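/- **Setting.** Let $\mathsf X,\mathsf Y$ be Polish spaces with their Borel $\sigma$-algebras, $\nu$ and $\lambda$ $\sigma$-finite measures on $\mathsf X$ and $\mathsf Y$, $\chi$ a probability measure on $\mathsf X$, $m:\mathsf X\times\mathsf X\to[0,\infty)$ a measurable transition density, $\int m(x,x')\,\nu(dx')=1$, with kernel $M(x,dx')=m(x,x')\,\nu(dx')$, and $g:\mathsf X\times\mathsf Y\to[0,\infty)$ measurable with $\int g(x,y)\,\lambda(dy)=1$. Fix an integer $T\ge 0$ and observations $y_0,\dots,y_T\in\mathsf Y$, and put $g_t(x)=g(x,y_t)$. For bounded measurable $h:\mathsf X^{T+1}\to\mathbb R$ and $0\le t\le T$ let $$L_{t,T}(x_{0:t},h)=\int\!\cdots\!\int\prod_{u=t+1}^{T}M(x_{u-1},dx_u)\,g_u(x_u)\;h(x_{0:T}),\qquad \phi_{0:T|T}(h)=\frac{\int\chi(dx_0)\,g_0(x_0)\,L_{0,T}(x_0,h)}{\int\chi(dx_0)\,g_0(x_0)\,L_{0,T}(x_0,\mathbf 1)}.$$ Let $\phi_t=\gamma_t/\gamma_t(\mathsf X)$ be the filter, where $\gamma_0(f)=\chi(g_0f)$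 and $\gamma_t(f)=\gamma_{t-1}M(g_tf)$. For a finite measure $\eta$ on $\mathsf X$ let $B_\eta(x,f)=\int\eta(dx')m(x',x)f(x')\big/\int\eta(dx')m(x',x)$ be the backward kernel (with $0/0=0$), and let $$F_{t,T}(x_t,h)=\int\!\cdots\!\int B_{\phi_{t-1}}(x_t,dx_{t-1})\cdots B_{\phi_0}(x_1,dx_0)\,L_{t,T}(x_{0:t},h),\qquad G_{t,T}(x,h)=F_{t,T}\bigl(x,h-\phi_{0:T|T}(h)\bigr),$$ with $F_{0,T}=L_{0,T}$. **Algorithm.** Let $\rho_0$ be a probability measure on $\mathsf X$ with $\chi\ll\rho_0$ and, for $1\le t\le T$, let $\vartheta_t:\mathsf X\to(0,\infty)$ be measurable and let $p_t:\mathsf X\times\mathsf X\to[0,\infty)$ be a measurable density, $\int p_t(x,x')\,\nu(dx')=1$, with kernel $P_t(x,dx')=p_t(x,x')\,\nu(dx')$. Fix a measurable nonnegative version of $d\chi/d\rho_0$ and put $$\omega_0(x)=\frac{d\chi}{d\rho_0}(x)\,g_0(x),\qquad \omega_t(x,x')=\frac{m(x,x')\,g_t(x')}{\vartheta_t(x)\,p_t(x,x')}\quad(t\ge1),$$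 with the conventions $0/0=0$ and $a/0=\infty$ for $a>0$. For every $N$, let $(\xi_t^i,\omega_t^i)_{1\le i\le N}$, $0\le t\le T$, be the weighted samples of the auxiliary particle filter: $\xi_0^1,\dots,\xi_0^N$ are i.i.d. with law $\rho_0$ and $\omega_0^i=\omega_0(\xi_0^i)$; for $1\le t\le T$, conditionally on $(\xi_s^i,\omega_s^i)_{s\le t-1,\,i\le N}$, the pairs $(I_t^i,\xi_t^i)$, $1\le i\le N$, are i.i.d. on $\{1,\dots,N\}\times\mathsf X$ with law proportional to $\omega_{t-1}^{j}\,\vartheta_t(\xi_{t-1}^{j})\,P_t(\xi_{t-1}^{j},dx)$ (on the event that all weights $\omega_{t-1}^j$ vanish the draw is arbitrary), and $\omega_t^i=\omega_t(\xi_{t-1}^{I_t^i},\xi_t^i)$. Let $\hat\phi_t=\sum_i\omega_t^i\,\delta_{\xi_t^i}\big/\sum_j\omega_t^j$ (zero if all weights vanish). The forward filtering backward smoothing estimator is $$\hat\phi_{0:T|T}(h)=\int\!\cdots\!\int\hat\phi_T(dx_T)\,B_{\hat\phi_{T-1}}(x_T,dx_{T-1})\cdots B_{\hat\phi_0}(x_1,dx_0)\,h(x_{0:T}).$$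 **Theorem.** Assume that 1. $g_t(x)>0$ for all $x\in\mathsf X$ and $0\le t\le T$, and $\sup_{0\le t\le T}\sup_x g_t(x)<\infty$; 2. $\sup_{1\le t\le T}\sup_x\vartheta_t(x)<\infty$ and $\sup_{0\le t\le T}\|\omega_t\|_\infty<\infty$; 3. $\sup_{x,x'}m(x,x')<\infty$ and $\sup_{1\le t\le T}\sup_{x,x'}p_t(x,x')<\infty$. Then for every bounded measurable $h:\mathsf X^{T+1}\to\mathbb R$, as $N\to\infty$, $$\sqrt N\,\bigl(\hat\phi_{0:T|T}(h)-\phi_{0:T|T}(h)\bigr)\;\xrightarrow{\ d\ }\;\mathcal N\bigl(0,\Gamma_{0:T|T}[h]\bigr),$$ where $\Gamma_{0:T|T}[h]\ge 0$ is given by $$\Gamma_{0:T|T}[h]=\frac{\rho_0\bigl[\omega_0^2\,G_{0,T}^2(\cdot,h)\bigr]}{\bigl(\rho_0[\omega_0\,F_{0,T}(\cdot,\mathbf 1)]\bigr)^2}+\sum_{t=1}^{T}\frac{\phi_{t-1}[\upsilon_{t,T}(\cdot,h)]\;\phi_{t-1}(\vartheta_t)}{\bigl(\phi_{t-1}[F_{t-1,T}(\cdot,\mathbf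 1)]\bigr)^2},$$ $$\upsilon_{t,T}(x,h)=\vartheta_t(x)\int P_t(x,dx')\,\omega_t^2(x,x')\,G_{t,T}^2(x',h),$$ and $\mathcal N(0,0)$ denotes the point mass at $0$. -/

import Mathlib

open MeasureTheory ProbabilityTheory Filter Topology
open scoped NNReal ENNReal

noncomputable section

namespace FFBS

variable {X Y : Type*} [MeasurableSpace X] [MeasurableSpace Y]

/-- A fully dominated state space model: initial distribution `χ`, reference measure `ν`,
transition density `m` with respect to `ν`, and observation density `obs` with respect to `lam`. -/
structure HMM (X Y : Type*) [MeasurableSpace X] [MeasurableSpace Y] where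
  χ : Measure X
  isProb_χ : IsProbabilityMeasure χ
  ν : Measure X
  sigmaFinite_ν : SigmaFinite ν
  m : X → X → ℝ
  measurable_m : Measurable (Function.uncurry m)
  m_nonneg : ∀ x x', 0 ≤ m x x'
  lintegral_m : ∀ x, ∫⁻ x', ENNReal.ofReal (m x x') ∂ν = 1
  lam : Measure Y
  sigmaFinite_lam : SigmaFinite lam
  obs : X → Y → ℝ
  measurable_obs : Measurable (Function.uncurry obs)
  obs_nonneg : ∀ x y, 0 ≤ obs x y
  lintegral_obs : ∀ x, ∫⁻ y, ENNReal.ofReal (obs x y) ∂lam = 1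

attribute [instance] HMM.isProb_χ HMM.sigmaFinite_ν HMM.sigmaFinite_lam

namespace HMM

variable (H : HMM X Y) (y : ℕ → Y)

/-- The transition kernel `M(x, dx') = m(x, x') ν(dx')`. -/
def M : Kernel X X :=
  Kernel.withDensity (Kernel.const X H.ν) (fun x x' => ENNReal.ofReal (H.m x x'))

/-- The likelihood `g_t(x) = g(x, y_t)` of the fixed observation record `y`. -/
def g (t : ℕ) (x : X) : ℝ := H.obs x (y t)

/-- The unnormalised filter: `γ_0(h) = χ(g_0 h)` and `γ_s(h) = γ_{s-1} M (g_s h)`. -/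
def γ : ℕ → Measure X
  | 0 => H.χ.withDensity (fun x => ENNReal.ofReal (H.g y 0 x))
  | t + 1 => ((γ t).bind H.M).withDensity (fun x => ENNReal.ofReal (H.g y (t + 1) x))

/-- The filtering distribution `φ_t = γ_t / γ_t(1)`. -/
def φ (t : ℕ) : Measure X := (H.γ y t Set.univ)⁻¹ • H.γ y t

/-- The backward kernel `B_η(x, f) = ∫ η(dx') m(x', x) f(x') / ∫ η(dx') m(x', x)`
(with value `0` where the denominator vanishes). -/
def B (η : Measure X) (x : X) (f : X → ℝ) : ℝ :=
  (∫ x', H.m x' x * f x' ∂η) / (∫ x', H.m x' x ∂η)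

/-- Functions on `X^{T+1}`, seen as functions of the first `T + 1` coordinates of a sequence. -/
def lift {T : ℕ} (h : (Fin (T + 1) → X) → ℝ) (x : ℕ → X) : ℝ := h (fun i => x i)

/-- The iterated integral `∫⋯∫ ∏_{u=t+1}^{t+k} M(x_{u-1}, dx_u) g_u(x_u) f(x)`, where the
coordinates `0, …, t` of the sequence `x` are given. -/
def forwardInt : (k t : ℕ) → ((ℕ → X) → ℝ) → (ℕ → X) → ℝ
  | 0, _, f, x => f x
  | k + 1, t, f, x =>
      ∫ x', H.g y (t + 1) x' * forwardInt k (t + 1) f (Function.update x (t + 1) x') ∂(H.M (x t))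

/-- The iterated integral `∫⋯∫ B_{η_{t-1}}(x_t, dx_{t-1}) ⋯ B_{η_0}(x_1, dx_0) f(x)`, where the
coordinates of `x` from `t` on are given. -/
def backwardInt (η : ℕ → Measure X) : (t : ℕ) → ((ℕ → X) → ℝ) → (ℕ → X) → ℝ
  | 0, f, x => f x
  | t + 1, f, x =>
      H.B (η t) (x (t + 1)) (fun x' => backwardInt η t f (Function.update x t x'))

/-- `L_{t,T}(x_{0:t}, h)`; only the coordinates `0, …, t` of `x` matter. Used for `t ≤ T`. -/
def L {T : ℕ} (t : ℕ) (h : (Fin (T + 1) → X) → ℝ) : (ℕ → X) → ℝ :=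
  H.forwardInt y (T - t) t (lift h)

/-- The unnormalised joint smoothing functional
`∫⋯∫ χ(dx_0) g_0(x_0) ∏_{u=1}^T M(x_{u-1}, dx_u) g_u(x_u) h(x_{0:T})`. -/
def unnormSmooth {T : ℕ} (h : (Fin (T + 1) → X) → ℝ) : ℝ :=
  ∫ x₀, H.g y 0 x₀ * H.forwardInt y T 0 (lift h) (fun _ => x₀) ∂H.χ

/-- The joint smoothing distribution `φ_{0:T|T}(h)`. -/
def smooth {T : ℕ} (h : (Fin (T + 1) → X) → ℝ) : ℝ :=
  H.unnormSmooth y h / H.unnormSmooth y (T := T) (fun _ => 1)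

/-- `F_{t,T}(x_t, h) = ∫⋯∫ B_{φ_{t-1}}(x_t, dx_{t-1}) ⋯ B_{φ_0}(x_1, dx_0) L_{t,T}(x_{0:t}, h)`.
Of the constant sequence only the coordinate `t` is used. -/
def F {T : ℕ} (t : ℕ) (x : X) (h : (Fin (T + 1) → X) → ℝ) : ℝ :=
  H.backwardInt (H.φ y) t (H.L y t h) (fun _ => x)

/-- `G_{t,T}(x, h) = F_{t,T}(x, h - φ_{0:T|T}(h))`. -/
def G {T : ℕ} (t : ℕ) (x : X) (h : (Fin (T + 1) → X) → ℝ) : ℝ :=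
  H.F y t x (fun z => h z - H.smooth y h)

/-- The likelihoods are positive and bounded up to time `T`. -/
def BoundedLikelihood (T : ℕ) : Prop :=
  (∀ t ≤ T, ∀ x, 0 < H.g y t x) ∧ ∃ C : ℝ, ∀ t ≤ T, ∀ x, H.g y t x ≤ C

end HMM

/-- The design of an auxiliary particle filter: the initial instrumental distribution `ρ₀` with a
version `dχ` of the Radon–Nikodym derivative `dχ/dρ₀`, and for every time `t ≥ 1` the adjustment
multiplier function `ϑ t` and the proposal density `p t` with respect to `ν`
(the values at `t = 0` are not used). -/
structure Proposal (H : HMM X Y) where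
  ρ₀ : Measure X
  isProb_ρ₀ : IsProbabilityMeasure ρ₀
  dχ : X → ℝ
  measurable_dχ : Measurable dχ
  dχ_nonneg : ∀ x, 0 ≤ dχ x
  χ_eq : H.χ = ρ₀.withDensity (fun x => ENNReal.ofReal (dχ x))
  ϑ : ℕ → X → ℝ
  measurable_ϑ : ∀ t, Measurable (ϑ t)
  ϑ_pos : ∀ t x, 0 < ϑ t x
  p : ℕ → X → X → ℝ
  measurable_p : ∀ t, Measurable (Function.uncurry (p t))
  p_nonneg : ∀ t x x', 0 ≤ p t x x'
  lintegral_p : ∀ t x, ∫⁻ x', ENNReal.ofReal (p t x x') ∂H.ν = 1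

attribute [instance] Proposal.isProb_ρ₀

namespace Proposal

variable {H : HMM X Y} (A : Proposal H) (y : ℕ → Y)

/-- The proposal kernel `P_t(x, dx') = p_t(x, x') ν(dx')`. -/
def P (t : ℕ) : Kernel X X :=
  Kernel.withDensity (Kernel.const X H.ν) (fun x x' => ENNReal.ofReal (A.p t x x'))

/-- The initial importance weight function `ω_0(x) = (dχ/dρ₀)(x) g_0(x)`. -/
def w₀ (x : X) : ℝ := A.dχ x * H.g y 0 x

/-- The importance weight function `ω_t(x, x') = m(x, x') g_t(x') / (ϑ_t(x) p_t(x, x'))`, `t ≥ 1`. -/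
def w (t : ℕ) (x x' : X) : ℝ := (H.m x x' * H.g y t x') / (A.ϑ t x * A.p t x x')

/-- `υ_{t,T}(x, h) = ϑ_t(x) ∫ P_t(x, dx') ω_t(x, x')² G_{t,T}(x', h)²`. -/
def upsilon {T : ℕ} (t : ℕ) (x : X) (h : (Fin (T + 1) → X) → ℝ) : ℝ :=
  A.ϑ t x * ∫ x', A.w y t x x' ^ 2 * H.G y t x' h ^ 2 ∂(A.P t x)

/-- The asymptotic variance `Γ_{0:T|T}[h]`; the summand of index `t` is the one of time `t + 1`. -/
def asymVar {T : ℕ} (h : (Fin (T + 1) → X) → ℝ) : ℝ :=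
  (∫ x, A.w₀ y x ^ 2 * H.G y 0 x h ^ 2 ∂A.ρ₀)
      / (∫ x, A.w₀ y x * H.F y (T := T) 0 x (fun _ => 1) ∂A.ρ₀) ^ 2
    + ∑ t ∈ Finset.range T,
        ((∫ x, A.upsilon y (t + 1) x h ∂(H.φ y t)) * (∫ x, A.ϑ (t + 1) x ∂(H.φ y t)))
          / (∫ x, H.F y (T := T) t x (fun _ => 1) ∂(H.φ y t)) ^ 2

/-- The adjustment multipliers and the importance weight functions are bounded up to time `T`.
The third clause says that no weight is a quotient of a positive number by zero. -/
def BoundedWeights (T : ℕ) : Prop :=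
  (∃ C : ℝ, ∀ t, 1 ≤ t → t ≤ T → ∀ x, A.ϑ t x ≤ C) ∧
  (∃ C : ℝ, ∀ x, A.w₀ y x ≤ C) ∧
  (∀ t, 1 ≤ t → t ≤ T → ∀ x x', A.p t x x' = 0 → H.m x x' = 0) ∧
  (∃ C : ℝ, ∀ t, 1 ≤ t → t ≤ T → ∀ x x', A.w y t x x' ≤ C)

/-- The transition density and the proposal densities are bounded up to time `T`. -/
def BoundedDensities (T : ℕ) : Prop :=
  (∃ C : ℝ, ∀ x x', H.m x x' ≤ C) ∧
  (∃ C : ℝ, ∀ t, 1 ≤ t → t ≤ T → ∀ x x', A.p t x x' ≤ C)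

section Particles

variable {Ω : Type*} {N : ℕ} (ξ : ℕ → Fin N → Ω → X) (I : ℕ → Fin N → Ω → Fin N)

/-- The importance weight of particle `i` at time `t`, for particles `ξ` and ancestor indices `I`. -/
def weight : (t : ℕ) → Fin N → Ω → ℝ
  | 0, i, ω => A.w₀ y (ξ 0 i ω)
  | t + 1, i, ω => A.w y (t + 1) (ξ t (I (t + 1) i ω) ω) (ξ (t + 1) i ω)

/-- The particle filter `φ̂_t = ∑ᵢ (ω_t^i / ∑ⱼ ω_t^j) δ_{ξ_t^i}` (zero if all weights vanish). -/
def filterHat (t : ℕ) (ω : Ω) : Measure X :=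
  (∑ i, ENNReal.ofReal (A.weight y ξ I t i ω))⁻¹ •
    ∑ i, ENNReal.ofReal (A.weight y ξ I t i ω) • Measure.dirac (ξ t i ω)

/-- The forward filtering backward smoothing estimator
`φ̂_{0:T|T}(h) = ∫⋯∫ φ̂_T(dx_T) B_{φ̂_{T-1}}(x_T, dx_{T-1}) ⋯ B_{φ̂_0}(x_1, dx_0) h(x_{0:T})`. -/
def smoothHat {T : ℕ} (h : (Fin (T + 1) → X) → ℝ) (ω : Ω) : ℝ :=
  ∫ x, H.backwardInt (fun t => A.filterHat y ξ I t ω) T (HMM.lift h) (fun _ => x)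
    ∂(A.filterHat y ξ I T ω)

/-- The instrumental distribution on `{1, …, N} × X` from which the pairs (index, particle) of
time `t + 1` are drawn, proportional to `ω_t^i ϑ_{t+1}(ξ_t^i) P_{t+1}(ξ_t^i, dx)`. -/
def instr (t : ℕ) (ω : Ω) : Measure (Fin N × X) :=
  (∑ i, ENNReal.ofReal (A.weight y ξ I t i ω * A.ϑ (t + 1) (ξ t i ω)))⁻¹ •
    ∑ i, ENNReal.ofReal (A.weight y ξ I t i ω * A.ϑ (t + 1) (ξ t i ω)) •
      (Measure.dirac i).prod (A.P (t + 1) (ξ t i ω))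

/-- The σ-algebra generated by the particles and weights up to time `t`. -/
@[reducible]
def hist (t : ℕ) : MeasurableSpace Ω :=
  ⨆ s ∈ Finset.range (t + 1), ⨆ i : Fin N,
    MeasurableSpace.comap (fun ω => (ξ s i ω, A.weight y ξ I s i ω)) inferInstance

/-- `ξ` and `I` are the particles and ancestor indices of an auxiliary particle filter with `N`
particles run up to time `T`: the initial particles are i.i.d. with law `ρ₀`, and, conditionally
on the particles and weights up to time `t`, the `N` pairs (index, particle) of time `t + 1` are
i.i.d. with the instrumental distribution. Nothing is prescribed on the event that all weights
of time `t` vanish, where that distribution is undefined. -/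
structure IsParticleFilter [MeasurableSpace Ω] (μ : Measure Ω) (T : ℕ) : Prop where
  measurable_ξ : ∀ t i, Measurable (ξ t i)
  measurable_I : ∀ t i, Measurable (I t i)
  indep_init : iIndepFun (fun i => ξ 0 i) μ
  law_init : ∀ i, μ.map (ξ 0 i) = A.ρ₀
  step : ∀ t < T, ∀ S : Set (Fin N → Fin N × X), MeasurableSet S →
    μ[Set.indicator {ω | (fun i => (I (t + 1) i ω, ξ (t + 1) i ω)) ∈ S} (fun _ => (1 : ℝ))
        | A.hist y ξ I t]
      =ᵐ[μ.restrict {ω | 0 < ∑ i, A.weight y ξ I t i ω}]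
        fun ω => (Measure.pi (fun _ : Fin N => A.instr y ξ I t ω)).real S

end Particles

end Proposal

end FFBS

end

/-!
Write `γ̂_t` for the unnormalised particle filter, whose total mass estimates the likelihood of
`y_0, …, y_t`, and evaluate it at `B_{φ̂_{t-1}} ⋯ B_{φ̂_0} L_{t,T}(·, f)` for `f` bounded with
`∫ L_{0,T}(·, f) dγ_0 = 0`. The result `Z_t` is a martingale in `t`: a weighted draw of ancestors
and proposals has conditional mean `γ̂_{t-1} M g_t`, and the backward kernel `B_{γ̂_{t-1}}` reverses
`γ̂_{t-1} M` exactly. Given the past, `Z_t` is moreover an average of `N` i.i.d. bounded variables,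
so its conditional characteristic function at scale `√N` is Gaussian up to `O(1 / √N)`. The
conditional variance converges in `L¹` to a constant, so the characteristic function of `√N Z_t` is
in the limit that of `√N Z_{t-1}` times a Gaussian factor, and the variances add up over time. For
`f = h - φ_{0:T|T}(h)`, almost surely `Z_T` is the error of the smoothing estimator times the total
mass of `γ̂_T`, which converges in probability to that of `γ_T`; Slutsky's theorem concludes.
-/

namespace FFBS

section IID

lemma norm_pow_sub_pow_le {R : Type*} [SeminormedRing R] [NormOneClass R] {a b : R}
    (ha : ‖a‖ ≤ 1) (hb : ‖b‖ ≤ 1) (n : ℕ) : ‖a ^ n - b ^ n‖ ≤ n * ‖a - b‖ := by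
  induction n with
  | zero => simp
  | succ n ih =>
    have hpow : ‖b ^ n‖ ≤ 1 := (norm_pow_le b n).trans (pow_le_one₀ (norm_nonneg _) hb)
    calc ‖a ^ (n + 1) - b ^ (n + 1)‖ = ‖a * (a ^ n - b ^ n) + (a - b) * b ^ n‖ := by
          rw [mul_sub, sub_mul, ← pow_succ', ← pow_succ', sub_add_sub_cancel]
      _ ≤ ‖a‖ * ‖a ^ n - b ^ n‖ + ‖a - b‖ * ‖b ^ n‖ :=
          (norm_add_le _ _).trans (add_le_add (norm_mul_le _ _) (norm_mul_le _ _))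
      _ ≤ 1 * (n * ‖a - b‖) + ‖a - b‖ * 1 := by gcongr
      _ = (n + 1 : ℕ) * ‖a - b‖ := by push_cast; ring

lemma abs_exp_neg_sub_one_sub_le {x : ℝ} (hx : 0 ≤ x) :
    |Real.exp (-x) - (1 - x)| ≤ x ^ 2 := by
  have hlower : 1 - x ≤ Real.exp (-x) := Real.one_sub_le_exp_neg x
  have hupper : Real.exp (-x) ≤ 1 - x + x ^ 2 / 2 := by
    rw [Real.exp_neg, inv_le_iff_one_le_mul₀ (Real.exp_pos x)]
    calc (1 : ℝ) ≤ (1 - x + x ^ 2 / 2) * (1 + x + x ^ 2 / 2) := by nlinarith [sq_nonneg (x ^ 2)]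
      _ ≤ (1 - x + x ^ 2 / 2) * Real.exp x := by
          gcongr
          · nlinarith [sq_nonneg (1 - x)]
          · exact Real.quadratic_le_exp_of_nonneg hx
  rw [abs_of_nonneg (by linarith)]
  nlinarith [sq_nonneg x]

lemma norm_integral_cexp_sub_one_sub_le {α : Type*} [MeasurableSpace α] {μ : Measure α}
    [IsProbabilityMeasure μ] {X : α → ℝ} {K : ℝ} (hX : AEMeasurable X μ)
    (hK : ∀ᵐ x ∂μ, |X x| ≤ K) (hmean : ∫ x, X x ∂μ = 0) (s : ℝ) :
    ‖∫ x, Complex.exp (Complex.I * (s * X x : ℝ)) ∂μ - (1 - s ^ 2 * Var[X; μ] / 2 : ℝ)‖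
      ≤ (|s| * K) ^ 3 * Real.exp (|s| * K) := by
  have hL2 : MemLp X 2 μ := MemLp.of_bound hX.aestronglyMeasurable K hK
  have hlin : Integrable (fun x => Complex.I * s * (X x : ℂ)) μ :=
    ((hL2.integrable one_le_two).ofReal (𝕜 := ℂ)).const_mul _
  have haff : Integrable (fun x => 1 + Complex.I * s * (X x : ℂ)) μ := (integrable_const _).add hlin
  have hquad : Integrable (fun x => ((s ^ 2 / 2 : ℝ) : ℂ) * ((X x ^ 2 : ℝ) : ℂ)) μ :=
    (hL2.integrable_sq.ofReal (𝕜 := ℂ)).const_mul _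
  have hexp : Integrable (fun x => Complex.exp (Complex.I * (s * X x : ℝ))) μ :=
    Integrable.of_bound (by fun_prop) 1
      (ae_of_all _ fun x => by rw [Complex.norm_exp_I_mul_ofReal])
  have hTaylor : ((1 - s ^ 2 * Var[X; μ] / 2 : ℝ) : ℂ) = ∫ x, ((1 : ℂ)
      + Complex.I * s * (X x : ℂ) - ((s ^ 2 / 2 : ℝ) : ℂ) * ((X x ^ 2 : ℝ) : ℂ)) ∂μ := by
    rw [integral_sub haff hquad, integral_add (integrable_const _) hlin, integral_const_mul,
      integral_const_mul, integral_complex_ofReal, integral_complex_ofReal, hmean,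
      variance_of_integral_eq_zero hX hmean]
    simp
    ring
  rw [hTaylor, ← integral_sub hexp (by exact haff.sub hquad)]
  refine (norm_integral_le_of_norm_le_const (C := (|s| * K) ^ 3 * Real.exp (|s| * K)) ?_).trans
    (by simp)
  filter_upwards [hK] with x hx
  have hnorm : ‖Complex.I * (s * X x : ℝ)‖ ≤ |s| * K := by
    rw [norm_mul, Complex.norm_I, one_mul, Complex.norm_real, Real.norm_eq_abs, abs_mul]
    gcongr
  have hsum : ∑ m ∈ Finset.range 3, (Complex.I * (s * X x : ℝ)) ^ m / (m.factorial : ℂ)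
      = 1 + Complex.I * s * (X x : ℂ) - ((s ^ 2 / 2 : ℝ) : ℂ) * ((X x ^ 2 : ℝ) : ℂ) := by
    simp [Finset.sum_range_succ, mul_pow, Nat.factorial]
    ring
  rw [← hsum]
  refine (Complex.norm_exp_sub_sum_le_norm_mul_exp _ 3).trans ?_
  have := (norm_nonneg _).trans hnorm
  gcongr

/-- The constant in the Gaussian approximation, at frequency `u`, of the characteristic function
of a normalised sum of i.i.d. variables bounded by `K`. -/
noncomputable def cltConst (u K : ℝ) : ℝ :=
  (2 * |u| * K) ^ 3 * Real.exp (2 * |u| * K) + (u * K) ^ 4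

lemma mul_cltConst_div_sqrt_le {N : ℕ} (hN : N ≠ 0) (u : ℝ) {K : ℝ} (hK : 0 ≤ K) :
    N * cltConst (u / √N) K ≤ cltConst u K / √N := by
  have hone : 1 ≤ √(N : ℝ) := by
    rw [Real.one_le_sqrt]
    exact_mod_cast Nat.one_le_iff_ne_zero.2 hN
  have hsq : (N : ℝ) = √N ^ 2 := (Real.sq_sqrt (Nat.cast_nonneg N)).symm
  set r := √(N : ℝ)
  have hr : 0 < r := by linarith
  have hexp : Real.exp (2 * |u / r| * K) ≤ Real.exp (2 * |u| * K) := by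
    have : |u / r| ≤ |u| := by
      rw [abs_div, abs_of_pos hr]
      exact div_le_self (abs_nonneg u) hone
    gcongr
  have hquart : (u * K) ^ 4 / r ^ 2 ≤ (u * K) ^ 4 / r := by
    gcongr
    exact le_self_pow₀ hone two_ne_zero
  calc N * cltConst (u / r) K
      ≤ N * ((2 * |u / r| * K) ^ 3 * Real.exp (2 * |u| * K) + (u / r * K) ^ 4) := by
        rw [cltConst]
        gcongr
    _ = (2 * |u| * K) ^ 3 * Real.exp (2 * |u| * K) / r + (u * K) ^ 4 / r ^ 2 := by
        rw [hsq, abs_div, abs_of_pos hr]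
        field_simp
    _ ≤ cltConst u K / r := by
        rw [cltConst, add_div]
        gcongr

variable {N : ℕ} {ρ : Measure ℝ} [IsProbabilityMeasure ρ] {K : ℝ}

lemma memLp_id_of_ae_abs_le (hK : ∀ᵐ x ∂ρ, |x| ≤ K) : MemLp id 2 ρ :=
  MemLp.of_bound aestronglyMeasurable_id K hK

lemma variance_id_le_sq (hK : ∀ᵐ x ∂ρ, |x| ≤ K) : Var[id; ρ] ≤ K ^ 2 := by
  have h := variance_le_sq_of_bounded (hK.mono fun x hx => abs_le.1 hx) aemeasurable_id
  rwa [sub_neg_eq_add, add_self_div_two] at h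

lemma integral_pi_average (hN : N ≠ 0) (hρ : Integrable (fun x => x) ρ) :
    ∫ z, (N : ℝ)⁻¹ * ∑ i, z i ∂(Measure.pi fun _ : Fin N => ρ) = ∫ x, x ∂ρ := by
  have hcoord (i : Fin N) : ∫ z, z i ∂(Measure.pi fun _ : Fin N => ρ) = ∫ x, x ∂ρ :=
    integral_comp_eval (μ := fun _ : Fin N => ρ) aestronglyMeasurable_id
  rw [integral_const_mul, integral_finsetSum _ fun i _ =>
    integrable_comp_eval (μ := fun _ : Fin N => ρ) (i := i) (f := fun x => x) hρ]
  simp [hcoord, hN]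

lemma variance_pi_average (hN : N ≠ 0) (hρ : MemLp id 2 ρ) :
    Var[fun z => (N : ℝ)⁻¹ * ∑ i, z i; Measure.pi fun _ : Fin N => ρ] = Var[id; ρ] / N := by
  have hsum := variance_sum_pi (μ := fun _ : Fin N => ρ) (X := fun _ => id) fun _ => hρ
  have hfun : (∑ i, fun z : Fin N → ℝ => id (z i)) = fun z => ∑ i, z i := by
    ext z
    simp
  rw [hfun] at hsum
  rw [variance_const_mul, hsum]
  simp only [Finset.sum_const, Finset.card_univ, Fintype.card_fin, nsmul_eq_mul]
  field_simp

lemma integral_pi_average_sub_sq_le (hN : N ≠ 0) (hK : ∀ᵐ x ∂ρ, |x| ≤ K) :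
    ∫ z, ((N : ℝ)⁻¹ * ∑ i, z i - ∫ x, x ∂ρ) ^ 2 ∂(Measure.pi fun _ : Fin N => ρ) ≤ K ^ 2 / N := by
  have hρ := memLp_id_of_ae_abs_le hK
  rw [← integral_pi_average hN (hρ.integrable one_le_two), ← variance_eq_integral (by fun_prop),
    variance_pi_average hN hρ]
  gcongr
  exact variance_id_le_sq hK

lemma norm_integral_cexp_centered_sub_le (hK : ∀ᵐ x ∂ρ, |x| ≤ K) (s : ℝ) :
    ‖∫ x, Complex.exp (Complex.I * (s * (x - ∫ x, x ∂ρ) : ℝ)) ∂ρ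
        - (Real.exp (-(s ^ 2 * Var[id; ρ] / 2)) : ℝ)‖ ≤ cltConst s K := by
  have hρ := memLp_id_of_ae_abs_le hK
  set a := ∫ x, x ∂ρ with ha
  have haK : |a| ≤ K := by
    simpa using norm_integral_le_of_norm_le_const (f := fun x : ℝ => x) hK
  have hbound : ∀ᵐ x ∂ρ, |x - a| ≤ 2 * K := by
    filter_upwards [hK] with x hx
    linarith [abs_sub x a]
  have hint : Integrable (fun x => x) ρ := hρ.integrable one_le_two
  have hmean : ∫ x, (x - a) ∂ρ = 0 := by
    rw [integral_sub hint (integrable_const _), ← ha]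
    simp
  have hvar : Var[fun x => x - a; ρ] = Var[id; ρ] := variance_sub_const (by fun_prop) a
  have hTaylor := norm_integral_cexp_sub_one_sub_le (by fun_prop) hbound hmean s
  have hGauss := abs_exp_neg_sub_one_sub_le (x := s ^ 2 * Var[id; ρ] / 2)
    (by have := variance_nonneg id ρ; positivity)
  have hquart : (s ^ 2 * Var[id; ρ] / 2) ^ 2 ≤ (s * K) ^ 4 := by
    have h : s ^ 2 * Var[id; ρ] ≤ s ^ 2 * K ^ 2 := by
      gcongr
      exact variance_id_le_sq hK
    have h0 : 0 ≤ s ^ 2 * Var[id; ρ] := mul_nonneg (sq_nonneg s) (variance_nonneg id ρ)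
    calc (s ^ 2 * Var[id; ρ] / 2) ^ 2 ≤ (s ^ 2 * K ^ 2) ^ 2 := by gcongr; linarith
      _ = (s * K) ^ 4 := by ring
  rw [hvar, show |s| * (2 * K) = 2 * |s| * K by ring] at hTaylor
  rw [← Real.norm_eq_abs, ← Complex.norm_real, Complex.ofReal_sub, norm_sub_rev] at hGauss
  refine (norm_sub_le_norm_sub_add_norm_sub _ _ _).trans (add_le_add hTaylor ?_)
  exact hGauss.trans hquart

lemma integral_pi_cexp_average (hN : N ≠ 0) (u a : ℝ) :
    ∫ z, Complex.exp (Complex.I * (u * (√N * ((N : ℝ)⁻¹ * ∑ i, z i)) : ℝ))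
        ∂(Measure.pi fun _ : Fin N => ρ)
      = Complex.exp (Complex.I * (u * (√N * a) : ℝ))
        * (∫ x, Complex.exp (Complex.I * (u / √N * (x - a) : ℝ)) ∂ρ) ^ N := by
  have hN' : (0 : ℝ) < N := by positivity
  have hsqrt : √(N : ℝ) * √(N : ℝ) = N := Real.mul_self_sqrt hN'.le
  have hprod := integral_fintype_prod_eq_pow (ι := Fin N) (μ := ρ)
    fun x => Complex.exp (Complex.I * (u / √N * (x - a) : ℝ))
  rw [Fintype.card_fin] at hprod
  rw [← hprod, ← integral_const_mul]
  congr 1 with z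
  rw [← Complex.exp_sum, ← Complex.exp_add, ← Finset.mul_sum, ← mul_add, ← Complex.ofReal_sum,
    ← Complex.ofReal_add, ← Finset.mul_sum, Finset.sum_sub_distrib]
  congr 3
  simp only [Finset.sum_const, Finset.card_univ, Fintype.card_fin, nsmul_eq_mul]
  have : 0 < √(N : ℝ) := Real.sqrt_pos.2 hN'
  field_simp
  linear_combination (u * ∑ i, z i - u * N * a) * hsqrt

lemma norm_integral_pi_cexp_average_sub_le (hN : N ≠ 0) (hK : ∀ᵐ x ∂ρ, |x| ≤ K) (u : ℝ) :
    ‖∫ z, Complex.exp (Complex.I * (u * (√N * ((N : ℝ)⁻¹ * ∑ i, z i)) : ℝ))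
          ∂(Measure.pi fun _ : Fin N => ρ)
        - Complex.exp (Complex.I * (u * (√N * ∫ x, x ∂ρ) : ℝ))
          * Real.exp (-(u ^ 2 * Var[id; ρ] / 2))‖ ≤ cltConst u K / √N := by
  have hK0 : 0 ≤ K := by
    obtain ⟨x, hx⟩ := hK.exists
    exact (abs_nonneg x).trans hx
  set s := u / √N with hs
  have hpow : ((Real.exp (-(u ^ 2 * Var[id; ρ] / 2)) : ℝ) : ℂ)
      = ((Real.exp (-(s ^ 2 * Var[id; ρ] / 2)) : ℝ) : ℂ) ^ N := by
    rw [← Complex.ofReal_pow, ← Real.exp_nat_mul, hs, div_pow, Real.sq_sqrt (Nat.cast_nonneg N)]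
    congr 2
    field_simp
  have hchar : ‖∫ x, Complex.exp (Complex.I * (s * (x - ∫ x, x ∂ρ) : ℝ)) ∂ρ‖ ≤ 1 :=
    (norm_integral_le_of_norm_le_const (C := 1)
      (ae_of_all _ fun z => by rw [Complex.norm_exp_I_mul_ofReal])).trans (by simp)
  have hGauss : ‖((Real.exp (-(s ^ 2 * Var[id; ρ] / 2)) : ℝ) : ℂ)‖ ≤ 1 := by
    rw [Complex.norm_real, Real.norm_eq_abs, Real.abs_exp, Real.exp_le_one_iff, neg_nonpos]
    have := variance_nonneg id ρ
    positivity
  rw [integral_pi_cexp_average hN u (∫ x, x ∂ρ), hpow, ← mul_sub, norm_mul,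
    Complex.norm_exp_I_mul_ofReal, one_mul]
  refine (norm_pow_sub_pow_le hchar hGauss N).trans ?_
  refine le_trans ?_ (mul_cltConst_div_sqrt_le hN u hK0)
  gcongr
  exact norm_integral_cexp_centered_sub_le hK s

end IID

end FFBS

namespace FFBS

lemma abs_integral_le_of_abs_le {α : Type*} [MeasurableSpace α] {μ : Measure α}
    [IsProbabilityMeasure μ] {f : α → ℝ} {K : ℝ} (hK : ∀ᵐ x ∂μ, |f x| ≤ K) :
    |∫ x, f x ∂μ| ≤ K := by
  simpa using norm_integral_le_of_norm_le_const (μ := μ) (f := f) hK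

section CondIID

variable {Ω E 𝒵 : Type*} [MeasurableSpace Ω] [MeasurableSpace E] [MeasurableSpace 𝒵] {N : ℕ}
  {μ : Measure Ω}

lemma map_prodMk_restrict_eq_compProd_of_condExp [IsFiniteMeasure μ] {V : Ω → E} {W : Ω → 𝒵}
    {D : Set E} {κ : Kernel E 𝒵} [IsMarkovKernel κ] (hV : Measurable V) (hW : Measurable W)
    (hD : MeasurableSet D)
    (h : ∀ S : Set 𝒵, MeasurableSet S →
      μ[(W ⁻¹' S).indicator (fun _ => (1 : ℝ)) | MeasurableSpace.comap V ‹_›]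
        =ᵐ[μ.restrict (V ⁻¹' D)] fun ω => (κ (V ω)).real S) :
    (μ.restrict (V ⁻¹' D)).map (fun ω => (V ω, W ω)) = (μ.restrict (V ⁻¹' D)).map V ⊗ₘ κ := by
  refine Measure.ext_prod fun {A S} hA hS => ?_
  rw [Measure.compProd_apply_prod hA hS, Measure.map_apply (hV.prodMk hW) (hA.prod hS),
    setLIntegral_map hA (κ.measurable_coe hS) hV, Measure.restrict_restrict (hV hA),
    ← Set.preimage_inter]
  have hWS : MeasurableSet (W ⁻¹' S) := hW hS
  have hcond : ∫ ω in V ⁻¹' (A ∩ D), (κ (V ω)).real S ∂μ = μ.real (V ⁻¹' (A ∩ D) ∩ W ⁻¹' S) := by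
    have hAD : MeasurableSet[MeasurableSpace.comap V ‹_›] (V ⁻¹' (A ∩ D)) := ⟨_, hA.inter hD, rfl⟩
    have hac : μ.restrict (V ⁻¹' (A ∩ D)) ≪ μ.restrict (V ⁻¹' D) :=
      Measure.absolutelyContinuous_of_le (Measure.restrict_mono_set _ Set.inter_subset_right)
    rw [← integral_congr_ae (hac.ae_eq (h S hS)), setIntegral_condExp hV.comap_le
      ((integrable_const _).indicator hWS) hAD, setIntegral_indicator hWS, setIntegral_const,
      smul_eq_mul, mul_one]
  have hlintegral : ENNReal.ofReal (∫ ω in V ⁻¹' (A ∩ D), (κ (V ω)).real S ∂μ)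
      = ∫⁻ ω in V ⁻¹' (A ∩ D), κ (V ω) S ∂μ := by
    rw [ofReal_integral_eq_lintegral_ofReal _ (ae_of_all _ fun ω => measureReal_nonneg)]
    · simp only [Measure.real, ENNReal.ofReal_toReal (measure_ne_top _ _)]
    · exact Integrable.of_bound ((κ.measurable_coe hS).comp hV).ennreal_toReal.aestronglyMeasurable
        1 (ae_of_all _ fun ω => by simp [abs_of_nonneg measureReal_nonneg, measureReal_le_one])
  rw [← hlintegral, hcond, ofReal_measureReal, Measure.restrict_apply' (hV hD)]
  congr 1
  ext ω
  simp only [Set.mem_inter_iff, Set.mem_preimage, Set.mem_prod]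
  tauto

/-- The kernel whose values are the laws of `N` independent draws from the values of `κ`. -/
noncomputable def iidKernel (N : ℕ) (κ : Kernel E 𝒵) [IsMarkovKernel κ] :
    Kernel E (Fin N → 𝒵) where
  toFun e := Measure.pi fun _ => κ e
  measurable' := by
    refine Measurable.measure_of_isPiSystem_of_isProbabilityMeasure generateFrom_pi.symm
      isPiSystem_pi ?_
    rintro _ ⟨s, hs, rfl⟩
    simp_rw [Measure.pi_pi]
    exact Finset.measurable_prod _ fun i _ => κ.measurable_coe (hs i (Set.mem_univ i))

lemma iidKernel_apply (κ : Kernel E 𝒵) [IsMarkovKernel κ] (e : E) :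
    iidKernel N κ e = Measure.pi fun _ => κ e := rfl

instance (κ : Kernel E 𝒵) [IsMarkovKernel κ] : IsMarkovKernel (iidKernel N κ) :=
  ⟨fun e => by rw [iidKernel_apply]; infer_instance⟩

/-- The variables `ζ i` are conditionally i.i.d. with law `κ V`, given `V`. The measure `μ` is
allowed to be the restriction of a probability measure to an event. -/
def IsCondIID (μ : Measure Ω) (V : Ω → E) (κ : Kernel E 𝒵) [IsMarkovKernel κ]
    (ζ : Fin N → Ω → 𝒵) : Prop :=
  μ.map (fun ω => (V ω, fun i => ζ i ω)) = μ.map V ⊗ₘ iidKernel N κ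

namespace IsCondIID

variable {V : Ω → E} {κ : Kernel E 𝒵} [IsMarkovKernel κ] {ζ : Fin N → Ω → 𝒵}

lemma lintegral_eq [SFinite μ] (h : IsCondIID μ V κ ζ) (hV : Measurable V)
    (hζ : ∀ i, Measurable (ζ i)) {f : E × (Fin N → 𝒵) → ℝ≥0∞} (hf : Measurable f) :
    ∫⁻ ω, f (V ω, fun i => ζ i ω) ∂μ = ∫⁻ ω, ∫⁻ z, f (V ω, z) ∂(iidKernel N κ (V ω)) ∂μ := by
  rw [← lintegral_map hf (hV.prodMk (measurable_pi_lambda _ hζ)), h, Measure.lintegral_compProd hf,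
    lintegral_map hf.lintegral_kernel_prod_right' hV]

lemma integral_eq [IsFiniteMeasure μ] {F : Type*} [NormedAddCommGroup F] [NormedSpace ℝ F]
    (h : IsCondIID μ V κ ζ) (hV : Measurable V) (hζ : ∀ i, Measurable (ζ i))
    {f : E × (Fin N → 𝒵) → F} (hf : StronglyMeasurable f)
    (hint : Integrable (fun ω => f (V ω, fun i => ζ i ω)) μ) :
    ∫ ω, f (V ω, fun i => ζ i ω) ∂μ = ∫ ω, ∫ z, f (V ω, z) ∂(iidKernel N κ (V ω)) ∂μ := by
  have hVζ := hV.prodMk (measurable_pi_lambda _ hζ)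
  have hint' := (integrable_map_measure hf.aestronglyMeasurable hVζ.aemeasurable).2 hint
  rw [← integral_map hVζ.aemeasurable hf.aestronglyMeasurable]
  rw [h] at hint' ⊢
  rw [Measure.integral_compProd hint', integral_map hV.aemeasurable]
  exact (hf.integral_kernel_prod_right' (κ := iidKernel N κ)).aestronglyMeasurable

end IsCondIID

/-- The image under `Ψ e` of the value at `e` of a kernel. -/
noncomputable def mapKernel (κ : Kernel E 𝒵) (Ψ : E → 𝒵 → ℝ) : Kernel E ℝ :=
  (Kernel.id ×ₖ κ).map (Function.uncurry Ψ)

lemma mapKernel_apply (κ : Kernel E 𝒵) [IsSFiniteKernel κ] {Ψ : E → 𝒵 → ℝ}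
    (hΨ : Measurable (Function.uncurry Ψ)) (e : E) : mapKernel κ Ψ e = (κ e).map (Ψ e) := by
  ext s hs
  rw [mapKernel, Kernel.map_apply' _ hΨ _ hs, Kernel.id_prod_apply' _ _ (hΨ hs),
    Measure.map_apply hΨ.of_uncurry_left hs]
  rfl

lemma isMarkovKernel_mapKernel (κ : Kernel E 𝒵) [IsMarkovKernel κ] {Ψ : E → 𝒵 → ℝ}
    (hΨ : Measurable (Function.uncurry Ψ)) : IsMarkovKernel (mapKernel κ Ψ) :=
  Kernel.IsMarkovKernel.map _ hΨ

lemma lintegral_iidKernel_mapKernel (κ : Kernel E 𝒵) [IsMarkovKernel κ] {Ψ : E → 𝒵 → ℝ}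
    (hΨ : Measurable (Function.uncurry Ψ)) [IsMarkovKernel (mapKernel κ Ψ)] (e : E)
    {f : (Fin N → ℝ) → ℝ≥0∞} (hf : Measurable f) :
    ∫⁻ x, f x ∂(iidKernel N (mapKernel κ Ψ) e)
      = ∫⁻ z, f (fun i => Ψ e (z i)) ∂(iidKernel N κ e) := by
  have hΨe : Measurable (Ψ e) := hΨ.of_uncurry_left
  have (_ : Fin N) : IsProbabilityMeasure ((κ e).map (Ψ e)) :=
    Measure.isProbabilityMeasure_map hΨe.aemeasurable
  simp only [iidKernel_apply, mapKernel_apply κ hΨ]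
  rw [← Measure.pi_map_pi (fun _ => hΨe.aemeasurable), lintegral_map hf (by fun_prop)]

/-- Draws that are only specified on an event `V ∈ D` become conditionally i.i.d. without
restriction once they are mapped to `0` off that event. -/
lemma IsCondIID.map_of_restrict [IsFiniteMeasure μ] {V : Ω → E} {D : Set E} {κ : Kernel E 𝒵}
    [IsMarkovKernel κ] {ζ : Fin N → Ω → 𝒵} (h : IsCondIID (μ.restrict (V ⁻¹' D)) V κ ζ)
    (hV : Measurable V) (hD : MeasurableSet D) (hζ : ∀ i, Measurable (ζ i)) {Ψ : E → 𝒵 → ℝ}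
    (hΨ : Measurable (Function.uncurry Ψ)) (hΨ0 : ∀ e ∉ D, ∀ z, Ψ e z = 0)
    [IsMarkovKernel (mapKernel κ Ψ)] :
    IsCondIID μ V (mapKernel κ Ψ) fun i ω => Ψ (V ω) (ζ i ω) := by
  have hΨζ : Measurable fun ω => (V ω, fun i => Ψ (V ω) (ζ i ω)) :=
    hV.prodMk (measurable_pi_lambda _ fun i => hΨ.comp (hV.prodMk (hζ i)))
  refine Measure.ext_of_lintegral _ fun f hf => ?_
  have hfΨ : Measurable fun p : E × (Fin N → 𝒵) => f (p.1, fun i => Ψ p.1 (p.2 i)) := by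
    refine hf.comp (measurable_fst.prodMk (measurable_pi_lambda _ fun i => ?_))
    exact hΨ.comp (measurable_fst.prodMk ((measurable_pi_apply i).comp measurable_snd))
  rw [lintegral_map hf hΨζ, Measure.lintegral_compProd hf,
    lintegral_map hf.lintegral_kernel_prod_right' hV]
  have hker (e : E) : ∫⁻ x, f (e, x) ∂(iidKernel N (mapKernel κ Ψ) e)
      = ∫⁻ z, f (e, fun i => Ψ e (z i)) ∂(iidKernel N κ e) :=
    lintegral_iidKernel_mapKernel κ hΨ e (hf.comp measurable_prodMk_left)
  simp only [hker]
  rw [← lintegral_add_compl _ (hV hD), ← lintegral_add_compl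
    (fun ω => ∫⁻ z, f (V ω, fun i => Ψ (V ω) (z i)) ∂(iidKernel N κ (V ω))) (hV hD)]
  refine congrArg₂ (· + ·) (h.lintegral_eq hV hζ hfΨ) ?_
  refine setLIntegral_congr_fun (hV hD).compl fun ω (hω : V ω ∉ D) => ?_
  simp [hΨ0 _ hω]

/-- `Z` is an average of `N` real random variables bounded by `K` which, given `V`, are
conditionally i.i.d. with mean `a` and second moment `q`. -/
def IsCondIIDAverage (μ : Measure Ω) (V : Ω → E) (N : ℕ) (K : ℝ) (Z a q : Ω → ℝ) : Prop :=
  ∃ (κ : Kernel E ℝ) (_ : IsMarkovKernel κ) (ζ : Fin N → Ω → ℝ),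
    Measurable V ∧ (∀ i, Measurable (ζ i)) ∧ IsCondIID μ V κ ζ ∧
    (∀ ω, ∀ᵐ x ∂(κ (V ω)), |x| ≤ K) ∧ (∀ i ω, |ζ i ω| ≤ K) ∧
    (∀ ω, Z ω = (N : ℝ)⁻¹ * ∑ i, ζ i ω) ∧ (∀ ω, a ω = ∫ x, x ∂(κ (V ω))) ∧
    ∀ ω, q ω = ∫ x, x ^ 2 ∂(κ (V ω))

lemma IsCondIID.isCondIIDAverage [IsFiniteMeasure μ] {V : Ω → E} {D : Set E} {κ : Kernel E 𝒵}
    [IsMarkovKernel κ] {ζ : Fin N → Ω → 𝒵} (h : IsCondIID (μ.restrict (V ⁻¹' D)) V κ ζ)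
    (hV : Measurable V) (hD : MeasurableSet D) (hζ : ∀ i, Measurable (ζ i)) {Ψ : E → 𝒵 → ℝ}
    (hΨ : Measurable (Function.uncurry Ψ)) (hΨ0 : ∀ e ∉ D, ∀ z, Ψ e z = 0) {K : ℝ}
    (hK : ∀ ω z, |Ψ (V ω) z| ≤ K) :
    IsCondIIDAverage μ V N K (fun ω => (N : ℝ)⁻¹ * ∑ i, Ψ (V ω) (ζ i ω))
      (fun ω => ∫ z, Ψ (V ω) z ∂(κ (V ω))) fun ω => ∫ z, Ψ (V ω) z ^ 2 ∂(κ (V ω)) := by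
  have hmap := mapKernel_apply κ hΨ
  have hΨe (e : E) : Measurable (Ψ e) := hΨ.of_uncurry_left
  have := isMarkovKernel_mapKernel κ hΨ
  refine ⟨mapKernel κ Ψ, this, fun i ω => Ψ (V ω) (ζ i ω), hV,
    fun i => hΨ.comp (hV.prodMk (hζ i)), h.map_of_restrict hV hD hζ hΨ hΨ0, fun ω => ?_,
    fun i ω => hK _ _, fun ω => rfl, fun ω => ?_, fun ω => ?_⟩
  · rw [hmap, ae_map_iff (hΨe _).aemeasurable (measurableSet_le (by fun_prop) (by fun_prop))]
    exact ae_of_all _ (hK ω)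
  · rw [hmap, integral_map (hΨe _).aemeasurable (by fun_prop)]
  · rw [hmap, integral_map (hΨe _).aemeasurable (by fun_prop)]

namespace IsCondIIDAverage

variable {V : Ω → E} {K : ℝ} {Z a q : Ω → ℝ}

lemma measurable_mean (h : IsCondIIDAverage μ V N K Z a q) : Measurable a := by
  obtain ⟨κ, _, -, hV, -, -, -, -, -, ha, -⟩ := h
  rw [funext ha]
  exact (StronglyMeasurable.integral_kernel_prod_right' (κ := κ) (f := Prod.snd)
    measurable_snd.stronglyMeasurable).measurable.comp hV

lemma measurable_secondMoment (h : IsCondIIDAverage μ V N K Z a q) : Measurable q := by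
  obtain ⟨κ, _, -, hV, -, -, -, -, -, -, hq⟩ := h
  rw [funext hq]
  exact (StronglyMeasurable.integral_kernel_prod_right' (κ := κ) (f := fun p => p.2 ^ 2)
    (measurable_snd.pow_const 2).stronglyMeasurable).measurable.comp hV

variable [IsProbabilityMeasure μ]

lemma integral_eq (h : IsCondIIDAverage μ V N K Z a q) (hN : N ≠ 0) :
    ∫ ω, Z ω ∂μ = ∫ ω, a ω ∂μ := by
  obtain ⟨κ, _, ζ, hV, hζ, hcond, hκ, hζK, hZ, ha, -⟩ := h
  simp only [hZ, ha]
  rw [hcond.integral_eq hV hζ (f := fun p => (N : ℝ)⁻¹ * ∑ i, p.2 i)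
    (Measurable.stronglyMeasurable (by fun_prop))]
  · congr 1 with ω
    exact integral_pi_average hN ((memLp_id_of_ae_abs_le (hκ ω)).integrable one_le_two)
  · exact (integrable_finsetSum _ fun i _ => Integrable.of_bound (hζ i).aestronglyMeasurable K
      (ae_of_all _ (hζK i))).const_mul _

lemma memLp_average (h : IsCondIIDAverage μ V N K Z a q) : MemLp Z 2 μ := by
  obtain ⟨κ, _, ζ, -, hζ, -, -, hζK, hZ, -, -⟩ := h
  have hsum : MemLp (fun ω => ∑ i, ζ i ω) 2 μ := memLp_finsetSum _ fun i _ =>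
    MemLp.of_bound (hζ i).aestronglyMeasurable K (ae_of_all _ (hζK i))
  rw [funext hZ]
  exact hsum.const_mul _

lemma memLp_mean (h : IsCondIIDAverage μ V N K Z a q) : MemLp a 2 μ := by
  have ha_meas := h.measurable_mean
  obtain ⟨κ, _, -, -, -, -, hκ, -, -, ha, -⟩ := h
  refine MemLp.of_bound ha_meas.aestronglyMeasurable K (ae_of_all _ fun ω => ?_)
  rw [ha]
  exact abs_integral_le_of_abs_le (hκ ω)

lemma integral_sub_sq_le (h : IsCondIIDAverage μ V N K Z a q) (hN : N ≠ 0) :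
    ∫ ω, (Z ω - a ω) ^ 2 ∂μ ≤ K ^ 2 / N := by
  have hsq : Integrable (fun ω => (Z ω - a ω) ^ 2) μ :=
    (h.memLp_average.sub h.memLp_mean).integrable_sq
  obtain ⟨κ, _, ζ, hV, hζ, hcond, hκ, -, hZ, ha, -⟩ := h
  have hκ_mean : Measurable fun p : E × (Fin N → ℝ) => ∫ x, x ∂(κ p.1) :=
    (StronglyMeasurable.integral_kernel_prod_right' (κ := κ) (f := Prod.snd)
      measurable_snd.stronglyMeasurable).measurable.comp measurable_fst
  have hdev : StronglyMeasurable fun p : E × (Fin N → ℝ) =>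
      ((N : ℝ)⁻¹ * ∑ i, p.2 i - ∫ x, x ∂(κ p.1)) ^ 2 :=
    Measurable.stronglyMeasurable (by fun_prop)
  simp only [hZ, ha] at hsq ⊢
  rw [hcond.integral_eq hV hζ hdev hsq]
  refine (le_abs_self _).trans (abs_integral_le_of_abs_le (ae_of_all _ fun ω => ?_))
  rw [abs_of_nonneg (integral_nonneg fun z => sq_nonneg _)]
  exact integral_pi_average_sub_sq_le hN (hκ ω)

lemma integral_sub_const_sq_le (h : IsCondIIDAverage μ V N K Z a q) (hN : N ≠ 0) (c : ℝ) :
    ∫ ω, (Z ω - c) ^ 2 ∂μ ≤ 2 * (K ^ 2 / N) + 2 * ∫ ω, (a ω - c) ^ 2 ∂μ := by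
  have hfluct : Integrable (fun ω => (Z ω - a ω) ^ 2) μ :=
    (h.memLp_average.sub h.memLp_mean).integrable_sq
  have hbias : Integrable (fun ω => (a ω - c) ^ 2) μ :=
    (h.memLp_mean.sub (memLp_const c)).integrable_sq
  calc ∫ ω, (Z ω - c) ^ 2 ∂μ ≤ ∫ ω, (2 * (Z ω - a ω) ^ 2 + 2 * (a ω - c) ^ 2) ∂μ :=
        integral_mono (h.memLp_average.sub (memLp_const c)).integrable_sq
          ((hfluct.const_mul 2).add (hbias.const_mul 2)) fun ω => by
            simp only
            nlinarith [sq_nonneg ((Z ω - a ω) - (a ω - c))]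
    _ = 2 * ∫ ω, (Z ω - a ω) ^ 2 ∂μ + 2 * ∫ ω, (a ω - c) ^ 2 ∂μ := by
        rw [integral_add (hfluct.const_mul 2) (hbias.const_mul 2), integral_const_mul,
          integral_const_mul]
    _ ≤ 2 * (K ^ 2 / N) + 2 * ∫ ω, (a ω - c) ^ 2 ∂μ := by
        gcongr
        exact h.integral_sub_sq_le hN

omit [IsProbabilityMeasure μ] in
lemma sq_mean_le_secondMoment (h : IsCondIIDAverage μ V N K Z a q) (ω : Ω) : a ω ^ 2 ≤ q ω := by
  obtain ⟨κ, _, -, -, -, -, hκ, -, -, ha, hq⟩ := h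
  rw [← sub_nonneg, ha, hq]
  simpa [variance_eq_sub (memLp_id_of_ae_abs_le (hκ ω))] using variance_nonneg id (κ (V ω))

lemma norm_integral_cexp_sub_le (h : IsCondIIDAverage μ V N K Z a q) (hN : N ≠ 0) (u : ℝ) :
    ‖∫ ω, Complex.exp (Complex.I * (u * (√N * Z ω) : ℝ)) ∂μ
        - ∫ ω, Complex.exp (Complex.I * (u * (√N * a ω) : ℝ))
          * Real.exp (-(u ^ 2 * (q ω - a ω ^ 2) / 2)) ∂μ‖ ≤ cltConst u K / √N := by
  have ha_meas := h.measurable_mean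
  have hq_meas := h.measurable_secondMoment
  have hle := h.sq_mean_le_secondMoment
  obtain ⟨κ, _, ζ, hV, hζ, hcond, hκ, -, hZ, ha, hq⟩ := h
  have hvar (ω : Ω) : Var[id; κ (V ω)] = q ω - a ω ^ 2 := by
    simp [variance_eq_sub (memLp_id_of_ae_abs_le (hκ ω)), hq, ha]
  have hGauss : Integrable (fun ω => Complex.exp (Complex.I * (u * (√N * a ω) : ℝ))
      * Real.exp (-(u ^ 2 * (q ω - a ω ^ 2) / 2))) μ := by
    refine Integrable.of_bound (C := 1) ?_ (ae_of_all _ fun ω => ?_)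
    · fun_prop
    · rw [norm_mul, Complex.norm_exp_I_mul_ofReal, one_mul, Complex.norm_real, Real.norm_eq_abs,
        Real.abs_exp, Real.exp_le_one_iff, neg_nonpos]
      have := sub_nonneg.2 (hle ω)
      positivity
  have hchar : StronglyMeasurable fun p : E × (Fin N → ℝ) =>
      Complex.exp (Complex.I * (u * (√N * ((N : ℝ)⁻¹ * ∑ i, p.2 i)) : ℝ)) :=
    Measurable.stronglyMeasurable (by fun_prop)
  have hnorm (x : ℝ) : ‖Complex.exp (Complex.I * x)‖ ≤ 1 := by rw [Complex.norm_exp_I_mul_ofReal]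
  simp only [hZ]
  rw [hcond.integral_eq hV hζ hchar
      (Integrable.of_bound (by fun_prop) 1 (ae_of_all _ fun ω => hnorm _)),
    ← integral_sub _ hGauss]
  · refine (norm_integral_le_of_norm_le_const (C := cltConst u K / √N)
      (ae_of_all _ fun ω => ?_)).trans (by simp)
    rw [← hvar, ha]
    exact norm_integral_pi_cexp_average_sub_le hN (hκ ω) u
  · refine Integrable.of_bound (C := 1) ((hchar.integral_kernel_prod_right'
      (κ := iidKernel N κ)).comp_measurable hV).aestronglyMeasurable (ae_of_all _ fun ω => ?_)
    exact (norm_integral_le_of_norm_le_const (ae_of_all _ fun z => hnorm _)).trans (by simp)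

end IsCondIIDAverage

end CondIID

end FFBS

namespace FFBS

lemma integrable_of_abs_le {α : Type*} [MeasurableSpace α] {μ : Measure α} [IsFiniteMeasure μ]
    {f : α → ℝ} (hf : Measurable f) {K : ℝ} (hK : ∀ x, |f x| ≤ K) : Integrable f μ :=
  Integrable.of_bound hf.aestronglyMeasurable K (ae_of_all _ hK)

variable {X Y : Type*} [MeasurableSpace X] [MeasurableSpace Y]

section DensityKernel

variable {ν : Measure X} [SigmaFinite ν] {q : X → X → ℝ}

lemma withDensity_const_apply (hq : Measurable (Function.uncurry q)) (x : X) :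
    Kernel.withDensity (Kernel.const X ν) (fun x x' => ENNReal.ofReal (q x x')) x
      = ν.withDensity (fun x' => ENNReal.ofReal (q x x')) := by
  rw [Kernel.withDensity_apply _ (by exact hq.ennreal_ofReal), Kernel.const_apply]

lemma isMarkovKernel_withDensity_const (hq : Measurable (Function.uncurry q))
    (hq_one : ∀ x, ∫⁻ x', ENNReal.ofReal (q x x') ∂ν = 1) :
    IsMarkovKernel
      (Kernel.withDensity (Kernel.const X ν) (fun x x' => ENNReal.ofReal (q x x'))) := by
  refine ⟨fun x => ⟨?_⟩⟩
  rw [withDensity_const_apply hq, withDensity_apply _ MeasurableSet.univ, Measure.restrict_univ,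
    hq_one]

lemma integral_withDensity_const (hq : Measurable (Function.uncurry q))
    (hq_nonneg : ∀ x x', 0 ≤ q x x') (x : X) (f : X → ℝ) :
    ∫ x', f x' ∂(Kernel.withDensity (Kernel.const X ν) (fun x x' => ENNReal.ofReal (q x x')) x)
      = ∫ x', q x x' * f x' ∂ν := by
  rw [withDensity_const_apply hq, integral_withDensity_eq_integral_toReal_smul
    hq.of_uncurry_left.ennreal_ofReal (ae_of_all _ fun _ => ENNReal.ofReal_lt_top)]
  simp [ENNReal.toReal_ofReal (hq_nonneg _ _)]

end DensityKernel

namespace HMM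

variable {H : HMM X Y}

instance : IsMarkovKernel H.M := isMarkovKernel_withDensity_const H.measurable_m H.lintegral_m

lemma integral_M (x : X) (f : X → ℝ) : ∫ x', f x' ∂(H.M x) = ∫ x', H.m x x' * f x' ∂H.ν :=
  integral_withDensity_const H.measurable_m H.m_nonneg x f

lemma integrable_m_prod (η : Measure X) [IsFiniteMeasure η] :
    Integrable (Function.uncurry H.m) (η.prod H.ν) := by
  refine ⟨H.measurable_m.aestronglyMeasurable, ?_⟩
  rw [HasFiniteIntegral, lintegral_prod _ H.measurable_m.enorm.aemeasurable]
  simp [Real.enorm_eq_ofReal (H.m_nonneg _ _), H.lintegral_m]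

lemma integral_integral_M (η : Measure X) [IsFiniteMeasure η] {f : X → X → ℝ}
    (hf : Measurable (Function.uncurry f)) {K : ℝ} (hK : ∀ x x', |f x x'| ≤ K) :
    ∫ x, ∫ x', f x x' ∂(H.M x) ∂η = ∫ x', ∫ x, H.m x x' * f x x' ∂η ∂H.ν := by
  simp_rw [integral_M]
  exact integral_integral_swap ((integrable_m_prod η).mul_bdd (c := K) hf.aestronglyMeasurable
    (ae_of_all _ fun p => hK p.1 p.2))

section Backward

lemma measurable_B {E : Type*} [MeasurableSpace E] (η : Kernel E X) [IsSFiniteKernel η]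
    {a : E → X} (ha : Measurable a) {f : E → X → ℝ} (hf : Measurable (Function.uncurry f)) :
    Measurable fun e => H.B (η e) (a e) (f e) := by
  have hm : Measurable fun p : E × X => H.m p.2 (a p.1) :=
    H.measurable_m.comp (measurable_snd.prodMk (ha.comp measurable_fst))
  have hnum := StronglyMeasurable.integral_kernel_prod_right (κ := η)
    (f := fun e x' => H.m x' (a e) * f e x') (hm.mul hf).stronglyMeasurable
  have hden := StronglyMeasurable.integral_kernel_prod_right (κ := η)
    (f := fun e x' => H.m x' (a e)) hm.stronglyMeasurable
  exact hnum.measurable.div hden.measurable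

lemma measurable_backwardInt_kernel {E : Type*} [MeasurableSpace E] (η : ℕ → Kernel E X)
    [∀ t, IsSFiniteKernel (η t)] {f : (ℕ → X) → ℝ} (hf : Measurable f) (t : ℕ) :
    Measurable fun p : E × (ℕ → X) => H.backwardInt (fun s => η s p.1) t f p.2 := by
  induction t with
  | zero => exact hf.comp measurable_snd
  | succ t ih =>
    refine measurable_B (E := E × (ℕ → X)) ((η t).comap Prod.fst measurable_fst)
      (a := fun p => p.2 (t + 1)) ((measurable_pi_apply _).comp measurable_snd)
      (f := fun p x' => H.backwardInt (fun s => η s p.1) t f (Function.update p.2 t x')) ?_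
    exact ih.comp ((measurable_fst.comp measurable_fst).prodMk
      (measurable_update'.comp ((measurable_snd.comp measurable_fst).prodMk measurable_snd)))

lemma measurable_backwardInt (η : ℕ → Measure X) [∀ t, SFinite (η t)] {f : (ℕ → X) → ℝ}
    (hf : Measurable f) (t : ℕ) : Measurable (H.backwardInt η t f) :=
  (measurable_backwardInt_kernel (fun s => Kernel.const Unit (η s)) hf t).comp
    (measurable_const (a := ()).prodMk measurable_id)

lemma backwardInt_congr {η η' : ℕ → Measure X} {f f' : (ℕ → X) → ℝ} (t : ℕ) {x x' : ℕ → X}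
    (hη : ∀ s < t, η s = η' s) (hx : x t = x' t)
    (h : ∀ z z' : ℕ → X, (∀ k < t, z k = z' k) → (∀ k, t ≤ k → z k = x k) →
      (∀ k, t ≤ k → z' k = x' k) → f z = f' z') :
    H.backwardInt η t f x = H.backwardInt η' t f' x' := by
  induction t generalizing x x' with
  | zero => exact h x x' (by simp) (by simp) (by simp)
  | succ t ih =>
    simp only [backwardInt]
    rw [hx, hη t t.lt_succ_self]
    congr 1
    funext u
    refine ih (fun s hs => hη s (hs.trans t.lt_succ_self)) (by simp) fun z z' hzz' hz hz' => ?_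
    refine h z z' (fun k hk => ?_) (fun k hk => ?_) (fun k hk => ?_)
    · rcases Nat.lt_succ_iff_lt_or_eq.1 hk with hk | rfl
      · exact hzz' k hk
      · rw [hz k le_rfl, hz' k le_rfl]
        simp
    · rw [hz k (by omega), Function.update_of_ne (by omega)]
    · rw [hz' k (by omega), Function.update_of_ne (by omega)]

lemma backwardInt_congr_right (η : ℕ → Measure X) {f f' : (ℕ → X) → ℝ} (t : ℕ) {x : ℕ → X}
    (h : ∀ z : ℕ → X, (∀ k, t ≤ k → z k = x k) → f z = f' z) :
    H.backwardInt η t f x = H.backwardInt η t f' x := by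
  refine backwardInt_congr t (fun _ _ => rfl) rfl fun z z' hzz' hz hz' => ?_
  obtain rfl : z = z' := funext fun k => by
    rcases lt_or_ge k t with hk | hk
    · exact hzz' k hk
    · rw [hz k hk, hz' k hk]
  exact h z hz

lemma backwardInt_const_mul (η : ℕ → Measure X) (a : ℝ) (f : (ℕ → X) → ℝ) (t : ℕ) (x : ℕ → X) :
    H.backwardInt η t (fun z => a * f z) x = a * H.backwardInt η t f x := by
  induction t generalizing x with
  | zero => rfl
  | succ t ih =>
    simp only [backwardInt, B, ih]
    rw [← mul_div_assoc, ← integral_const_mul]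
    simp only [mul_left_comm]

lemma backwardInt_apply_mul (η : ℕ → Measure X) (a : X → ℝ) (f : (ℕ → X) → ℝ) {t n : ℕ}
    (hn : t ≤ n) (x : ℕ → X) :
    H.backwardInt η t (fun z => a (z n) * f z) x = a (x n) * H.backwardInt η t f x := by
  rw [← backwardInt_const_mul]
  exact backwardInt_congr_right η t fun z hz => by rw [hz n hn]

variable {C : ℝ} (hm : ∀ x x', H.m x x' ≤ C)

include hm

lemma integrable_m_left (η : Measure X) [IsFiniteMeasure η] (x : X) :
    Integrable (fun x' => H.m x' x) η :=
  integrable_of_abs_le H.measurable_m.of_uncurry_right fun x' => by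
    rw [abs_of_nonneg (H.m_nonneg _ _)]
    exact hm _ _

lemma abs_integral_m_mul_le (η : Measure X) [IsFiniteMeasure η] (x : X) {f : X → ℝ} {K : ℝ}
    (hK : ∀ x, |f x| ≤ K) : |∫ x', H.m x' x * f x' ∂η| ≤ K * ∫ x', H.m x' x ∂η := by
  rw [← integral_const_mul, ← Real.norm_eq_abs]
  refine norm_integral_le_of_norm_le ((integrable_m_left hm η x).const_mul K)
    (ae_of_all _ fun x' => ?_)
  rw [Real.norm_eq_abs, abs_mul, abs_of_nonneg (H.m_nonneg _ _), mul_comm]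
  exact mul_le_mul_of_nonneg_right (hK x') (H.m_nonneg _ _)

lemma abs_B_le (η : Measure X) [IsFiniteMeasure η] (x : X) {f : X → ℝ} {K : ℝ} (hK₀ : 0 ≤ K)
    (hK : ∀ x, |f x| ≤ K) : |H.B η x f| ≤ K := by
  have hden : 0 ≤ ∫ x', H.m x' x ∂η := integral_nonneg fun x' => H.m_nonneg _ _
  rw [B, abs_div, abs_of_nonneg hden]
  exact div_le_of_le_mul₀ hden hK₀ (abs_integral_m_mul_le hm η x hK)

/-- Unlike the definition of `B`, this identity is not affected by a vanishing denominator. -/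
lemma integral_m_mul_B (η : Measure X) [IsFiniteMeasure η] (x : X) {f : X → ℝ} {K : ℝ}
    (hK : ∀ x, |f x| ≤ K) :
    (∫ x', H.m x' x ∂η) * H.B η x f = ∫ x', H.m x' x * f x' ∂η := by
  rw [B]
  rcases eq_or_ne (∫ x', H.m x' x ∂η) 0 with h | h
  · have := abs_integral_m_mul_le hm η x hK
    rw [h, mul_zero] at this
    rw [h, zero_mul, abs_nonpos_iff.1 this]
  · field_simp

lemma abs_backwardInt_le (η : ℕ → Measure X) [∀ t, IsFiniteMeasure (η t)] {f : (ℕ → X) → ℝ}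
    {K : ℝ} (hK : ∀ x, |f x| ≤ K) (t : ℕ) (x : ℕ → X) : |H.backwardInt η t f x| ≤ K := by
  induction t generalizing x with
  | zero => exact hK x
  | succ t ih => exact abs_B_le hm (η t) _ ((abs_nonneg _).trans (hK x)) fun x' => ih _

lemma integrable_m_mul_backwardInt (η : ℕ → Measure X) [∀ t, IsFiniteMeasure (η t)]
    {f : (ℕ → X) → ℝ} (hf : Measurable f) {K : ℝ} (hK : ∀ x, |f x| ≤ K) (t : ℕ) (x : ℕ → X)
    (x₁ : X) :
    Integrable (fun x' => H.m x' x₁ * H.backwardInt η t f (Function.update x t x')) (η t) :=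
  (integrable_m_left hm (η t) x₁).mul_bdd (c := K)
    ((measurable_backwardInt η hf t).comp (measurable_update _)).aestronglyMeasurable
    (ae_of_all _ fun _ => abs_backwardInt_le hm η hK t _)

lemma backwardInt_sub (η : ℕ → Measure X) [∀ t, IsFiniteMeasure (η t)] {f f' : (ℕ → X) → ℝ}
    (hf : Measurable f) (hf' : Measurable f') {K : ℝ} (hK : ∀ x, |f x| ≤ K)
    (hK' : ∀ x, |f' x| ≤ K) (t : ℕ) (x : ℕ → X) :
    H.backwardInt η t (fun z => f z - f' z) x
      = H.backwardInt η t f x - H.backwardInt η t f' x := by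
  induction t generalizing x with
  | zero => rfl
  | succ t ih =>
    simp only [backwardInt, B, ih, mul_sub]
    rw [integral_sub (integrable_m_mul_backwardInt hm η hf hK t x _)
      (integrable_m_mul_backwardInt hm η hf' hK' t x _), sub_div]

lemma integral_m_mul_integral_backwardInt (η : ℕ → Measure X) [∀ t, IsFiniteMeasure (η t)]
    (ρ : Measure X) [IsFiniteMeasure ρ] {f : (ℕ → X) → ℝ} (hf : Measurable f) {K : ℝ}
    (hK : ∀ x, |f x| ≤ K) {t n : ℕ} (hn : t < n) (x : ℕ → X) (x₁ : X) :
    ∫ x'', H.m x'' x₁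
        * ∫ x', H.backwardInt η t f (Function.update (Function.update x t x'') n x') ∂ρ ∂(η t)
      = ∫ x', ∫ x'', H.m x'' x₁
        * H.backwardInt η t f (Function.update (Function.update x n x') t x'') ∂(η t) ∂ρ := by
  simp_rw [← integral_const_mul, Function.update_comm hn.ne']
  refine integral_integral_swap (integrable_of_abs_le (K := C * K) ?_ fun p => ?_)
  · refine Measurable.mul (H.measurable_m.comp (measurable_fst.prodMk measurable_const)) ?_
    exact (measurable_backwardInt η hf t).comp (measurable_update'.comp
      (((measurable_update _).comp measurable_fst).prodMk measurable_snd))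
  · rw [Function.uncurry, abs_mul, abs_of_nonneg (H.m_nonneg _ _)]
    exact mul_le_mul (hm _ _) (abs_backwardInt_le hm η hK t _) (abs_nonneg _)
      ((H.m_nonneg x₁ x₁).trans (hm _ _))

lemma backwardInt_integral (η : ℕ → Measure X) [∀ t, IsFiniteMeasure (η t)] (ρ : Measure X)
    [IsFiniteMeasure ρ] {f : (ℕ → X) → ℝ} (hf : Measurable f) {K : ℝ} (hK : ∀ x, |f x| ≤ K)
    {t n : ℕ} (hn : t < n) (x : ℕ → X) :
    H.backwardInt η t (fun z => ∫ x', f (Function.update z n x') ∂ρ) x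
      = ∫ x', H.backwardInt η t f (Function.update x n x') ∂ρ := by
  induction t generalizing x with
  | zero => rfl
  | succ t ih =>
    simp only [backwardInt, B]
    simp_rw [ih (by omega)]
    rw [integral_m_mul_integral_backwardInt hm η ρ hf hK (by omega), ← integral_div]
    simp only [Function.update_of_ne (show t + 1 ≠ n by omega)]

lemma integral_integral_M_mul_B (η : Measure X) [IsFiniteMeasure η] {f : X → X → ℝ}
    (hf : Measurable (Function.uncurry f)) {K : ℝ} (hK : ∀ x x', |f x x'| ≤ K) {a : X → ℝ}
    (ha : Measurable a) {Ka : ℝ} (hKa : ∀ x, |a x| ≤ Ka) :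
    ∫ x, ∫ x', a x' * H.B η x' (fun x => f x x') ∂(H.M x) ∂η
      = ∫ x, ∫ x', a x' * f x x' ∂(H.M x) ∂η := by
  rcases isEmpty_or_nonempty X with hX | ⟨⟨x₀⟩⟩
  · simp [Measure.eq_zero_of_isEmpty]
  have hK₀ : 0 ≤ K := (abs_nonneg _).trans (hK x₀ x₀)
  have hB : Measurable fun x' => H.B η x' (fun x => f x x') :=
    measurable_B (Kernel.const X η) measurable_id (f := fun x' x => f x x')
      (hf.comp measurable_swap)
  have hmul {b c : ℝ} (hb : |b| ≤ Ka) (hc : |c| ≤ K) : |b * c| ≤ Ka * K := by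
    rw [abs_mul]
    exact mul_le_mul hb hc (abs_nonneg _) ((abs_nonneg _).trans hb)
  rw [integral_integral_M η (f := fun _ x' => a x' * H.B η x' (fun x => f x x')) (K := Ka * K)
      ((ha.mul hB).comp measurable_snd)
      (fun _ _ => hmul (hKa _) (abs_B_le hm η _ hK₀ fun _ => hK _ _)),
    integral_integral_M η (f := fun x x' => a x' * f x x') (K := Ka * K)
      ((ha.comp measurable_snd).mul hf) (fun _ _ => hmul (hKa _) (hK _ _))]
  congr 1 with x'
  rw [integral_mul_const, mul_left_comm, integral_m_mul_B hm η x' (fun x => hK x x'),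
    ← integral_const_mul]
  simp only [mul_left_comm]

end Backward

end HMM

end FFBS

namespace FFBS

variable {X Y : Type*} [MeasurableSpace X] [MeasurableSpace Y]

namespace HMM

variable {H : HMM X Y} {y : ℕ → Y} {C K : ℝ} {T : ℕ}

lemma measurable_g (t : ℕ) : Measurable (H.g y t) := H.measurable_obs.of_uncurry_right

lemma g_nonneg (t : ℕ) (x : X) : 0 ≤ H.g y t x := H.obs_nonneg _ _

lemma abs_g_mul_le (hg : ∀ s ≤ T, ∀ x, H.g y s x ≤ C) {t : ℕ} (ht : t ≤ T) (x : X) {a : ℝ}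
    (ha : |a| ≤ K) : |H.g y t x * a| ≤ C * K := by
  rw [abs_mul, abs_of_nonneg (g_nonneg t x)]
  exact mul_le_mul (hg t ht x) ha (abs_nonneg _) ((g_nonneg t x).trans (hg t ht x))

section Forward

lemma measurable_forwardInt {f : (ℕ → X) → ℝ} (hf : Measurable f) (k t : ℕ) :
    Measurable (H.forwardInt y k t f) := by
  induction k generalizing t with
  | zero => exact hf
  | succ k ih =>
    refine (StronglyMeasurable.integral_kernel_prod_right
      (κ := H.M.comap (fun x : ℕ → X => x t) (measurable_pi_apply t))
      (f := fun x x' =>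
        H.g y (t + 1) x' * H.forwardInt y k (t + 1) f (Function.update x (t + 1) x'))
      (Measurable.stronglyMeasurable ?_)).measurable
    exact ((measurable_g _).comp measurable_snd).mul ((ih (t + 1)).comp measurable_update')

lemma dependsOn_forwardInt {f : (ℕ → X) → ℝ} {k s t : ℕ} (hst : s ≤ t)
    (hf : DependsOn f (Set.Icc s (t + k))) :
    DependsOn (H.forwardInt y k t f) (Set.Icc s t) := by
  induction k generalizing t with
  | zero => exact hf
  | succ k ih =>
    intro x x' hx
    simp only [forwardInt]
    rw [hx t (Set.right_mem_Icc.2 hst)]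
    congr 1 with u
    congr 1
    refine ih (by omega) (by rwa [Nat.add_right_comm]) fun i hi => ?_
    rcases eq_or_ne i (t + 1) with rfl | hne
    · simp
    · rw [Function.update_of_ne hne, Function.update_of_ne hne]
      exact hx i ⟨hi.1, by have := hi.2; omega⟩

variable (hg : ∀ s ≤ T, ∀ x, H.g y s x ≤ C)

include hg

lemma abs_forwardInt_le {f : (ℕ → X) → ℝ} (hK : ∀ x, |f x| ≤ K) (k : ℕ) {t : ℕ} (ht : t + k ≤ T)
    (x : ℕ → X) : |H.forwardInt y k t f x| ≤ C ^ k * K := by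
  induction k generalizing t x with
  | zero => simpa [forwardInt] using hK x
  | succ k ih =>
    refine abs_integral_le_of_abs_le (ae_of_all _ fun x' => ?_)
    rw [pow_succ', mul_assoc]
    exact abs_g_mul_le hg (by omega) _ (ih (by omega) _)

lemma integrable_g_mul_forwardInt {f : (ℕ → X) → ℝ} (hf : Measurable f) (hK : ∀ x, |f x| ≤ K)
    (k : ℕ) {t : ℕ} (ht : t + k ≤ T) (η : Measure X) [IsFiniteMeasure η] (x : ℕ → X) :
    Integrable (fun x' => H.g y t x' * H.forwardInt y k t f (Function.update x t x')) η :=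
  integrable_of_abs_le (K := C * (C ^ k * K))
    ((measurable_g _).mul ((measurable_forwardInt hf k _).comp (measurable_update _)))
    fun _ => abs_g_mul_le hg (by omega) _ (abs_forwardInt_le hg hK k ht _)

lemma forwardInt_sub_mul {f f' : (ℕ → X) → ℝ} (hf : Measurable f) (hf' : Measurable f') {K' : ℝ}
    (hK : ∀ x, |f x| ≤ K) (hK' : ∀ x, |f' x| ≤ K') (c : ℝ) (k : ℕ) {t : ℕ}
    (ht : t + k ≤ T) (x : ℕ → X) :
    H.forwardInt y k t (fun z => f z - c * f' z) x
      = H.forwardInt y k t f x - c * H.forwardInt y k t f' x := by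
  induction k generalizing t x with
  | zero => rfl
  | succ k ih =>
    have ht' : t + 1 + k ≤ T := by omega
    simp only [forwardInt]
    rw [← integral_const_mul, ← integral_sub (integrable_g_mul_forwardInt hg hf hK k ht' _ x)
      ((integrable_g_mul_forwardInt hg hf' hK' k ht' _ x).const_mul c)]
    congr 1 with x'
    rw [ih ht']
    ring

section Backward

variable {Cm : ℝ} (hm : ∀ x x', H.m x x' ≤ Cm) (η : ℕ → Measure X)
  [∀ t, IsFiniteMeasure (η t)] {f : (ℕ → X) → ℝ} (hf : Measurable f) (hK : ∀ x, |f x| ≤ K)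
  {k t : ℕ}

include hm hf hK

lemma backwardInt_forwardInt_succ (ht : t + (k + 1) ≤ T) (x : ℕ → X) :
    H.backwardInt η t (H.forwardInt y (k + 1) t f) x
      = ∫ x', H.g y (t + 1) x'
          * H.backwardInt η t (H.forwardInt y k (t + 1) f) (Function.update x (t + 1) x')
          ∂(H.M (x t)) := by
  set F : (ℕ → X) → ℝ := fun z => H.g y (t + 1) (z (t + 1)) * H.forwardInt y k (t + 1) f z with hF
  have hF_meas : Measurable F :=
    ((measurable_g _).comp (measurable_pi_apply _)).mul (measurable_forwardInt hf k (t + 1))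
  have hF_le (z : ℕ → X) : |F z| ≤ C * (C ^ k * K) :=
    abs_g_mul_le hg (by omega) _ (abs_forwardInt_le hg hK k (by omega) z)
  calc H.backwardInt η t (H.forwardInt y (k + 1) t f) x
      = H.backwardInt η t (fun z => ∫ x', F (Function.update z (t + 1) x') ∂(H.M (x t))) x :=
        backwardInt_congr_right η t fun z hz => by
          simp only [forwardInt, hF, hz t le_rfl, Function.update_self]
    _ = ∫ x', H.backwardInt η t F (Function.update x (t + 1) x') ∂(H.M (x t)) :=
        backwardInt_integral hm η (H.M (x t)) hF_meas hF_le t.lt_succ_self x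
    _ = _ := by
        simp only [hF, backwardInt_apply_mul η (H.g y (t + 1)) _ (Nat.le_succ t),
          Function.update_self]

lemma backwardInt_forwardInt_succ_const (hdep : DependsOn f (Set.Iic (t + (k + 1))))
    (ht : t + (k + 1) ≤ T) (x : X) :
    H.backwardInt η t (H.forwardInt y (k + 1) t f) (fun _ => x)
      = ∫ x', H.g y (t + 1) x' * H.backwardInt η t (H.forwardInt y k (t + 1) f)
          (Function.update (fun _ => x') t x) ∂(H.M x) := by
  rw [backwardInt_forwardInt_succ hg hm η hf hK ht]
  congr 1 with x'
  congr 1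
  refine backwardInt_congr t (fun _ _ => rfl) ?_ fun z z' hzz' hz hz' => ?_
  · rw [Function.update_self, Function.update_of_ne (by omega)]
  rw [← Set.Icc_bot, show t + (k + 1) = t + 1 + k by ring] at hdep
  refine dependsOn_forwardInt (Nat.zero_le _) hdep fun i hi => ?_
  rcases lt_trichotomy i t with hit | rfl | hit
  · exact hzz' i hit
  · rw [hz i le_rfl, hz' i le_rfl, Function.update_self, Function.update_of_ne (by omega)]
  · obtain rfl : i = t + 1 := le_antisymm hi.2 hit
    rw [hz _ (by omega), hz' _ (by omega), Function.update_self, Function.update_of_ne (by omega)]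

lemma integral_backwardInt_forwardInt_succ (hdep : DependsOn f (Set.Iic (t + (k + 1))))
    (ht : t + (k + 1) ≤ T) {c : ℝ≥0∞} {γ' : Measure X} (hγ : γ' = c • η t) :
    ∫ x, H.backwardInt η t (H.forwardInt y (k + 1) t f) (fun _ => x) ∂γ'
      = ∫ x, ∫ x', H.g y (t + 1) x'
          * H.backwardInt η (t + 1) (H.forwardInt y k (t + 1) f) (fun _ => x') ∂(H.M x) ∂γ' := by
  rw [hγ, integral_smul_measure, integral_smul_measure]
  congr 1
  have hcoord : Measurable fun p : X × X => Function.update (fun _ : ℕ => p.2) t p.1 :=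
    measurable_update'.comp
      ((measurable_pi_lambda _ fun _ => measurable_snd).prodMk measurable_fst)
  simp only [backwardInt_forwardInt_succ_const hg hm η hf hK hdep ht, backwardInt]
  refine (integral_integral_M_mul_B hm (η t) (Ka := C)
    (f := fun x x' => H.backwardInt η t (H.forwardInt y k (t + 1) f)
      (Function.update (fun _ => x') t x))
    ((measurable_backwardInt η (measurable_forwardInt hf k (t + 1)) t).comp hcoord)
    (fun _ _ => abs_backwardInt_le hm η (abs_forwardInt_le hg hK k (by omega)) t _)
    (measurable_g (t + 1)) fun x => ?_).symm
  rw [abs_of_nonneg (g_nonneg _ x)]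
  exact hg _ (by omega) x

end Backward

end Forward

section Filter

instance (t : ℕ) : IsFiniteMeasure (H.φ y t) := by
  refine ⟨?_⟩
  rw [φ, Measure.smul_apply, smul_eq_mul]
  exact (ENNReal.inv_mul_le_one _).trans_lt ENNReal.one_lt_top

lemma integral_φ (t : ℕ) (f : X → ℝ) :
    ∫ x, f x ∂(H.φ y t) = (∫ x, f x ∂(H.γ y t)) / (H.γ y t).real Set.univ := by
  rw [φ, integral_smul_measure, ENNReal.toReal_inv, smul_eq_mul, inv_mul_eq_div, Measure.real]

lemma integral_withDensity_g (η : Measure X) (t : ℕ) (f : X → ℝ) :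
    ∫ x, f x ∂(η.withDensity (fun x => ENNReal.ofReal (H.g y t x)))
      = ∫ x, H.g y t x * f x ∂η := by
  rw [integral_withDensity_eq_integral_toReal_smul (measurable_g t).ennreal_ofReal
    (ae_of_all _ fun _ => ENNReal.ofReal_lt_top)]
  simp [ENNReal.toReal_ofReal (g_nonneg _ _)]

lemma withDensity_g_ne_zero {t : ℕ} (hg_pos : ∀ x, 0 < H.g y t x) {η : Measure X} (hη : η ≠ 0) :
    η.withDensity (fun x => ENNReal.ofReal (H.g y t x)) ≠ 0 := by
  intro h
  rw [withDensity_eq_zero_iff (measurable_g t).ennreal_ofReal.aemeasurable] at h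
  refine hη (Measure.measure_univ_eq_zero.1 (measure_mono_null (fun x _ => ?_) (ae_iff.1 h)))
  simpa using hg_pos x

lemma γ_ne_zero (hg_pos : ∀ s ≤ T, ∀ x, 0 < H.g y s x) {t : ℕ} (ht : t ≤ T) : H.γ y t ≠ 0 := by
  induction t with
  | zero => exact withDensity_g_ne_zero (hg_pos 0 ht) (IsProbabilityMeasure.ne_zero H.χ)
  | succ t ih =>
    refine withDensity_g_ne_zero (hg_pos _ ht) fun h => ih (by omega) ?_
    rw [← Measure.measure_univ_eq_zero] at h ⊢
    rw [Measure.bind_apply MeasurableSet.univ H.M.aemeasurable] at h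
    simpa using h

variable (hg : ∀ s ≤ T, ∀ x, H.g y s x ≤ C)

include hg

lemma isFiniteMeasure_withDensity_g {t : ℕ} (ht : t ≤ T) (η : Measure X) [IsFiniteMeasure η] :
    IsFiniteMeasure (η.withDensity (fun x => ENNReal.ofReal (H.g y t x))) := by
  refine isFiniteMeasure_withDensity
    (ne_top_of_le_ne_top (b := ENNReal.ofReal C * η Set.univ) (by finiteness) ?_)
  rw [← lintegral_const]
  exact lintegral_mono fun x => ENNReal.ofReal_le_ofReal (hg t ht x)

lemma isFiniteMeasure_γ {t : ℕ} (ht : t ≤ T) : IsFiniteMeasure (H.γ y t) := by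
  induction t with
  | zero => exact isFiniteMeasure_withDensity_g hg ht H.χ
  | succ t ih =>
    have := ih (by omega)
    exact isFiniteMeasure_withDensity_g hg ht ((H.γ y t).bind H.M)

lemma integral_γ_succ {t : ℕ} (ht : t + 1 ≤ T) {f : X → ℝ} (hf : Measurable f)
    (hK : ∀ x, |f x| ≤ K) :
    ∫ x, f x ∂(H.γ y (t + 1)) = ∫ x, ∫ x', H.g y (t + 1) x' * f x' ∂(H.M x) ∂(H.γ y t) := by
  have := isFiniteMeasure_γ hg (t := t) (by omega)
  rw [γ, integral_withDensity_g]
  rw [Measure.comp_eq_comp_const_apply, Kernel.integral_comp, Kernel.const_apply]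
  rw [← Measure.comp_eq_comp_const_apply]
  exact integrable_of_abs_le (K := C * K) ((measurable_g _).mul hf)
    fun _ => abs_g_mul_le hg ht _ (hK _)

lemma γ_eq_smul_φ (hg_pos : ∀ s ≤ T, ∀ x, 0 < H.g y s x) {t : ℕ} (ht : t ≤ T) :
    H.γ y t = H.γ y t Set.univ • H.φ y t := by
  have := isFiniteMeasure_γ hg ht
  rw [φ, smul_smul, ENNReal.mul_inv_cancel (by simpa using γ_ne_zero hg_pos ht) (by finiteness),
    one_smul]

lemma integral_γ_backwardInt (hg_pos : ∀ s ≤ T, ∀ x, 0 < H.g y s x) {Cm : ℝ}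
    (hm : ∀ x x', H.m x x' ≤ Cm) {f : (ℕ → X) → ℝ} (hf : Measurable f) (hK : ∀ x, |f x| ≤ K)
    {k t : ℕ} (hdep : DependsOn f (Set.Iic (t + k))) (ht : t + k ≤ T) :
    ∫ x, H.backwardInt (H.φ y) t (H.forwardInt y k t f) (fun _ => x) ∂(H.γ y t)
      = ∫ x, H.forwardInt y (t + k) 0 f (fun _ => x) ∂(H.γ y 0) := by
  induction t generalizing k with
  | zero => simp [backwardInt]
  | succ t ih =>
    have hmeas : Measurable fun x : X =>
        H.backwardInt (H.φ y) (t + 1) (H.forwardInt y k (t + 1) f) (fun _ => x) :=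
      (measurable_backwardInt (H.φ y) (measurable_forwardInt hf k (t + 1)) (t + 1)).comp
        (measurable_pi_lambda _ fun _ => measurable_id)
    have hbound := abs_backwardInt_le hm (H.φ y) (abs_forwardInt_le hg hK k ht) (t + 1)
    rw [show t + 1 + k = t + (k + 1) by ring] at hdep ht ⊢
    rw [integral_γ_succ hg (by omega) hmeas fun x => hbound _, ← ih hdep ht,
      integral_backwardInt_forwardInt_succ hg hm (H.φ y) hf hK hdep ht
        (γ_eq_smul_φ hg hg_pos (by omega))]

lemma integral_γ_forwardInt_one (k : ℕ) {t : ℕ} (ht : t + k ≤ T) :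
    ∫ x, H.forwardInt y k t (fun _ => 1) (fun _ => x) ∂(H.γ y t)
      = (H.γ y (t + k)).real Set.univ := by
  induction k generalizing t with
  | zero => simp [forwardInt, Measure.real]
  | succ k ih =>
    have hmeas : Measurable fun x : X => H.forwardInt y k (t + 1) (fun _ => 1) (fun _ => x) :=
      (measurable_forwardInt measurable_const k _).comp
        (measurable_pi_lambda _ fun _ => measurable_id)
    rw [show t + (k + 1) = t + 1 + k by ring, ← ih (by omega), integral_γ_succ hg (by omega) hmeas
      fun x => abs_forwardInt_le hg (K := 1) (by simp) k (by omega) _]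
    have hdep := dependsOn_forwardInt (H := H) (y := y) (k := k) (le_refl (t + 1))
      ((dependsOn_const (1 : ℝ)).mono (Set.empty_subset _))
    simp only [forwardInt]
    congr 2 with x
    congr 1 with x'
    rw [hdep (x := Function.update (fun _ => x) (t + 1) x') (y := fun _ => x')]
    intro i hi
    rw [Set.Icc_self, Set.mem_singleton_iff] at hi
    simp [hi]

end Filter

end HMM

end FFBS

namespace FFBS

variable {X Y : Type*} [MeasurableSpace X] [MeasurableSpace Y]

namespace Proposal

variable {H : HMM X Y} {A : Proposal H} {y : ℕ → Y} {T : ℕ} {C : ℝ}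

/-- All the functions that enter the particle filter are bounded by the same constant `C ≥ 1` up to
time `T`, and the likelihoods are positive. The clause `m_eq_zero` excludes weights of the form
`a / 0` with `a > 0`. -/
structure BoundedBy (A : Proposal H) (y : ℕ → Y) (T : ℕ) (C : ℝ) : Prop where
  one_le : 1 ≤ C
  g_pos : ∀ t ≤ T, ∀ x, 0 < H.g y t x
  g_le : ∀ t ≤ T, ∀ x, H.g y t x ≤ C
  m_le : ∀ x x', H.m x x' ≤ C
  ϑ_le : ∀ t, 1 ≤ t → t ≤ T → ∀ x, A.ϑ t x ≤ C
  w₀_le : ∀ x, A.w₀ y x ≤ C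
  m_eq_zero : ∀ t, 1 ≤ t → t ≤ T → ∀ x x', A.p t x x' = 0 → H.m x x' = 0
  w_le : ∀ t, 1 ≤ t → t ≤ T → ∀ x x', A.w y t x x' ≤ C

lemma BoundedBy.nonneg (hC : A.BoundedBy y T C) : 0 ≤ C :=
  zero_le_one.trans hC.one_le

lemma exists_boundedBy (hg : H.BoundedLikelihood y T) (hw : A.BoundedWeights y T)
    (hm : ∃ C : ℝ, ∀ x x', H.m x x' ≤ C) : ∃ C, A.BoundedBy y T C := by
  obtain ⟨hg_pos, Cg, hCg⟩ := hg
  obtain ⟨⟨Cϑ, hCϑ⟩, ⟨C₀, hC₀⟩, hp, ⟨Cw, hCw⟩⟩ := hw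
  obtain ⟨Cm, hCm⟩ := hm
  refine ⟨max 1 (max Cg (max Cϑ (max C₀ (max Cw Cm)))), ?_⟩
  exact
    { one_le := by simp
      g_pos := hg_pos
      g_le := fun t ht x => (hCg t ht x).trans (by simp)
      m_le := fun x x' => (hCm x x').trans (by simp)
      ϑ_le := fun t h1 ht x => (hCϑ t h1 ht x).trans (by simp)
      w₀_le := fun x => (hC₀ x).trans (by simp)
      m_eq_zero := hp
      w_le := fun t h1 ht x x' => (hCw t h1 ht x x').trans (by simp) }

instance (t : ℕ) : IsMarkovKernel (A.P t) :=
  isMarkovKernel_withDensity_const (A.measurable_p t) (A.lintegral_p t)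

lemma integral_P (t : ℕ) (x : X) (f : X → ℝ) :
    ∫ x', f x' ∂(A.P t x) = ∫ x', A.p t x x' * f x' ∂H.ν :=
  integral_withDensity_const (A.measurable_p t) (A.p_nonneg t) x f

lemma measurable_w₀ : Measurable (A.w₀ y) := A.measurable_dχ.mul (HMM.measurable_g 0)

lemma measurable_w (t : ℕ) : Measurable (Function.uncurry (A.w y t)) :=
  (H.measurable_m.mul ((HMM.measurable_g t).comp measurable_snd)).div
    (((A.measurable_ϑ t).comp measurable_fst).mul (A.measurable_p t))

lemma w₀_nonneg (x : X) : 0 ≤ A.w₀ y x := mul_nonneg (A.dχ_nonneg x) (HMM.g_nonneg 0 x)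

lemma w_nonneg (t : ℕ) (x x' : X) : 0 ≤ A.w y t x x' :=
  div_nonneg (mul_nonneg (H.m_nonneg _ _) (HMM.g_nonneg t _))
    (mul_nonneg (A.ϑ_pos t x).le (A.p_nonneg t x _))

lemma abs_w₀_mul_le (hC : A.BoundedBy y T C) {a K : ℝ} (ha : |a| ≤ K) (x : X) :
    |A.w₀ y x * a| ≤ C * K := by
  rw [abs_mul, abs_of_nonneg (w₀_nonneg _)]
  exact mul_le_mul (hC.w₀_le x) ha (abs_nonneg _) hC.nonneg

lemma abs_w_mul_le (hC : A.BoundedBy y T C) {t : ℕ} (h1 : 1 ≤ t) (ht : t ≤ T) {a K : ℝ}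
    (ha : |a| ≤ K) (x x' : X) : |A.w y t x x' * a| ≤ C * K := by
  rw [abs_mul, abs_of_nonneg (w_nonneg _ _ _)]
  exact mul_le_mul (hC.w_le t h1 ht x x') ha (abs_nonneg _) hC.nonneg

lemma ϑ_mul_integral_P_w_mul (hC : A.BoundedBy y T C) {t : ℕ} (h1 : 1 ≤ t) (ht : t ≤ T) (x : X)
    (f : X → ℝ) :
    A.ϑ t x * ∫ x', A.w y t x x' * f x' ∂(A.P t x) = ∫ x', H.g y t x' * f x' ∂(H.M x) := by
  rw [integral_P, HMM.integral_M, ← integral_const_mul]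
  congr 1 with x'
  have := A.ϑ_pos t x
  rcases eq_or_ne (A.p t x x') 0 with hp | hp
  · simp [hp, hC.m_eq_zero t h1 ht x x' hp]
  · simp only [w]
    field_simp

lemma integral_w₀_mul (f : X → ℝ) : ∫ x, A.w₀ y x * f x ∂A.ρ₀ = ∫ x, f x ∂(H.γ y 0) := by
  rw [HMM.γ, HMM.integral_withDensity_g, A.χ_eq, integral_withDensity_eq_integral_toReal_smul
    A.measurable_dχ.ennreal_ofReal (ae_of_all _ fun _ => ENNReal.ofReal_lt_top)]
  simp [ENNReal.toReal_ofReal (A.dχ_nonneg _), w₀, mul_assoc]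

section Particles

variable {Ω : Type*} {N : ℕ} {ξ : ℕ → Fin N → Ω → X} {I : ℕ → Fin N → Ω → Fin N}

section UnnormalizedFilter

variable (A y ξ I)

/-- The estimator `∏_{u < t} N⁻¹ ∑ⱼ ω_u^j ϑ_{u+1}(ξ_u^j)` of the normalising constant that turns
the weighted sample of time `t` into an unbiased approximation of `γ_t`. -/
noncomputable def zHat : ℕ → Ω → ℝ
  | 0, _ => 1
  | t + 1, ω => zHat t ω * ((N : ℝ)⁻¹ * ∑ j, A.weight y ξ I t j ω * A.ϑ (t + 1) (ξ t j ω))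

/-- The particle approximation of the unnormalised filter `γ_t`; it is a multiple of `φ̂_t`. -/
noncomputable def γHat (t : ℕ) (ω : Ω) : Measure X :=
  ENNReal.ofReal (A.zHat y ξ I t ω * (N : ℝ)⁻¹) •
    ∑ i, ENNReal.ofReal (A.weight y ξ I t i ω) • Measure.dirac (ξ t i ω)

end UnnormalizedFilter

lemma weight_nonneg (t : ℕ) (i : Fin N) (ω : Ω) : 0 ≤ A.weight y ξ I t i ω := by
  cases t with
  | zero => exact w₀_nonneg _
  | succ t => exact w_nonneg _ _ _

lemma weight_le (hC : A.BoundedBy y T C) {t : ℕ} (ht : t ≤ T) (i : Fin N) (ω : Ω) :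
    A.weight y ξ I t i ω ≤ C := by
  cases t with
  | zero => exact hC.w₀_le _
  | succ t => exact hC.w_le _ (by omega) ht _ _

lemma weight_mul_ϑ_nonneg (t : ℕ) (i : Fin N) (ω : Ω) :
    0 ≤ A.weight y ξ I t i ω * A.ϑ (t + 1) (ξ t i ω) :=
  mul_nonneg (weight_nonneg _ _ _) (A.ϑ_pos _ _).le

lemma weight_mul_ϑ_le (hC : A.BoundedBy y T C) {t : ℕ} (ht : t < T) (i : Fin N) (ω : Ω) :
    A.weight y ξ I t i ω * A.ϑ (t + 1) (ξ t i ω) ≤ C * C :=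
  mul_le_mul (weight_le hC ht.le i ω) (hC.ϑ_le _ (by omega) ht _) (A.ϑ_pos _ _).le hC.nonneg

lemma zHat_nonneg (t : ℕ) (ω : Ω) : 0 ≤ A.zHat y ξ I t ω := by
  induction t with
  | zero => exact zero_le_one
  | succ t ih =>
    exact mul_nonneg ih
      (mul_nonneg (by positivity) (Finset.sum_nonneg fun j _ => weight_mul_ϑ_nonneg t j ω))

lemma inv_mul_sum_le {a : Fin N → ℝ} {K : ℝ} (hK : 0 ≤ K) (ha : ∀ i, a i ≤ K) :
    (N : ℝ)⁻¹ * ∑ i, a i ≤ K := by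
  rcases Nat.eq_zero_or_pos N with rfl | hN
  · simpa using hK
  rw [inv_mul_le_iff₀ (by positivity)]
  exact (Finset.sum_le_sum fun i _ => ha i).trans (by simp)

lemma zHat_le (hC : A.BoundedBy y T C) {t : ℕ} (ht : t ≤ T) (ω : Ω) :
    A.zHat y ξ I t ω ≤ (C * C) ^ t := by
  have hC0 := hC.nonneg
  induction t with
  | zero => simp [zHat]
  | succ t ih =>
    rw [zHat, pow_succ]
    exact mul_le_mul (ih (by omega))
      (inv_mul_sum_le (by positivity) fun j => weight_mul_ϑ_le hC ht j ω)
      (mul_nonneg (by positivity) (Finset.sum_nonneg fun j _ => weight_mul_ϑ_nonneg t j ω))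
      (by positivity)

lemma sum_smul_dirac_univ (a : Fin N → ℝ≥0∞) (x : Fin N → X) :
    (∑ i, a i • Measure.dirac (x i)) Set.univ = ∑ i, a i := by
  simp

instance (t : ℕ) (ω : Ω) : IsFiniteMeasure (A.γHat y ξ I t ω) := by
  refine ⟨?_⟩
  rw [γHat, Measure.smul_apply, smul_eq_mul, sum_smul_dirac_univ]
  exact ENNReal.mul_lt_top ENNReal.ofReal_lt_top
    (ENNReal.sum_lt_top.2 fun i _ => ENNReal.ofReal_lt_top)

lemma filterHat_univ_le_one (t : ℕ) (ω : Ω) : A.filterHat y ξ I t ω Set.univ ≤ 1 := by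
  rw [filterHat, Measure.smul_apply, smul_eq_mul, sum_smul_dirac_univ]
  exact ENNReal.inv_mul_le_one _

instance (t : ℕ) (ω : Ω) : IsFiniteMeasure (A.filterHat y ξ I t ω) :=
  ⟨(filterHat_univ_le_one t ω).trans_lt ENNReal.one_lt_top⟩

lemma integral_γHat (t : ℕ) (ω : Ω) {f : X → ℝ} (hf : Measurable f) :
    ∫ x, f x ∂(A.γHat y ξ I t ω)
      = A.zHat y ξ I t ω * (N : ℝ)⁻¹ * ∑ i, A.weight y ξ I t i ω * f (ξ t i ω) := by
  rw [γHat, integral_smul_measure, integral_finsetSum_measure]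
  · simp only [integral_smul_measure, integral_dirac' _ _ hf.stronglyMeasurable, smul_eq_mul]
    rw [ENNReal.toReal_ofReal (mul_nonneg (zHat_nonneg _ _) (by positivity))]
    simp [ENNReal.toReal_ofReal (weight_nonneg _ _ _)]
  · intro i _
    exact (integrable_dirac' hf.stronglyMeasurable (by simp)).smul_measure ENNReal.ofReal_ne_top

lemma γHat_eq_smul_filterHat (t : ℕ) (ω : Ω) :
    A.γHat y ξ I t ω = (ENNReal.ofReal (A.zHat y ξ I t ω * (N : ℝ)⁻¹) *
      ∑ i, ENNReal.ofReal (A.weight y ξ I t i ω)) • A.filterHat y ξ I t ω := by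
  rw [γHat, filterHat, smul_smul, mul_assoc]
  rcases eq_or_ne (∑ i, ENNReal.ofReal (A.weight y ξ I t i ω)) 0 with h | h
  · have hzero : ∀ i, ENNReal.ofReal (A.weight y ξ I t i ω) = 0 := fun i =>
      Finset.sum_eq_zero_iff.1 h i (Finset.mem_univ i)
    simp [hzero]
  · rw [ENNReal.mul_inv_cancel h (ENNReal.sum_ne_top.2 fun i _ => ENNReal.ofReal_ne_top), mul_one]

lemma γHat_real_univ_le (hC : A.BoundedBy y T C) {t : ℕ} (ht : t ≤ T) (ω : Ω) :
    (A.γHat y ξ I t ω).real Set.univ ≤ (C * C) ^ t * C := by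
  have hC0 := hC.nonneg
  have h := integral_γHat (A := A) (y := y) (ξ := ξ) (I := I) t ω measurable_one
  simp only [Pi.one_apply, integral_const, smul_eq_mul, mul_one] at h
  rw [h, mul_assoc]
  exact mul_le_mul (zHat_le hC ht ω) (inv_mul_sum_le hC0 fun i => weight_le hC ht i ω)
    (mul_nonneg (by positivity) (Finset.sum_nonneg fun i _ => weight_nonneg t i ω))
    (by positivity)

lemma abs_integral_γHat_le (hC : A.BoundedBy y T C) {t : ℕ} (ht : t ≤ T) (ω : Ω) {f : X → ℝ}
    {K : ℝ} (hK : ∀ x, |f x| ≤ K) :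
    |∫ x, f x ∂(A.γHat y ξ I t ω)| ≤ (C * C) ^ t * C * K := by
  obtain ⟨x⟩ : Nonempty X := nonempty_of_isProbabilityMeasure A.ρ₀
  rw [mul_comm _ K, ← Real.norm_eq_abs]
  exact (norm_integral_le_of_norm_le_const (ae_of_all _ fun x => by simpa using hK x)).trans
    (mul_le_mul_of_nonneg_left (γHat_real_univ_le hC ht ω) ((abs_nonneg _).trans (hK x)))

lemma weight_eq_zero {t : ℕ} {ω : Ω} (h : ¬ 0 < ∑ i, A.weight y ξ I t i ω) (i : Fin N) :
    A.weight y ξ I t i ω = 0 :=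
  (Finset.sum_eq_zero_iff_of_nonneg (fun i _ => weight_nonneg t i ω)).1
    (le_antisymm (not_lt.1 h) (Finset.sum_nonneg fun i _ => weight_nonneg t i ω)) i
    (Finset.mem_univ i)

lemma zHat_succ_eq_zero {t : ℕ} {ω : Ω} (h : ¬ 0 < ∑ i, A.weight y ξ I t i ω) :
    A.zHat y ξ I (t + 1) ω = 0 := by
  simp [zHat, weight_eq_zero h]

lemma γHat_eq_zero {t : ℕ} {ω : Ω} (h : ¬ 0 < ∑ i, A.weight y ξ I t i ω) :
    A.γHat y ξ I t ω = 0 := by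
  simp [γHat, weight_eq_zero h]

section Measurability

variable [MeasurableSpace Ω]

lemma measurable_weight (hξ : ∀ t i, Measurable (ξ t i)) (hI : ∀ t i, Measurable (I t i)) (t : ℕ)
    (i : Fin N) : Measurable (A.weight y ξ I t i) := by
  cases t with
  | zero => exact measurable_w₀.comp (hξ 0 i)
  | succ t =>
    refine (measurable_w (t + 1)).comp (Measurable.prodMk ?_ (hξ _ i))
    exact (measurable_from_prod_countable_left (f := fun p : Ω × Fin N => ξ t p.2 p.1)
      (fun j => hξ t j)).comp (measurable_id.prodMk (hI (t + 1) i))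

variable {t : ℕ} (hξ : ∀ s ≤ t, ∀ i, Measurable (ξ s i))
  (hw : ∀ s ≤ t, ∀ i, Measurable (A.weight y ξ I s i))

include hξ hw

lemma measurable_zHat {s : ℕ} (hs : s ≤ t + 1) : Measurable (A.zHat y ξ I s) := by
  induction s with
  | zero => exact measurable_const
  | succ s ih =>
    exact (ih (by omega)).mul (measurable_const.mul (Finset.measurable_sum _ fun j _ =>
      (hw s (by omega) j).mul ((A.measurable_ϑ _).comp (hξ s (by omega) j))))

lemma measurable_filterHat {s : ℕ} (hs : s ≤ t) : Measurable (A.filterHat y ξ I s) := by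
  refine Measure.measurable_of_measurable_coe _ fun S hS => ?_
  simp only [filterHat, Measure.smul_apply, Measure.coe_finsetSum, Finset.sum_apply, smul_eq_mul]
  exact (Finset.measurable_sum _ fun i _ => (hw s hs i).ennreal_ofReal).inv.mul
    (Finset.measurable_sum _ fun i _ => (hw s hs i).ennreal_ofReal.mul
      ((Measure.measurable_coe hS).comp (Measure.measurable_dirac.comp (hξ s hs i))))

lemma measurable_backwardInt_filterHat {f : (ℕ → X) → ℝ} (hf : Measurable f) {s : ℕ}
    (hs : s ≤ t + 1) :
    Measurable fun p : Ω × (ℕ → X) =>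
      H.backwardInt (fun u => A.filterHat y ξ I u p.1) s f p.2 := by
  let η : ℕ → Kernel Ω X := fun u =>
    ⟨A.filterHat y ξ I (min u t), measurable_filterHat hξ hw (min_le_right u t)⟩
  have : ∀ u, IsFiniteKernel (η u) := fun u =>
    ⟨1, ENNReal.one_lt_top, fun ω => filterHat_univ_le_one (min u t) ω⟩
  convert HMM.measurable_backwardInt_kernel (H := H) η hf s using 1
  funext p
  refine HMM.backwardInt_congr s (fun u hu => ?_) rfl fun z z' hlt hz hz' => ?_
  · change _ = A.filterHat y ξ I (min u t) p.1
    rw [min_eq_left (by omega)]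
  · congr 1
    funext k
    rcases lt_or_ge k s with hk | hk
    · exact hlt k hk
    · rw [hz k hk, hz' k hk]

lemma measurable_backwardInt_filterHat_const {f : (ℕ → X) → ℝ} (hf : Measurable f) {s : ℕ}
    (hs : s ≤ t + 1) :
    Measurable (Function.uncurry fun (ω : Ω) (x : X) =>
      H.backwardInt (fun u => A.filterHat y ξ I u ω) s f (fun _ => x)) := by
  have hconst : Measurable fun p : Ω × X => ((p.1, fun _ => p.2) : Ω × (ℕ → X)) := by fun_prop
  simpa only [Function.comp_def, Function.uncurry_def] using
    (measurable_backwardInt_filterHat hξ hw hf hs).comp hconst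

lemma measurable_integral_γHat {s : ℕ} (hs : s ≤ t) {E : Type*} [MeasurableSpace E]
    {f : Ω → E → X → ℝ} (hf : Measurable fun p : (Ω × E) × X => f p.1.1 p.1.2 p.2) :
    Measurable fun p : Ω × E => ∫ x, f p.1 p.2 x ∂(A.γHat y ξ I s p.1) := by
  have h : ∀ p : Ω × E, Measurable (f p.1 p.2) := fun p => hf.comp measurable_prodMk_left
  simp_rw [fun p : Ω × E => integral_γHat (A := A) (y := y) (ξ := ξ) (I := I) s p.1 (h p)]
  refine (((measurable_zHat hξ hw (by omega)).comp measurable_fst).mul_const _).mul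
    (Finset.measurable_sum _ fun i _ => ((hw s hs i).comp measurable_fst).mul ?_)
  exact hf.comp (measurable_id.prodMk ((hξ s hs i).comp measurable_fst))

end Measurability

end Particles

end Proposal

end FFBS

namespace FFBS

variable {X Y : Type*} [MeasurableSpace X] [MeasurableSpace Y]

/-- The set `Ω` with the σ-algebra `m` as its measurable structure, so that conditioning on `m` is
conditioning on the map `toWithSigma m` from `Ω` to `WithSigma m`. -/
def WithSigma {Ω : Type*} (_ : MeasurableSpace Ω) : Type _ := Ω

instance WithSigma.instMeasurableSpace {Ω : Type*} (m : MeasurableSpace Ω) :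
    MeasurableSpace (WithSigma m) := m

/-- The identity map from `Ω` to `WithSigma m`. -/
def toWithSigma {Ω : Type*} (m : MeasurableSpace Ω) : Ω → WithSigma m := id

lemma measurable_toWithSigma {Ω : Type*} {m mΩ : MeasurableSpace Ω} (hm : m ≤ mΩ) :
    Measurable (toWithSigma m) := measurable_id'' hm

lemma comap_toWithSigma {Ω : Type*} (m : MeasurableSpace Ω) :
    MeasurableSpace.comap (toWithSigma m) (WithSigma.instMeasurableSpace m) = m :=
  MeasurableSpace.comap_id

namespace Proposal

variable {H : HMM X Y} {A : Proposal H} {y : ℕ → Y} {T : ℕ} {C : ℝ}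

section Step

variable {Ω : Type*} {N : ℕ} {ξ : ℕ → Fin N → Ω → X} {I : ℕ → Fin N → Ω → Fin N}

section Draw

variable (A y ξ I)

/-- The law of a pair (index, particle) of time `t + 1`; the value `δ_{z₀}` on the event that all
weights of time `t` vanish is an arbitrary choice that makes it a probability measure. -/
noncomputable def draw (z₀ : Fin N × X) (t : ℕ) (ω : Ω) : Measure (Fin N × X) :=
  open Classical in
  if 0 < ∑ i, A.weight y ξ I t i ω then A.instr y ξ I t ω else Measure.dirac z₀

/-- The contribution of a pair `z` of index and particle, drawn at time `t + 1`, to the integral of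
`Φ` with respect to the unnormalised particle filter of time `t + 1`. -/
noncomputable def contribution (t : ℕ) (Φ : Ω → X → ℝ) (ω : Ω) (z : Fin N × X) : ℝ :=
  A.zHat y ξ I (t + 1) ω * (A.w y (t + 1) (ξ t z.1 ω) z.2 * Φ ω z.2)

end Draw

lemma sum_weight_mul_ϑ_pos {t : ℕ} {ω : Ω} (h : 0 < ∑ i, A.weight y ξ I t i ω) :
    0 < ∑ i, A.weight y ξ I t i ω * A.ϑ (t + 1) (ξ t i ω) := by
  obtain ⟨i, -, hi⟩ := Finset.exists_lt_of_sum_lt (f := fun _ => (0 : ℝ)) (by simpa using h)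
  exact Finset.sum_pos' (fun i _ => weight_mul_ϑ_nonneg t i ω)
    ⟨i, Finset.mem_univ i, mul_pos hi (A.ϑ_pos _ _)⟩

lemma sum_ofReal_weight_mul_ϑ (t : ℕ) (ω : Ω) :
    ∑ i, ENNReal.ofReal (A.weight y ξ I t i ω * A.ϑ (t + 1) (ξ t i ω))
      = ENNReal.ofReal (∑ i, A.weight y ξ I t i ω * A.ϑ (t + 1) (ξ t i ω)) :=
  (ENNReal.ofReal_sum_of_nonneg fun i _ => weight_mul_ϑ_nonneg t i ω).symm

lemma isProbabilityMeasure_instr {t : ℕ} {ω : Ω} (h : 0 < ∑ i, A.weight y ξ I t i ω) :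
    IsProbabilityMeasure (A.instr y ξ I t ω) := by
  refine ⟨?_⟩
  simp only [instr, Measure.smul_apply, Measure.coe_finsetSum, Finset.sum_apply, measure_univ,
    smul_eq_mul, mul_one]
  rw [sum_ofReal_weight_mul_ϑ]
  exact ENNReal.inv_mul_cancel (ENNReal.ofReal_pos.2 (sum_weight_mul_ϑ_pos h)).ne'
    ENNReal.ofReal_ne_top

instance isProbabilityMeasure_draw (z₀ : Fin N × X) (t : ℕ) (ω : Ω) :
    IsProbabilityMeasure (A.draw y ξ I z₀ t ω) := by
  rw [draw]
  split_ifs with h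
  · exact isProbabilityMeasure_instr h
  · infer_instance

lemma measurable_instr [MeasurableSpace Ω] {t : ℕ} (hξ : ∀ i, Measurable (ξ t i))
    (hw : ∀ i, Measurable (A.weight y ξ I t i)) : Measurable (A.instr y ξ I t) := by
  have hwϑ : ∀ i, Measurable fun ω =>
      ENNReal.ofReal (A.weight y ξ I t i ω * A.ϑ (t + 1) (ξ t i ω)) := fun i =>
    ((hw i).mul ((A.measurable_ϑ _).comp (hξ i))).ennreal_ofReal
  refine Measure.measurable_of_measurable_coe _ fun S hS => ?_
  simp only [instr, Measure.smul_apply, Measure.coe_finsetSum, Finset.sum_apply, smul_eq_mul]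
  refine (Finset.measurable_sum _ fun i _ => hwϑ i).inv.mul
    (Finset.measurable_sum _ fun i _ => (hwϑ i).mul ?_)
  simp_rw [Measure.dirac_prod, Measure.map_apply measurable_prodMk_left hS]
  exact ((A.P (t + 1)).measurable_coe (measurable_prodMk_left hS)).comp (hξ i)

lemma measurable_draw [MeasurableSpace Ω] {t : ℕ} (hξ : ∀ i, Measurable (ξ t i))
    (hw : ∀ i, Measurable (A.weight y ξ I t i)) (z₀ : Fin N × X) :
    Measurable (A.draw y ξ I z₀ t) :=
  Measurable.ite (measurableSet_lt measurable_const (Finset.measurable_sum _ fun i _ => hw i))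
    (measurable_instr hξ hw) measurable_const

section Integral

variable {ψ : X → X → ℝ} (hψ : Measurable (Function.uncurry ψ)) {K : ℝ}
  (hK : ∀ x x', |ψ x x'| ≤ K)

include hψ hK

lemma integral_instr (t : ℕ) (ω : Ω) :
    ∫ z, ψ (ξ t z.1 ω) z.2 ∂(A.instr y ξ I t ω)
      = (∑ i, A.weight y ξ I t i ω * A.ϑ (t + 1) (ξ t i ω))⁻¹
        * ∑ i, A.weight y ξ I t i ω * A.ϑ (t + 1) (ξ t i ω)
          * ∫ x', ψ (ξ t i ω) x' ∂(A.P (t + 1) (ξ t i ω)) := by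
  have hψξ : Measurable fun z : Fin N × X => ψ (ξ t z.1 ω) z.2 :=
    hψ.comp ((measurable_from_top (f := fun i => ξ t i ω)).comp measurable_fst |>.prodMk
      measurable_snd)
  have hsum_nonneg : 0 ≤ ∑ i, A.weight y ξ I t i ω * A.ϑ (t + 1) (ξ t i ω) :=
    Finset.sum_nonneg fun i _ => weight_mul_ϑ_nonneg t i ω
  rw [instr, integral_smul_measure, integral_finsetSum_measure fun i _ =>
    (integrable_of_abs_le hψξ fun z => hK _ _).smul_measure ENNReal.ofReal_ne_top,
    sum_ofReal_weight_mul_ϑ, ENNReal.toReal_inv, ENNReal.toReal_ofReal hsum_nonneg, smul_eq_mul]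
  congr 1
  refine Finset.sum_congr rfl fun i _ => ?_
  rw [integral_smul_measure, ENNReal.toReal_ofReal (weight_mul_ϑ_nonneg t i ω), smul_eq_mul,
    Measure.dirac_prod, integral_map measurable_prodMk_left.aemeasurable hψξ.aestronglyMeasurable]

lemma zHat_succ_mul_integral_draw (z₀ : Fin N × X) (t : ℕ) (ω : Ω) :
    A.zHat y ξ I (t + 1) ω * ∫ z, ψ (ξ t z.1 ω) z.2 ∂(A.draw y ξ I z₀ t ω)
      = ∫ x, A.ϑ (t + 1) x * ∫ x', ψ x x' ∂(A.P (t + 1) x) ∂(A.γHat y ξ I t ω) := by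
  by_cases h : 0 < ∑ i, A.weight y ξ I t i ω
  swap
  · simp [zHat_succ_eq_zero h, γHat_eq_zero h]
  have hψP : Measurable fun x => ∫ x', ψ x x' ∂(A.P (t + 1) x) :=
    (hψ.stronglyMeasurable.integral_kernel_prod_right (κ := A.P (t + 1))).measurable
  rw [integral_γHat t ω (f := fun x => A.ϑ (t + 1) x * ∫ x', ψ x x' ∂(A.P (t + 1) x))
    ((A.measurable_ϑ _).mul hψP), draw, if_pos h, integral_instr hψ hK, zHat]
  have hpos := sum_weight_mul_ϑ_pos h
  simp only [mul_assoc] at hpos ⊢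
  field_simp

end Integral

section Contribution

lemma average_contribution (t : ℕ) {Φ : Ω → X → ℝ} (ω : Ω) (hΦ : Measurable (Φ ω)) :
    (N : ℝ)⁻¹ * ∑ i, A.contribution y ξ I t Φ ω (I (t + 1) i ω, ξ (t + 1) i ω)
      = ∫ x, Φ ω x ∂(A.γHat y ξ I (t + 1) ω) := by
  rw [integral_γHat _ _ hΦ]
  simp only [contribution, weight]
  rw [← Finset.mul_sum]
  ring

lemma contribution_eq_zero {t : ℕ} (Φ : Ω → X → ℝ) {ω : Ω}
    (h : ¬ 0 < ∑ i, A.weight y ξ I t i ω) (z : Fin N × X) :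
    A.contribution y ξ I t Φ ω z = 0 := by
  rw [contribution, zHat_succ_eq_zero h, zero_mul]

lemma measurable_contribution [MeasurableSpace Ω] {t : ℕ} (hξ : ∀ s ≤ t, ∀ i, Measurable (ξ s i))
    (hw : ∀ s ≤ t, ∀ i, Measurable (A.weight y ξ I s i)) {Φ : Ω → X → ℝ}
    (hΦ : Measurable (Function.uncurry Φ)) :
    Measurable (Function.uncurry (A.contribution y ξ I t Φ)) := by
  have hancestor : Measurable fun p : Ω × (Fin N × X) => ξ t p.2.1 p.1 :=
    (measurable_from_prod_countable_left (f := fun p : Ω × Fin N => ξ t p.2 p.1)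
      (fun j => hξ t le_rfl j)).comp (measurable_fst.prodMk (measurable_fst.comp measurable_snd))
  have hparticle : Measurable fun p : Ω × (Fin N × X) => p.2.2 := measurable_snd.snd
  exact ((measurable_zHat hξ hw le_rfl).comp measurable_fst).mul
    (((measurable_w (t + 1)).comp (hancestor.prodMk hparticle)).mul
      (hΦ.comp (measurable_fst.prodMk hparticle)))

variable {t : ℕ} {Φ : Ω → X → ℝ} {ω : Ω} {K : ℝ} (hC : A.BoundedBy y T C) (ht : t < T)
  (hK : ∀ x, |Φ ω x| ≤ K)

include hC ht hK

lemma abs_contribution_le (z : Fin N × X) :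
    |A.contribution y ξ I t Φ ω z| ≤ (C * C) ^ (t + 1) * (C * K) := by
  have hC0 := hC.nonneg
  rw [contribution, abs_mul, abs_of_nonneg (zHat_nonneg _ _)]
  exact mul_le_mul (zHat_le hC ht _) (abs_w_mul_le hC (by omega) ht (hK _) _ _) (abs_nonneg _)
    (by positivity)

variable (hΦ : Measurable (Φ ω)) (z₀ : Fin N × X)

include hΦ

lemma integral_contribution :
    ∫ z, A.contribution y ξ I t Φ ω z ∂(A.draw y ξ I z₀ t ω)
      = ∫ x, ∫ x', H.g y (t + 1) x' * Φ ω x' ∂(H.M x) ∂(A.γHat y ξ I t ω) := by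
  simp only [contribution, integral_const_mul]
  rw [zHat_succ_mul_integral_draw (ψ := fun x x' => A.w y (t + 1) x x' * Φ ω x')
    ((measurable_w _).mul (hΦ.comp measurable_snd))
    fun x x' => abs_w_mul_le hC (by omega) ht (hK x') x x']
  simp only [ϑ_mul_integral_P_w_mul hC (show 1 ≤ t + 1 by omega) ht]

lemma integral_sq_contribution :
    ∫ z, A.contribution y ξ I t Φ ω z ^ 2 ∂(A.draw y ξ I z₀ t ω)
      = A.zHat y ξ I (t + 1) ω * ∫ x, A.ϑ (t + 1) x
          * ∫ x', A.w y (t + 1) x x' ^ 2 * Φ ω x' ^ 2 ∂(A.P (t + 1) x) ∂(A.γHat y ξ I t ω) := by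
  have hmeas : Measurable
      (Function.uncurry fun x x' => A.w y (t + 1) x x' ^ 2 * Φ ω x' ^ 2) :=
    ((measurable_w (t + 1)).pow_const 2).mul ((hΦ.pow_const 2).comp measurable_snd)
  have hbound : ∀ x x', |A.w y (t + 1) x x' ^ 2 * Φ ω x' ^ 2| ≤ (C * K) ^ 2 := fun x x' => by
    rw [← mul_pow, abs_pow]
    exact pow_le_pow_left₀ (abs_nonneg _) (abs_w_mul_le hC (by omega) ht (hK x') x x') 2
  rw [← zHat_succ_mul_integral_draw hmeas hbound z₀ t ω]
  simp only [contribution, mul_pow, integral_const_mul]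
  ring

end Contribution

lemma measurable_hist_pair {s t : ℕ} (hs : s ≤ t) (i : Fin N) :
    Measurable[A.hist y ξ I t] fun ω => (ξ s i ω, A.weight y ξ I s i ω) :=
  (comap_measurable _).mono (le_iSup₂_of_le s (by simp; omega) (le_iSup_of_le i le_rfl)) le_rfl

lemma measurable_hist_ξ {s t : ℕ} (hs : s ≤ t) (i : Fin N) :
    Measurable[A.hist y ξ I t] (ξ s i) :=
  measurable_fst.comp (measurable_hist_pair hs i)

lemma measurable_hist_weight {s t : ℕ} (hs : s ≤ t) (i : Fin N) :
    Measurable[A.hist y ξ I t] (A.weight y ξ I s i) :=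
  measurable_snd.comp (measurable_hist_pair hs i)

namespace IsParticleFilter

variable [mΩ : MeasurableSpace Ω] {μ : Measure Ω}

lemma measurable_weight (hF : A.IsParticleFilter y ξ I μ T) (t : ℕ) (i : Fin N) :
    Measurable (A.weight y ξ I t i) :=
  Proposal.measurable_weight hF.measurable_ξ hF.measurable_I t i

lemma hist_le (hF : A.IsParticleFilter y ξ I μ T) (t : ℕ) : A.hist y ξ I t ≤ mΩ :=
  iSup₂_le fun s _ => iSup_le fun i =>
    ((hF.measurable_ξ s i).prodMk (hF.measurable_weight s i)).comap_le

variable [IsProbabilityMeasure μ]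

lemma isCondIIDAverage_zero (hF : A.IsParticleFilter y ξ I μ T) (hC : A.BoundedBy y T C)
    {f : X → ℝ} (hf : Measurable f) {K : ℝ} (hK : ∀ x, |f x| ≤ K) :
    IsCondIIDAverage μ (fun _ => ()) N (C * K) (fun ω => ∫ x, f x ∂(A.γHat y ξ I 0 ω))
      (fun _ => ∫ x, f x ∂(H.γ y 0)) fun _ => ∫ x, A.w₀ y x ^ 2 * f x ^ 2 ∂A.ρ₀ := by
  have hiid : IsCondIID μ (fun _ => ()) (Kernel.const Unit A.ρ₀) (ξ 0) := by
    have hξ : Measurable fun ω i => ξ 0 i ω := measurable_pi_lambda _ (hF.measurable_ξ 0)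
    have hlaw : μ.map (fun ω i => ξ 0 i ω) = Measure.pi fun _ => A.ρ₀ := by
      rw [hF.indep_init.map_fun_eq_pi_map fun i => (hF.measurable_ξ 0 i).aemeasurable]
      simp only [hF.law_init]
    have hconst : μ.map (fun _ => ()) = Measure.dirac () := by simp [Measure.map_const]
    rw [IsCondIID, hconst, Measure.dirac_unit_compProd, iidKernel_apply, Kernel.const_apply,
      ← hlaw, Measure.map_map measurable_prodMk_left hξ]
    rfl
  have h := IsCondIID.isCondIIDAverage (D := Set.univ) (by simpa using hiid) measurable_const
    MeasurableSet.univ (hF.measurable_ξ 0) (Ψ := fun _ x => A.w₀ y x * f x)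
    ((measurable_w₀.mul hf).comp measurable_snd) (by simp) fun _ x => abs_w₀_mul_le hC (hK x) x
  simpa [integral_w₀_mul, mul_pow, integral_γHat 0 _ hf, zHat, weight] using h

lemma isCondIID_succ (hF : A.IsParticleFilter y ξ I μ T) {t : ℕ} (ht : t < T)
    {κ : Kernel (WithSigma (A.hist y ξ I t)) (Fin N × X)} [IsMarkovKernel κ]
    (hκ : ∀ ω : Ω, 0 < ∑ i, A.weight y ξ I t i ω → κ ω = A.instr y ξ I t ω) :
    IsCondIID (E := WithSigma (A.hist y ξ I t))
      (μ.restrict ((toWithSigma (A.hist y ξ I t)) ⁻¹' {ω | 0 < ∑ i, A.weight y ξ I t i ω}))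
      (toWithSigma (A.hist y ξ I t)) κ fun i ω => (I (t + 1) i ω, ξ (t + 1) i ω) := by
  have hpos : MeasurableSet[A.hist y ξ I t] {ω | 0 < ∑ i, A.weight y ξ I t i ω} :=
    measurableSet_lt measurable_const
      (Finset.measurable_sum _ fun i _ => measurable_hist_weight le_rfl i)
  refine map_prodMk_restrict_eq_compProd_of_condExp (measurable_toWithSigma (hF.hist_le t))
    (measurable_pi_lambda _ fun i => (hF.measurable_I _ i).prodMk (hF.measurable_ξ _ i)) hpos
    fun S hS => ?_
  rw [comap_toWithSigma]
  filter_upwards [hF.step t ht S hS, ae_restrict_mem (hF.hist_le t _ hpos)] with ω hω hω_pos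
  rw [iidKernel_apply, toWithSigma, id, hκ ω hω_pos]
  exact hω

lemma isCondIIDAverage_succ (hF : A.IsParticleFilter y ξ I μ T) (hC : A.BoundedBy y T C)
    (hN : N ≠ 0) {t : ℕ} (ht : t < T) {Φ : WithSigma (A.hist y ξ I t) → X → ℝ}
    (hΦ : Measurable (Function.uncurry Φ)) {K : ℝ} (hK : ∀ ω x, |Φ ω x| ≤ K) :
    IsCondIIDAverage μ (toWithSigma (A.hist y ξ I t)) N ((C * C) ^ (t + 1) * (C * K))
      (fun ω => ∫ x, Φ ω x ∂(A.γHat y ξ I (t + 1) ω))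
      (fun ω => ∫ x, ∫ x', H.g y (t + 1) x' * Φ ω x' ∂(H.M x) ∂(A.γHat y ξ I t ω))
      fun ω => A.zHat y ξ I (t + 1) ω * ∫ x, A.ϑ (t + 1) x
        * ∫ x', A.w y (t + 1) x x' ^ 2 * Φ ω x' ^ 2 ∂(A.P (t + 1) x) ∂(A.γHat y ξ I t ω) := by
  obtain ⟨x₀⟩ : Nonempty X := nonempty_of_isProbabilityMeasure A.ρ₀
  let z₀ : Fin N × X := (⟨0, Nat.pos_of_ne_zero hN⟩, x₀)
  have hξ : ∀ s ≤ t, ∀ i, Measurable[A.hist y ξ I t] (ξ s i) := fun s hs i =>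
    measurable_hist_ξ hs i
  have hw : ∀ s ≤ t, ∀ i, Measurable[A.hist y ξ I t] (A.weight y ξ I s i) := fun s hs i =>
    measurable_hist_weight hs i
  have hΦω : ∀ ω, Measurable (Φ ω) := fun _ => hΦ.of_uncurry_left
  let κ : Kernel (WithSigma (A.hist y ξ I t)) (Fin N × X) :=
    ⟨A.draw y ξ I z₀ t, measurable_draw (Ω := WithSigma (A.hist y ξ I t)) (hξ t le_rfl)
      (hw t le_rfl) z₀⟩
  have : IsMarkovKernel κ := ⟨fun ω => isProbabilityMeasure_draw (Ω := Ω) z₀ t ω⟩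
  have h := (hF.isCondIID_succ ht (κ := κ) fun ω hω => if_pos hω).isCondIIDAverage
    (measurable_toWithSigma (hF.hist_le t))
    (measurableSet_lt measurable_const (Finset.measurable_sum _ fun i _ => hw t le_rfl i))
    (fun i => (hF.measurable_I _ i).prodMk (hF.measurable_ξ _ i))
    (measurable_contribution (Ω := WithSigma (A.hist y ξ I t)) hξ hw hΦ)
    (fun ω hω z => contribution_eq_zero (Ω := Ω) Φ hω z)
    (fun ω z => abs_contribution_le (Ω := Ω) hC ht (hK ω) z)
  have hmean := fun ω : Ω =>
    average_contribution (A := A) (y := y) (ξ := ξ) (I := I) (Φ := Φ) t ω (hΦω ω)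
  have hint := fun ω : Ω =>
    integral_contribution (ξ := ξ) (I := I) (Φ := Φ) hC ht (hK ω) (hΦω ω) z₀
  have hint_sq := fun ω : Ω =>
    integral_sq_contribution (ξ := ξ) (I := I) (Φ := Φ) hC ht (hK ω) (hΦω ω) z₀
  simp only [← hmean, ← hint, ← hint_sq]
  exact h

end IsParticleFilter

end Step

end Proposal

end FFBS

namespace FFBS

variable {X Y : Type*} [MeasurableSpace X] [MeasurableSpace Y]

namespace Proposal

variable {H : HMM X Y} {A : Proposal H} {y : ℕ → Y} {T : ℕ} {C : ℝ}

lemma measurable_integral_M_g_mul (t : ℕ) {f : X → ℝ} (hf : Measurable f) :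
    Measurable fun x => ∫ x', H.g y t x' * f x' ∂(H.M x) :=
  (StronglyMeasurable.integral_kernel_prod_right (κ := H.M) (f := fun _ x' => H.g y t x' * f x')
    (((HMM.measurable_g t).mul hf).comp measurable_snd).stronglyMeasurable).measurable

lemma abs_integral_M_g_mul_le (hC : A.BoundedBy y T C) {t : ℕ} (ht : t ≤ T) {f : X → ℝ} {K : ℝ}
    (hK : ∀ x, |f x| ≤ K) (x : X) : |∫ x', H.g y t x' * f x' ∂(H.M x)| ≤ C * K :=
  abs_integral_le_of_abs_le (ae_of_all _ fun x' => HMM.abs_g_mul_le hC.g_le ht x' (hK x'))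

/-- The integral `∫ η(dx) ϑ_t(x) ∫ P_t(x, dx') ω_t(x, x')² Φ(x')²`. For `η = φ_{t-1}` and
`Φ = G_{t,T}(·, h)` it is the integral of `υ_{t,T}(·, h)` in the asymptotic variance; for
`η = γ̂_{t-1}` it gives the conditional second moment of one selection and mutation step. -/
noncomputable def secondMoment (A : Proposal H) (y : ℕ → Y) (t : ℕ) (η : Measure X) (Φ : X → ℝ) :
    ℝ :=
  ∫ x, A.ϑ t x * ∫ x', A.w y t x x' ^ 2 * Φ x' ^ 2 ∂(A.P t x) ∂η

/-- The constant in the mean square error of the particle approximation at time `t`. -/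
def mseConst (C : ℝ) : ℕ → ℝ
  | 0 => C ^ 2
  | t + 1 => 2 * ((C * C) ^ (t + 1) * C) ^ 2 + 2 * (mseConst C t * C ^ 2)

section Particles

variable {Ω : Type*} {N : ℕ} {ξ : ℕ → Fin N → Ω → X} {I : ℕ → Fin N → Ω → Fin N}

/-- The particle approximation `∫ γ̂_t(dx_t) B_{φ̂_{t-1}}(x_t, dx_{t-1}) ⋯ B_{φ̂_0}(x_1, dx_0) f(x)`
of the unnormalised smoothing functional at time `t`. -/
noncomputable def pathHat (A : Proposal H) (y : ℕ → Y) (ξ : ℕ → Fin N → Ω → X)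
    (I : ℕ → Fin N → Ω → Fin N) (t : ℕ) (f : (ℕ → X) → ℝ) (ω : Ω) : ℝ :=
  ∫ x, H.backwardInt (fun s => A.filterHat y ξ I s ω) t f (fun _ => x) ∂(A.γHat y ξ I t ω)

lemma abs_pathHat_le (hC : A.BoundedBy y T C) {t : ℕ} (ht : t ≤ T) {f : (ℕ → X) → ℝ} {K : ℝ}
    (hK : ∀ x, |f x| ≤ K) (ω : Ω) : |A.pathHat y ξ I t f ω| ≤ (C * C) ^ t * C * K :=
  abs_integral_γHat_le hC ht ω fun _ => HMM.abs_backwardInt_le hC.m_le _ hK t _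

lemma pathHat_forwardInt_succ (hC : A.BoundedBy y T C) {f : (ℕ → X) → ℝ} (hf : Measurable f)
    {K : ℝ} (hK : ∀ x, |f x| ≤ K) {k t : ℕ} (hdep : DependsOn f (Set.Iic (t + (k + 1))))
    (ht : t + (k + 1) ≤ T) (ω : Ω) :
    A.pathHat y ξ I t (H.forwardInt y (k + 1) t f) ω
      = ∫ x, ∫ x', H.g y (t + 1) x' * H.backwardInt (fun s => A.filterHat y ξ I s ω) (t + 1)
          (H.forwardInt y k (t + 1) f) (fun _ => x') ∂(H.M x) ∂(A.γHat y ξ I t ω) :=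
  HMM.integral_backwardInt_forwardInt_succ hC.g_le hC.m_le _ hf hK hdep ht
    (γHat_eq_smul_filterHat t ω)

lemma measurable_hist_backwardInt (t : ℕ) {f : (ℕ → X) → ℝ} (hf : Measurable f) :
    Measurable (Function.uncurry fun (ω : WithSigma (A.hist y ξ I t)) x =>
      H.backwardInt (fun s => A.filterHat y ξ I s ω) (t + 1) f (fun _ => x)) :=
  @measurable_backwardInt_filterHat_const _ _ _ _ H A y Ω N ξ I (A.hist y ξ I t) t
    (fun _ hs i => measurable_hist_ξ hs i) (fun _ hs i => measurable_hist_weight hs i) f hf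
    (t + 1) le_rfl

lemma pathHat_one_le (hC : A.BoundedBy y T C) (t : ℕ) (ω : Ω) :
    A.pathHat y ξ I t (fun _ => 1) ω ≤ (A.γHat y ξ I t ω).real Set.univ := by
  have hle (x : ℕ → X) :
      |H.backwardInt (fun s => A.filterHat y ξ I s ω) t (fun _ => 1) x| ≤ 1 :=
    HMM.abs_backwardInt_le hC.m_le _ (by simp) t x
  calc A.pathHat y ξ I t (fun _ => 1) ω ≤ ∫ _, (1 : ℝ) ∂(A.γHat y ξ I t ω) :=
        integral_mono (integrable_of_abs_le ((HMM.measurable_backwardInt _ measurable_const t).comp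
          (measurable_pi_lambda _ fun _ => measurable_id)) fun x => hle _) (integrable_const _)
          fun x => (le_abs_self _).trans (hle _)
    _ = (A.γHat y ξ I t ω).real Set.univ := by simp

namespace IsParticleFilter

variable [mΩ : MeasurableSpace Ω] {μ : Measure Ω}

lemma measurable_integral_γHat (hF : A.IsParticleFilter y ξ I μ T) (t : ℕ)
    {f : Ω → X → ℝ} (hf : Measurable (Function.uncurry f)) :
    Measurable fun ω => ∫ x, f ω x ∂(A.γHat y ξ I t ω) :=
  (Proposal.measurable_integral_γHat (t := t) (fun s _ i => hF.measurable_ξ s i)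
    (fun s _ i => hF.measurable_weight s i) le_rfl (E := Unit) (f := fun ω _ x => f ω x)
    (hf.comp ((measurable_fst.comp measurable_fst).prodMk measurable_snd))).comp
    (measurable_id.prodMk (measurable_const (a := ())))

lemma measurable_backwardInt (hF : A.IsParticleFilter y ξ I μ T) (t : ℕ)
    {f : (ℕ → X) → ℝ} (hf : Measurable f) :
    Measurable (Function.uncurry fun ω x =>
      H.backwardInt (fun s => A.filterHat y ξ I s ω) t f (fun _ => x)) :=
  measurable_backwardInt_filterHat_const (t := t) (fun s _ i => hF.measurable_ξ s i)
    (fun s _ i => hF.measurable_weight s i) hf (Nat.le_succ t)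

lemma measurable_pathHat (hF : A.IsParticleFilter y ξ I μ T) (t : ℕ)
    {f : (ℕ → X) → ℝ} (hf : Measurable f) : Measurable (A.pathHat y ξ I t f) :=
  hF.measurable_integral_γHat t (hF.measurable_backwardInt t hf)

lemma measurable_real_γHat_univ (hF : A.IsParticleFilter y ξ I μ T) (t : ℕ) :
    Measurable fun ω => (A.γHat y ξ I t ω).real Set.univ := by
  simpa using hF.measurable_integral_γHat t (f := fun _ _ => (1 : ℝ)) measurable_const

variable [IsProbabilityMeasure μ] (hF : A.IsParticleFilter y ξ I μ T) (hC : A.BoundedBy y T C)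
  (hN : N ≠ 0)

include hF hC hN

section Filter

variable {t : ℕ} (ht : t ≤ T) {f : X → ℝ} (hf : Measurable f) {K : ℝ} (hK : ∀ x, |f x| ≤ K)

include ht hf hK

lemma integral_integral_γHat :
    ∫ ω, ∫ x, f x ∂(A.γHat y ξ I t ω) ∂μ = ∫ x, f x ∂(H.γ y t) := by
  induction t generalizing f K with
  | zero => simpa using (hF.isCondIIDAverage_zero hC hf hK).integral_eq hN
  | succ t ih =>
    rw [HMM.integral_γ_succ hC.g_le ht hf hK, ← ih (by omega) (measurable_integral_M_g_mul _ hf)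
      (abs_integral_M_g_mul_le hC ht hK)]
    exact (hF.isCondIIDAverage_succ hC hN ht (Φ := fun _ => f) (hf.comp measurable_snd)
      fun _ => hK).integral_eq hN

lemma integral_integral_γHat_sub_sq_le :
    ∫ ω, (∫ x, f x ∂(A.γHat y ξ I t ω) - ∫ x, f x ∂(H.γ y t)) ^ 2 ∂μ
      ≤ mseConst C t * K ^ 2 / N := by
  induction t generalizing f K with
  | zero =>
    simpa [mseConst, mul_pow] using (hF.isCondIIDAverage_zero hC hf hK).integral_sub_sq_le hN
  | succ t ih =>
    rw [HMM.integral_γ_succ hC.g_le ht hf hK]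
    refine ((hF.isCondIIDAverage_succ hC hN ht (Φ := fun _ => f) (hf.comp measurable_snd)
      fun _ => hK).integral_sub_const_sq_le hN _).trans ?_
    grw [ih (by omega) (measurable_integral_M_g_mul _ hf) (abs_integral_M_g_mul_le hC ht hK)]
    rw [mseConst]
    exact le_of_eq (by ring)

end Filter

section Path

variable {k : ℕ} {f : (ℕ → X) → ℝ} (hf : Measurable f) {K : ℝ} (hK : ∀ x, |f x| ≤ K)

include hf hK

omit hN in
lemma isCondIIDAverage_pathHat_zero (hk : k ≤ T) :
    IsCondIIDAverage μ (fun _ => ()) N (C * (C ^ k * K))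
      (A.pathHat y ξ I 0 (H.forwardInt y k 0 f))
      (fun _ => ∫ x, H.forwardInt y k 0 f (fun _ => x) ∂(H.γ y 0))
      fun _ => ∫ x, A.w₀ y x ^ 2 * H.forwardInt y k 0 f (fun _ => x) ^ 2 ∂A.ρ₀ :=
  hF.isCondIIDAverage_zero hC ((HMM.measurable_forwardInt hf k 0).comp
    (measurable_pi_lambda _ fun _ => measurable_id))
    fun x => HMM.abs_forwardInt_le hC.g_le hK k (by omega) _

/-- Hence `pathHat t`, evaluated at the forward integral of `f` from time `t`, is a martingale. -/
lemma isCondIIDAverage_pathHat_succ {t : ℕ} (ht : t + (k + 1) ≤ T)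
    (hdep : DependsOn f (Set.Iic (t + (k + 1)))) :
    IsCondIIDAverage μ (toWithSigma (A.hist y ξ I t)) N ((C * C) ^ (t + 1) * (C * (C ^ k * K)))
      (A.pathHat y ξ I (t + 1) (H.forwardInt y k (t + 1) f))
      (A.pathHat y ξ I t (H.forwardInt y (k + 1) t f))
      fun ω => A.zHat y ξ I (t + 1) ω * A.secondMoment y (t + 1) (A.γHat y ξ I t ω)
        fun x => H.backwardInt (fun s => A.filterHat y ξ I s ω) (t + 1)
          (H.forwardInt y k (t + 1) f) (fun _ => x) := by
  rw [funext (pathHat_forwardInt_succ hC hf hK hdep ht)]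
  exact hF.isCondIIDAverage_succ hC hN (by omega)
    (measurable_hist_backwardInt t (HMM.measurable_forwardInt hf k _))
    fun (ω : Ω) _ => HMM.abs_backwardInt_le hC.m_le _
      (HMM.abs_forwardInt_le hC.g_le hK k (by omega)) _ _

variable {t : ℕ} (ht : t + k ≤ T) (hdep : DependsOn f (Set.Iic (t + k)))

include ht hdep

lemma integral_pathHat :
    ∫ ω, A.pathHat y ξ I t (H.forwardInt y k t f) ω ∂μ
      = ∫ x, H.forwardInt y (t + k) 0 f (fun _ => x) ∂(H.γ y 0) := by
  induction t generalizing k with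
  | zero =>
    rw [zero_add] at ht ⊢
    simpa using (hF.isCondIIDAverage_pathHat_zero hC hf hK ht).integral_eq hN
  | succ t ih =>
    rw [add_right_comm, add_assoc] at hdep ht ⊢
    rw [← ih ht hdep]
    exact (hF.isCondIIDAverage_pathHat_succ hC hN hf hK ht hdep).integral_eq hN

lemma integral_pathHat_sub_sq_le :
    ∫ ω, (A.pathHat y ξ I t (H.forwardInt y k t f) ω
      - ∫ x, H.forwardInt y (t + k) 0 f (fun _ => x) ∂(H.γ y 0)) ^ 2 ∂μ
      ≤ mseConst C t * (C ^ k * K) ^ 2 / N := by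
  induction t generalizing k with
  | zero =>
    rw [zero_add] at ht ⊢
    simpa only [mseConst, ← mul_pow] using
      (hF.isCondIIDAverage_pathHat_zero hC hf hK ht).integral_sub_sq_le hN
  | succ t ih =>
    rw [add_right_comm, add_assoc] at hdep ht ⊢
    refine ((hF.isCondIIDAverage_pathHat_succ hC hN hf hK ht hdep).integral_sub_const_sq_le
      hN _).trans ?_
    grw [ih ht hdep]
    rw [mseConst]
    exact le_of_eq (by ring)

end Path

/-- Backward kernels may fail to be normalised (`0 / 0 = 0`), but an estimate dominated by the
likelihood estimate that has the same expectation coincides with it. -/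
lemma pathHat_one_ae_eq {t : ℕ} (ht : t ≤ T) :
    A.pathHat y ξ I t (fun _ => 1) =ᵐ[μ] fun ω => (A.γHat y ξ I t ω).real Set.univ := by
  refine (integral_eq_iff_of_ae_le
    (integrable_of_abs_le (hF.measurable_pathHat t measurable_const)
      (abs_pathHat_le hC ht (K := 1) (by simp)))
    (integrable_of_abs_le (hF.measurable_real_γHat_univ t) (K := (C * C) ^ t * C) fun ω => ?_)
    (ae_of_all _ fun ω => pathHat_one_le hC t ω)).1 ?_
  · exact (abs_of_nonneg measureReal_nonneg).trans_le (γHat_real_univ_le hC ht ω)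
  · have hpath := hF.integral_pathHat hC hN (k := 0) (f := fun _ => 1) measurable_const (K := 1)
      (by simp) ht fun _ _ _ => rfl
    have hfilter := hF.integral_integral_γHat hC hN ht (f := fun _ => 1) measurable_const (K := 1)
      (by simp)
    have hlikelihood := HMM.integral_γ_forwardInt_one hC.g_le t (t := 0) (by omega)
    simp only [HMM.forwardInt, add_zero, zero_add, integral_const, smul_eq_mul, mul_one]
      at hpath hfilter hlikelihood
    rw [hpath, hfilter, hlikelihood]

end IsParticleFilter

end Particles

end Proposal

end FFBS

namespace FFBS

variable {X Y : Type*} [MeasurableSpace X] [MeasurableSpace Y]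

section ConvergenceInMean

variable {Ω : Type*} [MeasurableSpace Ω] {μ : Measure Ω}

lemma lintegral_enorm_le_ofReal_sqrt_integral_sq [IsProbabilityMeasure μ] {Z : Ω → ℝ}
    (hZ : MemLp Z 2 μ) : ∫⁻ ω, ‖Z ω‖ₑ ∂μ ≤ ENNReal.ofReal √(∫ ω, Z ω ^ 2 ∂μ) :=
  calc ∫⁻ ω, ‖Z ω‖ₑ ∂μ = eLpNorm Z 1 μ := eLpNorm_one_eq_lintegral_enorm.symm
    _ ≤ eLpNorm Z 2 μ := eLpNorm_le_eLpNorm_of_exponent_le one_le_two hZ.aestronglyMeasurable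
    _ = ENNReal.ofReal √(∫ ω, Z ω ^ 2 ∂μ) := by
        rw [hZ.eLpNorm_eq_integral_rpow_norm two_ne_zero ENNReal.ofNat_ne_top]
        simp [Real.sqrt_eq_rpow]

lemma tendsto_lintegral_enorm_sub_of_integral_sq_le [IsProbabilityMeasure μ] {Z : ℕ → Ω → ℝ}
    (hZ : ∀ N, MemLp (Z N) 2 μ) {c B : ℝ}
    (h : ∀ N : ℕ, N ≠ 0 → ∫ ω, (Z N ω - c) ^ 2 ∂μ ≤ B / N) :
    Tendsto (fun N => ∫⁻ ω, ‖Z N ω - c‖ₑ ∂μ) atTop (𝓝 0) := by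
  have hrate : Tendsto (fun N : ℕ => ENNReal.ofReal √(B / N)) atTop (𝓝 0) := by
    have hdiv : Tendsto (fun N : ℕ => B / (N : ℝ)) atTop (𝓝 0) :=
      tendsto_const_nhds.div_atTop tendsto_natCast_atTop_atTop
    simpa using ENNReal.tendsto_ofReal hdiv.sqrt
  refine tendsto_of_tendsto_of_tendsto_of_le_of_le' tendsto_const_nhds hrate
    (Eventually.of_forall fun _ => zero_le) ?_
  filter_upwards [eventually_ne_atTop 0] with N hN
  refine (lintegral_enorm_le_ofReal_sqrt_integral_sq ((hZ N).sub (memLp_const c))).trans ?_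
  exact ENNReal.ofReal_le_ofReal (Real.sqrt_le_sqrt (h N hN))

lemma tendsto_lintegral_enorm_of_abs_le {Z U V W : ℕ → Ω → ℝ} {a b c : ℝ}
    (hUm : ∀ N, Measurable (U N)) (hVm : ∀ N, Measurable (V N))
    (h : ∀ N ω, |Z N ω| ≤ a * |U N ω| + b * |V N ω| + c * |W N ω|)
    (hU : Tendsto (fun N => ∫⁻ ω, ‖U N ω‖ₑ ∂μ) atTop (𝓝 0))
    (hV : Tendsto (fun N => ∫⁻ ω, ‖V N ω‖ₑ ∂μ) atTop (𝓝 0))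
    (hW : Tendsto (fun N => ∫⁻ ω, ‖W N ω‖ₑ ∂μ) atTop (𝓝 0)) :
    Tendsto (fun N => ∫⁻ ω, ‖Z N ω‖ₑ ∂μ) atTop (𝓝 0) := by
  have hmul (r : ℝ) {S : ℕ → Ω → ℝ} (hS : Tendsto (fun N => ∫⁻ ω, ‖S N ω‖ₑ ∂μ) atTop (𝓝 0)) :
      Tendsto (fun N => ∫⁻ ω, ‖r * S N ω‖ₑ ∂μ) atTop (𝓝 0) := by
    simp_rw [enorm_mul, lintegral_const_mul' _ _ enorm_ne_top]
    simpa using ENNReal.Tendsto.const_mul hS (Or.inr enorm_ne_top)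
  have hle (N : ℕ) (ω : Ω) :
      ‖Z N ω‖ₑ ≤ ‖a * U N ω‖ₑ + ‖b * V N ω‖ₑ + ‖c * W N ω‖ₑ := by
    simp only [Real.enorm_eq_ofReal_abs]
    rw [← ENNReal.ofReal_add (abs_nonneg _) (abs_nonneg _),
      ← ENNReal.ofReal_add (by positivity) (abs_nonneg _)]
    refine ENNReal.ofReal_le_ofReal ((h N ω).trans ?_)
    simp only [abs_mul]
    gcongr <;> exact le_abs_self _
  have hsum := ((hmul a hU).add (hmul b hV)).add (hmul c hW)
  rw [add_zero, add_zero] at hsum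
  refine tendsto_of_tendsto_of_tendsto_of_le_of_le tendsto_const_nhds hsum
    (fun _ => zero_le) fun N => ?_
  simp only
  rw [← lintegral_add_left ((hUm N).const_mul a).enorm,
    ← lintegral_add_left (f := fun ω => ‖a * U N ω‖ₑ + ‖b * V N ω‖ₑ)
      (((hUm N).const_mul a).enorm.add ((hVm N).const_mul b).enorm)]
  exact lintegral_mono (hle N)

end ConvergenceInMean

/-- The expression is `a * (b / c) ^ 2`, but there is no lower bound on `c`: the quotient `b / c`
enters only through `c * F = b`, and the factor `a ≤ D * c` absorbs the small denominators. -/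
lemma abs_mul_sq_sub_le {a a' b b' c c' F F' K D : ℝ} (hb : c * F = b) (hb' : c' * F' = b')
    (hF : |F| ≤ K) (hF' : |F'| ≤ K) (ha' : 0 ≤ a') (hD : a' ≤ D * c') (hD0 : 0 ≤ D)
    (hc' : 0 ≤ c') :
    |a' * F' ^ 2 - a * F ^ 2| ≤ K ^ 2 * |a' - a| + 2 * K * D * (|b' - b| + K * |c' - c|) := by
  have hK0 : 0 ≤ K := (abs_nonneg _).trans hF
  have hfirst : |(a' - a) * F ^ 2| ≤ K ^ 2 * |a' - a| := by
    rw [abs_mul, abs_pow, mul_comm]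
    gcongr
  have hsub : c' * |F' - F| ≤ |b' - b| + K * |c' - c| :=
    calc c' * |F' - F| = |(b' - b) - (c' - c) * F| := by
          rw [← abs_of_nonneg hc', ← abs_mul, abs_of_nonneg hc', ← hb, ← hb']
          congr 1
          ring
      _ ≤ |b' - b| + |(c' - c) * F| := abs_sub _ _
      _ ≤ |b' - b| + K * |c' - c| := by
          rw [abs_mul, mul_comm |c' - c|]
          gcongr
  have hsecond : |a' * (F' ^ 2 - F ^ 2)| ≤ 2 * K * D * (|b' - b| + K * |c' - c|) := by
    have hadd : |F' + F| ≤ 2 * K := (abs_add_le _ _).trans (by linarith)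
    calc |a' * (F' ^ 2 - F ^ 2)| = a' * (|F' - F| * |F' + F|) := by
          rw [abs_mul, abs_of_nonneg ha', ← abs_mul, mul_comm (F' - F), ← sq_sub_sq]
      _ ≤ (D * c') * (|F' - F| * (2 * K)) := by gcongr
      _ = 2 * K * D * (c' * |F' - F|) := by ring
      _ ≤ 2 * K * D * (|b' - b| + K * |c' - c|) := by gcongr
  calc |a' * F' ^ 2 - a * F ^ 2| = |(a' - a) * F ^ 2 + a' * (F' ^ 2 - F ^ 2)| := by ring_nf
    _ ≤ _ := (abs_add_le _ _).trans (add_le_add hfirst hsecond)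

namespace HMM

variable {H : HMM X Y} {C : ℝ} {f : (ℕ → X) → ℝ} {K : ℝ} {t : ℕ}

lemma integral_m_mul_backwardInt_succ (hm : ∀ x x', H.m x x' ≤ C) (η : ℕ → Measure X)
    [∀ t, IsFiniteMeasure (η t)] (hK : ∀ x, |f x| ≤ K) (hdep : DependsOn f (Set.Iic (t + 1)))
    {c : ℝ≥0∞} {γ' : Measure X} (hγ : γ' = c • η t) (x' : X) :
    (∫ x, H.m x x' ∂γ') * H.backwardInt η (t + 1) f (fun _ => x')
      = ∫ x, H.backwardInt η t (fun z => H.m (z t) x' * f (Function.update z (t + 1) x'))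
          (fun _ => x) ∂γ' := by
  rw [hγ, integral_smul_measure, integral_smul_measure, smul_eq_mul, smul_eq_mul, mul_assoc,
    backwardInt, integral_m_mul_B hm (η t) x' (fun x => abs_backwardInt_le hm η hK t _)]
  congr 2 with x
  rw [backwardInt_apply_mul η (fun u => H.m u x') _ le_rfl]
  congr 1
  refine backwardInt_congr t (fun _ _ => rfl) (by simp) fun z z' hlt hge hge' => hdep fun i hi => ?_
  simp only [Set.mem_Iic] at hi
  rcases lt_trichotomy i t with hit | rfl | hit
  · rw [Function.update_of_ne (by omega)]
    exact hlt i hit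
  · rw [hge i le_rfl, Function.update_self, Function.update_of_ne (by omega), hge' i le_rfl]
  · obtain rfl : i = t + 1 := by omega
    rw [hge _ (by omega), Function.update_self, Function.update_of_ne (by omega)]

lemma abs_m_le (hm : ∀ x x', H.m x x' ≤ C) (x x' : X) : |H.m x x'| ≤ C := by
  rw [abs_of_nonneg (H.m_nonneg _ _)]
  exact hm x x'

lemma measurable_m_mul_update (hf : Measurable f) (x' : X) :
    Measurable fun z : ℕ → X => H.m (z t) x' * f (Function.update z (t + 1) x') :=
  (H.measurable_m.of_uncurry_right.comp (measurable_pi_apply t)).mul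
    (hf.comp measurable_update_left)

lemma abs_m_mul_update_le (hm : ∀ x x', H.m x x' ≤ C) (hK : ∀ x, |f x| ≤ K) (x' : X) (z : ℕ → X) :
    |H.m (z t) x' * f (Function.update z (t + 1) x')| ≤ C * K := by
  rw [abs_mul]
  exact mul_le_mul (abs_m_le hm _ _) (hK _) (abs_nonneg _)
    ((abs_nonneg _).trans (abs_m_le hm x' x'))

lemma dependsOn_m_mul_update (hdep : DependsOn f (Set.Iic (t + 1))) (x' : X) :
    DependsOn (fun z : ℕ → X => H.m (z t) x' * f (Function.update z (t + 1) x')) (Set.Iic t) := by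
  intro z z' h
  simp only
  rw [h t Set.self_mem_Iic, hdep (x := Function.update z (t + 1) x')
    (y := Function.update z' (t + 1) x')]
  intro i hi
  rcases eq_or_ne i (t + 1) with rfl | hne
  · simp
  · rw [Function.update_of_ne hne, Function.update_of_ne hne]
    exact h i (Set.mem_Iic.2 (by have := Set.mem_Iic.1 hi; omega))

end HMM

namespace Proposal

variable {H : HMM X Y} {A : Proposal H} {y : ℕ → Y} {T : ℕ} {C : ℝ} {t : ℕ}

/-- The density of `secondMoment` with respect to `ν(dx')`: since `ϑ_t p_t ω_t = m g_t`, one factor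
`ω_t` of the square cancels against the proposal. -/
noncomputable def momentDensity (A : Proposal H) (y : ℕ → Y) (t : ℕ) (η : Measure X) (Φ : X → ℝ)
    (x' : X) : ℝ :=
  (∫ x, H.m x x' * (H.g y t x' * A.w y t x x') ∂η) * Φ x' ^ 2

lemma measurable_g_mul_w (t : ℕ) :
    Measurable (Function.uncurry fun x x' => H.g y t x' * A.w y t x x') :=
  ((HMM.measurable_g t).comp measurable_snd).mul (measurable_w t)

lemma g_mul_w_nonneg (t : ℕ) (x x' : X) : 0 ≤ H.g y t x' * A.w y t x x' :=
  mul_nonneg (HMM.g_nonneg t _) (w_nonneg _ _ _)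

lemma g_mul_w_le (hC : A.BoundedBy y T C) (h1 : 1 ≤ t) (ht : t ≤ T) (x x' : X) :
    H.g y t x' * A.w y t x x' ≤ C * C :=
  mul_le_mul (hC.g_le t ht _) (hC.w_le t h1 ht _ _) (w_nonneg _ _ _) hC.nonneg

lemma measurable_m_mul_g_mul_w (t : ℕ) :
    Measurable (Function.uncurry fun x x' => H.m x x' * (H.g y t x' * A.w y t x x')) :=
  H.measurable_m.mul (measurable_g_mul_w (A := A) (y := y) t)

lemma m_mul_g_mul_w_nonneg (t : ℕ) (x x' : X) :
    0 ≤ H.m x x' * (H.g y t x' * A.w y t x x') :=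
  mul_nonneg (H.m_nonneg _ _) (g_mul_w_nonneg _ _ _)

lemma abs_m_mul_g_mul_w_le (hC : A.BoundedBy y T C) (h1 : 1 ≤ t) (ht : t ≤ T) (x x' : X) :
    |H.m x x' * (H.g y t x' * A.w y t x x')| ≤ C * (C * C) := by
  rw [abs_of_nonneg (m_mul_g_mul_w_nonneg t x x')]
  exact mul_le_mul (hC.m_le _ _) (g_mul_w_le hC h1 ht _ _) (g_mul_w_nonneg _ _ _) hC.nonneg

lemma integral_m_mul_g_mul_w_nonneg (η : Measure X) (x' : X) :
    0 ≤ ∫ x, H.m x x' * (H.g y t x' * A.w y t x x') ∂η :=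
  integral_nonneg fun _ => m_mul_g_mul_w_nonneg t _ _

lemma measurable_integral_m_mul_g_mul_w (t : ℕ) (η : Measure X) [SFinite η] :
    Measurable fun x' => ∫ x, H.m x x' * (H.g y t x' * A.w y t x x') ∂η :=
  (StronglyMeasurable.integral_prod_left (μ := η)
    (f := fun x x' => H.m x x' * (H.g y t x' * A.w y t x x'))
    (measurable_m_mul_g_mul_w t).stronglyMeasurable).measurable

section FiniteMeasure

variable (η : Measure X) [IsFiniteMeasure η] (hC : A.BoundedBy y T C) (h1 : 1 ≤ t) (ht : t ≤ T)
  {Φ : X → ℝ} (hΦ : Measurable Φ) {K : ℝ} (hK : ∀ x, |Φ x| ≤ K)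

include hC h1 ht

lemma integral_m_mul_g_mul_w_le (x' : X) :
    ∫ x, H.m x x' * (H.g y t x' * A.w y t x x') ∂η ≤ C * C * ∫ x, H.m x x' ∂η := by
  rw [← integral_const_mul]
  refine integral_mono_of_nonneg (ae_of_all _ fun x => m_mul_g_mul_w_nonneg _ _ _)
    ((HMM.integrable_m_left hC.m_le η x').const_mul _) (ae_of_all _ fun x => ?_)
  simp only
  rw [mul_comm]
  exact mul_le_mul_of_nonneg_right (g_mul_w_le hC h1 ht _ _) (H.m_nonneg _ _)

include hK

lemma abs_momentDensity_le (x' : X) :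
    |A.momentDensity y t η Φ x'| ≤ C * C * K ^ 2 * ∫ x, H.m x x' ∂η := by
  rw [momentDensity, abs_mul, abs_of_nonneg (integral_m_mul_g_mul_w_nonneg _ _), abs_pow]
  have hle := integral_m_mul_g_mul_w_le η hC h1 ht x'
  have hsq := pow_le_pow_left₀ (abs_nonneg _) (hK x') 2
  exact (mul_le_mul hle hsq (by positivity)
    ((integral_m_mul_g_mul_w_nonneg _ _).trans hle)).trans_eq (by ring)

include hΦ

omit hC h1 ht hK in
lemma measurable_momentDensity : Measurable (A.momentDensity y t η Φ) :=
  (measurable_integral_m_mul_g_mul_w t η).mul (hΦ.pow_const 2)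

lemma integrable_momentDensity : Integrable (A.momentDensity y t η Φ) H.ν :=
  ((HMM.integrable_m_prod η).integral_prod_right.const_mul _).mono'
    (measurable_momentDensity η hΦ).aestronglyMeasurable
    (ae_of_all _ (abs_momentDensity_le η hC h1 ht hK))

lemma secondMoment_eq_integral_momentDensity :
    A.secondMoment y t η Φ = ∫ x', A.momentDensity y t η Φ x' ∂H.ν := by
  have hweight (x : X) : A.ϑ t x * ∫ x', A.w y t x x' ^ 2 * Φ x' ^ 2 ∂(A.P t x)
      = ∫ x', H.g y t x' * A.w y t x x' * Φ x' ^ 2 ∂(H.M x) := by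
    have hcancel := ϑ_mul_integral_P_w_mul hC h1 ht x fun x' => A.w y t x x' * Φ x' ^ 2
    simpa only [← mul_assoc, ← sq] using hcancel
  have hmeas : Measurable fun p : X × X => H.g y t p.2 * A.w y t p.1 p.2 * Φ p.2 ^ 2 :=
    Measurable.mul (measurable_g_mul_w t) ((hΦ.pow_const 2).comp measurable_snd)
  have hle (x x' : X) : |H.g y t x' * A.w y t x x' * Φ x' ^ 2| ≤ C * C * K ^ 2 := by
    rw [abs_mul, abs_of_nonneg (g_mul_w_nonneg t x x'), abs_pow]
    exact mul_le_mul (g_mul_w_le hC h1 ht x x') (pow_le_pow_left₀ (abs_nonneg _) (hK x') 2)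
      (by positivity) (mul_self_nonneg C)
  simp_rw [secondMoment, hweight]
  rw [H.integral_integral_M η (f := fun x x' => H.g y t x' * A.w y t x x' * Φ x' ^ 2) hmeas hle]
  simp only [momentDensity, ← mul_assoc, integral_mul_const]

end FiniteMeasure

lemma IsParticleFilter.measurable_momentDensity {Ω : Type*} [MeasurableSpace Ω] {μ : Measure Ω}
    {N : ℕ} {ξ : ℕ → Fin N → Ω → X} {I : ℕ → Fin N → Ω → Fin N}
    (hF : A.IsParticleFilter y ξ I μ T) (t : ℕ) {f : (ℕ → X) → ℝ} (hf : Measurable f) :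
    Measurable (Function.uncurry fun ω => A.momentDensity y (t + 1) (A.γHat y ξ I t ω) fun x =>
      H.backwardInt (fun s => A.filterHat y ξ I s ω) (t + 1) f (fun _ => x)) := by
  refine Measurable.mul ?_ ((hF.measurable_backwardInt (t + 1) hf).pow_const 2)
  refine Proposal.measurable_integral_γHat (t := t) (fun s _ i => hF.measurable_ξ s i)
    (fun s _ i => hF.measurable_weight s i) le_rfl
    (f := fun _ x' x => H.m x x' * (H.g y (t + 1) x' * A.w y (t + 1) x x')) ?_
  exact (measurable_m_mul_g_mul_w (A := A) (y := y) (t + 1)).comp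
    (measurable_snd.prodMk (measurable_snd.comp measurable_fst))

section Limit

variable {Ω : Type*} [MeasurableSpace Ω] {μ : Measure Ω} [IsProbabilityMeasure μ]
  {ξ : (N : ℕ) → ℕ → Fin N → Ω → X} {I : (N : ℕ) → ℕ → Fin N → Ω → Fin N}
  (hF : ∀ N, A.IsParticleFilter y (ξ N) (I N) μ T) (hC : A.BoundedBy y T C)

include hF hC

lemma tendsto_lintegral_enorm_γHat_sub (ht : t ≤ T) {f : X → ℝ} (hf : Measurable f) {K : ℝ}
    (hK : ∀ x, |f x| ≤ K) :
    Tendsto (fun N => ∫⁻ ω, ‖∫ x, f x ∂(A.γHat y (ξ N) (I N) t ω)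
      - ∫ x, f x ∂(H.γ y t)‖ₑ ∂μ) atTop (𝓝 0) :=
  tendsto_lintegral_enorm_sub_of_integral_sq_le
    (fun N => MemLp.of_bound ((hF N).measurable_integral_γHat t (f := fun _ => f)
      (hf.comp measurable_snd)).aestronglyMeasurable _
      (ae_of_all _ fun ω => abs_integral_γHat_le hC ht ω hK))
    fun N hN => (hF N).integral_integral_γHat_sub_sq_le hC hN ht hf hK

variable {f : (ℕ → X) → ℝ} (hf : Measurable f) {K : ℝ} (hK : ∀ x, |f x| ≤ K)

include hf hK

lemma tendsto_lintegral_enorm_pathHat_forwardInt_sub {k : ℕ} (ht : t + k ≤ T)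
    (hdep : DependsOn f (Set.Iic (t + k))) :
    Tendsto (fun N => ∫⁻ ω, ‖A.pathHat y (ξ N) (I N) t (H.forwardInt y k t f) ω
      - ∫ x, H.forwardInt y (t + k) 0 f (fun _ => x) ∂(H.γ y 0)‖ₑ ∂μ) atTop (𝓝 0) :=
  tendsto_lintegral_enorm_sub_of_integral_sq_le
    (fun N => MemLp.of_bound
      ((hF N).measurable_pathHat t (HMM.measurable_forwardInt hf k t)).aestronglyMeasurable _
      (ae_of_all _ (abs_pathHat_le hC (by omega) (HMM.abs_forwardInt_le hC.g_le hK k ht))))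
    fun N hN => (hF N).integral_pathHat_sub_sq_le hC hN hf hK ht hdep

lemma tendsto_lintegral_enorm_pathHat_sub (ht : t ≤ T) (hdep : DependsOn f (Set.Iic t)) :
    Tendsto (fun N => ∫⁻ ω, ‖A.pathHat y (ξ N) (I N) t f ω
      - ∫ x, H.backwardInt (H.φ y) t f (fun _ => x) ∂(H.γ y t)‖ₑ ∂μ) atTop (𝓝 0) := by
  have hlim := tendsto_lintegral_enorm_pathHat_forwardInt_sub hF hC hf hK (k := 0) ht hdep
  rwa [← HMM.integral_γ_backwardInt hC.g_le hC.g_pos hC.m_le hf hK (k := 0) hdep ht] at hlim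

variable (ht : t + 1 ≤ T)

include ht

lemma tendsto_lintegral_enorm_momentDensity_sub (hdep : DependsOn f (Set.Iic (t + 1))) (x' : X) :
    Tendsto (fun N => ∫⁻ ω, ‖A.momentDensity y (t + 1) (A.γHat y (ξ N) (I N) t ω)
          (fun x => H.backwardInt (fun s => A.filterHat y (ξ N) (I N) s ω) (t + 1) f fun _ => x) x'
        - A.momentDensity y (t + 1) (H.γ y t)
          (fun x => H.backwardInt (H.φ y) (t + 1) f fun _ => x) x'‖ₑ ∂μ) atTop (𝓝 0) := by
  have hmeas_m : Measurable fun x => H.m x x' := H.measurable_m.of_uncurry_right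
  have hmeas_r : Measurable fun x => H.m x x' * (H.g y (t + 1) x' * A.w y (t + 1) x x') :=
    (measurable_m_mul_g_mul_w (t + 1)).of_uncurry_right
  have hmeas_γHat (N : ℕ) {r : X → ℝ} (hr : Measurable r) :
      Measurable fun ω => ∫ x, r x ∂(A.γHat y (ξ N) (I N) t ω) - ∫ x, r x ∂(H.γ y t) :=
    ((hF N).measurable_integral_γHat t (f := fun _ => r) (hr.comp measurable_snd)).sub_const _
  have hmeas_f := HMM.measurable_m_mul_update (H := H) (t := t) hf x'
  refine tendsto_lintegral_enorm_of_abs_le (a := K ^ 2) (b := 2 * K * (C * C))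
    (c := 2 * K * (C * C) * K) (fun N => hmeas_γHat N hmeas_r)
    (fun N => ((hF N).measurable_pathHat t hmeas_f).sub_const _) (fun N ω => ?_)
    (tendsto_lintegral_enorm_γHat_sub hF hC (t := t) (by omega) hmeas_r
      fun x => abs_m_mul_g_mul_w_le hC (by omega) ht x x')
    (tendsto_lintegral_enorm_pathHat_sub hF hC hmeas_f (HMM.abs_m_mul_update_le hC.m_le hK x')
      (by omega) (HMM.dependsOn_m_mul_update hdep x'))
    (tendsto_lintegral_enorm_γHat_sub hF hC (t := t) (by omega) hmeas_m
      fun x => HMM.abs_m_le hC.m_le x x')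
  refine (abs_mul_sq_sub_le
    (HMM.integral_m_mul_backwardInt_succ hC.m_le (H.φ y) hK hdep
      (HMM.γ_eq_smul_φ hC.g_le hC.g_pos (by omega)) x')
    (HMM.integral_m_mul_backwardInt_succ hC.m_le (fun s => A.filterHat y (ξ N) (I N) s ω) hK hdep
      (γHat_eq_smul_filterHat t ω) x')
    (HMM.abs_backwardInt_le hC.m_le _ hK _ _) (HMM.abs_backwardInt_le hC.m_le _ hK _ _)
    (integral_m_mul_g_mul_w_nonneg _ _) (integral_m_mul_g_mul_w_le _ hC (by omega) ht x')
    (mul_self_nonneg C) (integral_nonneg fun x => H.m_nonneg _ _)).trans_eq ?_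
  rw [mul_add, ← mul_assoc _ K, ← add_assoc]
  rfl

omit hf in
lemma lintegral_enorm_momentDensity_sub_le {N : ℕ} (hN : N ≠ 0) (x' : X) :
    ∫⁻ ω, ‖A.momentDensity y (t + 1) (A.γHat y (ξ N) (I N) t ω)
          (fun x => H.backwardInt (fun s => A.filterHat y (ξ N) (I N) s ω) (t + 1) f fun _ => x) x'
        - A.momentDensity y (t + 1) (H.γ y t)
          (fun x => H.backwardInt (H.φ y) (t + 1) f fun _ => x) x'‖ₑ ∂μ
      ≤ ENNReal.ofReal (2 * (C * C * K ^ 2) * ∫ x, H.m x x' ∂(H.γ y t)) := by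
  have := HMM.isFiniteMeasure_γ hC.g_le (t := t) (by omega)
  have hmeas : Measurable fun x => H.m x x' := H.measurable_m.of_uncurry_right
  have hint : Integrable (fun ω => ∫ x, H.m x x' ∂(A.γHat y (ξ N) (I N) t ω)) μ :=
    integrable_of_abs_le ((hF N).measurable_integral_γHat t (f := fun _ x => H.m x x')
      (hmeas.comp measurable_snd))
      fun ω => abs_integral_γHat_le hC (by omega) ω fun x => HMM.abs_m_le hC.m_le x x'
  set D := C * C * K ^ 2
  have hD : 0 ≤ D := mul_nonneg (mul_self_nonneg C) (sq_nonneg K)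
  have hnonneg (η : Measure X) : 0 ≤ D * ∫ x, H.m x x' ∂η :=
    mul_nonneg hD (integral_nonneg fun x => H.m_nonneg _ _)
  have hbound (ω : Ω) :
      ‖A.momentDensity y (t + 1) (A.γHat y (ξ N) (I N) t ω)
          (fun x => H.backwardInt (fun s => A.filterHat y (ξ N) (I N) s ω) (t + 1) f fun _ => x) x'
        - A.momentDensity y (t + 1) (H.γ y t)
          (fun x => H.backwardInt (H.φ y) (t + 1) f fun _ => x) x'‖ₑ
        ≤ ENNReal.ofReal (D * ∫ x, H.m x x' ∂(A.γHat y (ξ N) (I N) t ω)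
          + D * ∫ x, H.m x x' ∂(H.γ y t)) := by
    rw [Real.enorm_eq_ofReal_abs]
    refine ENNReal.ofReal_le_ofReal ((abs_sub _ _).trans (add_le_add ?_ ?_)) <;>
      exact abs_momentDensity_le _ hC (by omega) ht
        (fun x => HMM.abs_backwardInt_le hC.m_le _ hK _ _) x'
  refine (lintegral_mono hbound).trans_eq ?_
  refine (ofReal_integral_eq_lintegral_ofReal ((hint.const_mul D).add (integrable_const _))
    (ae_of_all _ fun ω => add_nonneg (hnonneg _) (hnonneg _))).symm.trans ?_
  rw [integral_add' (hint.const_mul D) (integrable_const _), integral_const_mul,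
    (hF N).integral_integral_γHat hC hN (by omega) hmeas fun x => HMM.abs_m_le hC.m_le x x',
    integral_const, probReal_univ, one_smul, ← two_mul, ← mul_assoc]

omit [IsProbabilityMeasure μ] hK in
lemma measurable_enorm_momentDensity_sub (N : ℕ) :
    Measurable fun p : Ω × X => ‖A.momentDensity y (t + 1) (A.γHat y (ξ N) (I N) t p.1)
          (fun x => H.backwardInt (fun s => A.filterHat y (ξ N) (I N) s p.1) (t + 1) f fun _ => x)
          p.2
        - A.momentDensity y (t + 1) (H.γ y t)
          (fun x => H.backwardInt (H.φ y) (t + 1) f fun _ => x) p.2‖ₑ := by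
  have := HMM.isFiniteMeasure_γ hC.g_le (t := t) (by omega)
  exact (((hF N).measurable_momentDensity t hf).sub ((measurable_momentDensity (H.γ y t)
    ((HMM.measurable_backwardInt _ hf (t + 1)).comp
      (measurable_pi_lambda _ fun _ => measurable_id))).comp measurable_snd)).enorm

variable (hdep : DependsOn f (Set.Iic (t + 1)))

include hdep

lemma tendsto_lintegral_lintegral_enorm_momentDensity_sub :
    Tendsto (fun N => ∫⁻ x', ∫⁻ ω, ‖A.momentDensity y (t + 1) (A.γHat y (ξ N) (I N) t ω)
          (fun x => H.backwardInt (fun s => A.filterHat y (ξ N) (I N) s ω) (t + 1) f fun _ => x) x'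
        - A.momentDensity y (t + 1) (H.γ y t)
          (fun x => H.backwardInt (H.φ y) (t + 1) f fun _ => x) x'‖ₑ ∂μ ∂H.ν) atTop (𝓝 0) := by
  have := HMM.isFiniteMeasure_γ hC.g_le (t := t) (by omega)
  rw [← lintegral_zero (μ := H.ν)]
  refine tendsto_lintegral_filter_of_dominated_convergence
    (fun x' => ENNReal.ofReal (2 * (C * C * K ^ 2) * ∫ x, H.m x x' ∂(H.γ y t)))
    (Eventually.of_forall fun N =>
      (measurable_enorm_momentDensity_sub hF hC hf ht N).lintegral_prod_left') ?_
    ((HMM.integrable_m_prod (H.γ y t)).integral_prod_right.const_mul _).lintegral_lt_top.ne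
    (ae_of_all _ (tendsto_lintegral_enorm_momentDensity_sub hF hC hf hK ht hdep))
  filter_upwards [eventually_ne_atTop 0] with N hN
  exact ae_of_all _ (lintegral_enorm_momentDensity_sub_le hF hC hK ht hN)

lemma tendsto_lintegral_enorm_secondMoment_sub :
    Tendsto (fun N => ∫⁻ ω, ‖A.secondMoment y (t + 1) (A.γHat y (ξ N) (I N) t ω)
          (fun x => H.backwardInt (fun s => A.filterHat y (ξ N) (I N) s ω) (t + 1) f fun _ => x)
        - A.secondMoment y (t + 1) (H.γ y t)
          (fun x => H.backwardInt (H.φ y) (t + 1) f fun _ => x)‖ₑ ∂μ) atTop (𝓝 0) := by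
  have := HMM.isFiniteMeasure_γ hC.g_le (t := t) (by omega)
  refine tendsto_of_tendsto_of_tendsto_of_le_of_le tendsto_const_nhds
    (tendsto_lintegral_lintegral_enorm_momentDensity_sub hF hC hf hK ht hdep)
    (fun _ => zero_le) fun N => ?_
  simp only
  rw [← lintegral_lintegral_swap
    (measurable_enorm_momentDensity_sub hF hC hf ht N).aemeasurable]
  refine lintegral_mono fun ω => ?_
  have hmeas (η : ℕ → Measure X) [∀ s, IsFiniteMeasure (η s)] :
      Measurable fun x => H.backwardInt η (t + 1) f fun _ => x :=
    (HMM.measurable_backwardInt η hf (t + 1)).comp (measurable_pi_lambda _ fun _ => measurable_id)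
  have hle (η : ℕ → Measure X) [∀ s, IsFiniteMeasure (η s)] (x : X) :
      |H.backwardInt η (t + 1) f fun _ => x| ≤ K := HMM.abs_backwardInt_le hC.m_le η hK _ _
  rw [secondMoment_eq_integral_momentDensity _ hC (by omega) ht (hmeas _) (hle _),
    secondMoment_eq_integral_momentDensity _ hC (by omega) ht (hmeas _) (hle _),
    ← integral_sub (integrable_momentDensity _ hC (by omega) ht (hmeas _) (hle _))
      (integrable_momentDensity _ hC (by omega) ht (hmeas _) (hle _))]
  exact enorm_integral_le_lintegral_enorm _

end Limit

end Proposal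

end FFBS

namespace FFBS

lemma abs_exp_neg_sub_exp_neg_le {a b : ℝ} (ha : 0 ≤ a) (hb : 0 ≤ b) :
    |Real.exp (-a) - Real.exp (-b)| ≤ |a - b| := by
  wlog hab : a ≤ b generalizing a b
  · rw [abs_sub_comm, abs_sub_comm a]
    exact this hb ha (le_of_not_ge hab)
  rw [abs_of_nonneg (sub_nonneg.2 (Real.exp_le_exp.2 (neg_le_neg hab))), abs_sub_comm,
    abs_of_nonneg (sub_nonneg.2 hab)]
  calc Real.exp (-a) - Real.exp (-b) = Real.exp (-a) * (1 - Real.exp (-(b - a))) := by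
        rw [mul_sub, ← Real.exp_add, mul_one]
        ring_nf
    _ ≤ 1 * (b - a) :=
        mul_le_mul (Real.exp_le_one_iff.2 (neg_nonpos.2 ha))
          (by linarith [Real.add_one_le_exp (-(b - a))])
          (sub_nonneg.2 (Real.exp_le_one_iff.2 (by linarith))) zero_le_one
    _ = b - a := one_mul _

section Limit

variable {Ω : Type*} [MeasurableSpace Ω] {μ : Measure Ω} [IsProbabilityMeasure μ]

lemma enorm_integral_mul_exp_neg_sub_le {Z : Ω → ℂ} (hZ : Measurable Z) (hZ1 : ∀ ω, ‖Z ω‖ ≤ 1)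
    {V : Ω → ℝ} (hV : Measurable V) (hV0 : ∀ ω, 0 ≤ V ω) {v : ℝ} (hv : 0 ≤ v) :
    ‖∫ ω, Z ω * Real.exp (-V ω) ∂μ - (∫ ω, Z ω ∂μ) * Real.exp (-v)‖ₑ
      ≤ ∫⁻ ω, ‖V ω - v‖ₑ ∂μ := by
  have hint : Integrable Z μ :=
    Integrable.of_bound hZ.aestronglyMeasurable 1 (ae_of_all _ hZ1)
  have hint' : Integrable (fun ω => Z ω * Real.exp (-V ω)) μ := by
    refine Integrable.of_bound (C := 1) (by fun_prop) (ae_of_all _ fun ω => ?_)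
    rw [norm_mul, Complex.norm_real, Real.norm_eq_abs, Real.abs_exp]
    exact mul_le_one₀ (hZ1 ω) (Real.exp_pos _).le (Real.exp_le_one_iff.2 (neg_nonpos.2 (hV0 ω)))
  rw [← integral_mul_const, ← integral_sub hint' (hint.mul_const _)]
  refine (enorm_integral_le_lintegral_enorm _).trans (lintegral_mono fun ω => ?_)
  rw [enorm_le_iff_norm_le, ← mul_sub, norm_mul, ← Complex.ofReal_sub, Complex.norm_real,
    Real.norm_eq_abs, Real.norm_eq_abs]
  exact (mul_le_of_le_one_left (abs_nonneg _) (hZ1 ω)).trans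
    (abs_exp_neg_sub_exp_neg_le (hV0 ω) hv)

lemma IsCondIIDAverage.enorm_integral_cexp_sub_mul_le {E : Type*} [MeasurableSpace E] {V : Ω → E}
    {N : ℕ} {K : ℝ} {Z a q : Ω → ℝ} (h : IsCondIIDAverage μ V N K Z a q) (hN : N ≠ 0) (u : ℝ)
    {v : ℝ} (hv : 0 ≤ v) :
    ‖∫ ω, Complex.exp (Complex.I * (u * (√N * Z ω) : ℝ)) ∂μ
        - (∫ ω, Complex.exp (Complex.I * (u * (√N * a ω) : ℝ)) ∂μ)
          * Real.exp (-(u ^ 2 * v / 2))‖ₑ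
      ≤ ENNReal.ofReal (cltConst u K / √N)
        + ‖u ^ 2 / 2‖ₑ * ∫⁻ ω, ‖q ω - a ω ^ 2 - v‖ₑ ∂μ := by
  have ha := h.measurable_mean
  have hq := h.measurable_secondMoment
  rw [← sub_add_sub_cancel _ (∫ ω, Complex.exp (Complex.I * (u * (√N * a ω) : ℝ))
    * Real.exp (-(u ^ 2 * (q ω - a ω ^ 2) / 2)) ∂μ)]
  refine (enorm_add_le _ _).trans (add_le_add ?_ ?_)
  · rw [← ofReal_norm]
    exact ENNReal.ofReal_le_ofReal (h.norm_integral_cexp_sub_le hN u)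
  · rw [← lintegral_const_mul' _ _ enorm_ne_top]
    refine (enorm_integral_mul_exp_neg_sub_le (by fun_prop)
      (fun ω => (Complex.norm_exp_I_mul_ofReal _).le) (by fun_prop) (fun ω => ?_)
      (by positivity)).trans_eq ?_
    · have := sub_nonneg.2 (h.sq_mean_le_secondMoment ω)
      positivity
    · congr 1 with ω
      rw [← enorm_mul]
      congr 1
      ring

lemma IsCondIIDAverage.tendsto_integral_cexp {E : ℕ → Type*} [∀ N, MeasurableSpace (E N)]
    {V : (N : ℕ) → Ω → E N} {K : ℝ} {Z a q : ℕ → Ω → ℝ}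
    (h : ∀ N ≠ 0, IsCondIIDAverage μ (V N) N K (Z N) (a N) (q N)) {u : ℝ} {c : ℂ}
    (ha : Tendsto (fun N : ℕ => ∫ ω, Complex.exp (Complex.I * (u * (√N * a N ω) : ℝ)) ∂μ)
      atTop (𝓝 c)) {v : ℝ} (hv : 0 ≤ v)
    (hq : Tendsto (fun N => ∫⁻ ω, ‖q N ω - a N ω ^ 2 - v‖ₑ ∂μ) atTop (𝓝 0)) :
    Tendsto (fun N : ℕ => ∫ ω, Complex.exp (Complex.I * (u * (√N * Z N ω) : ℝ)) ∂μ) atTop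
      (𝓝 (c * Real.exp (-(u ^ 2 * v / 2)))) := by
  have hrate : Tendsto (fun N : ℕ => ENNReal.ofReal (cltConst u K / √N)) atTop (𝓝 0) := by
    rw [← ENNReal.ofReal_zero]
    exact ENNReal.tendsto_ofReal (tendsto_const_nhds.div_atTop
      (Real.tendsto_sqrt_atTop.comp tendsto_natCast_atTop_atTop))
  have hbound := hrate.add (ENNReal.Tendsto.const_mul hq (Or.inr (enorm_ne_top (x := u ^ 2 / 2))))
  rw [mul_zero, add_zero] at hbound
  have hdiff : Tendsto (fun N : ℕ => ∫ ω, Complex.exp (Complex.I * (u * (√N * Z N ω) : ℝ)) ∂μ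
      - (∫ ω, Complex.exp (Complex.I * (u * (√N * a N ω) : ℝ)) ∂μ)
        * Real.exp (-(u ^ 2 * v / 2))) atTop (𝓝 0) := by
    rw [tendsto_zero_iff_enorm_tendsto_zero]
    refine tendsto_of_tendsto_of_tendsto_of_le_of_le' tendsto_const_nhds hbound
      (Eventually.of_forall fun _ => zero_le) ?_
    filter_upwards [eventually_ne_atTop 0] with N hN
    exact (h N hN).enorm_integral_cexp_sub_mul_le hN u hv
  rw [← zero_add (c * _)]
  exact (hdiff.add (ha.mul_const _)).congr fun _ => sub_add_cancel _ _

/-- The denominators `G N` may vanish, so Slutsky's theorem is applied with the continuous function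
`(s, g) ↦ γ s / max g (γ / 2)` instead of the quotient. -/
lemma tendstoInDistribution_of_ae_eq_mul {v : ℝ≥0} {S R G : ℕ → Ω → ℝ} {γ : ℝ} (hγ : 0 < γ)
    (hS : TendstoInDistribution S atTop (id : ℝ → ℝ) (fun _ => μ) (gaussianReal 0 v))
    (hR : ∀ N, Measurable (R N)) (hG : ∀ N, Measurable (G N))
    (hGγ : TendstoInMeasure μ G atTop (fun _ => γ))
    (h : ∀ N, (fun ω => γ * S N ω) =ᵐ[μ] fun ω => G N ω * R N ω) :
    TendstoInDistribution R atTop (id : ℝ → ℝ) (fun _ => μ) (gaussianReal 0 v) := by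
  have hpos (b : ℝ) : 0 < max b (γ / 2) := lt_max_of_lt_right (by positivity)
  have hcont : Continuous fun p : ℝ × ℝ => γ * p.1 * (max p.2 (γ / 2))⁻¹ :=
    (by fun_prop : Continuous fun p : ℝ × ℝ => γ * p.1).mul
      (Continuous.inv₀ (by fun_prop) fun p => (hpos p.2).ne')
  have hquot := hS.continuous_comp_prodMk_of_tendstoInMeasure_const hcont hGγ
    fun N => (hG N).aemeasurable
  have hid : (fun x : ℝ => γ * id x * (max γ (γ / 2))⁻¹) = id := by
    funext x
    rw [max_eq_left (by linarith), mul_right_comm, mul_inv_cancel₀ hγ.ne', one_mul]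
  simp only [hid] at hquot
  refine tendstoInDistribution_of_tendstoInMeasure_sub R id hquot ?_ fun N => (hR N).aemeasurable
  rw [tendstoInMeasure_iff_norm] at hGγ ⊢
  intro ε hε
  refine tendsto_of_tendsto_of_tendsto_of_le_of_le tendsto_const_nhds
    (hGγ (γ / 2) (by positivity)) (fun _ => zero_le) fun N => measure_mono_ae ?_
  filter_upwards [h N] with ω hω hle
  by_contra hlt
  have hclose : |G N ω - γ| < γ / 2 := not_le.1 hlt
  have hG2 : γ / 2 < G N ω := by linarith [(abs_lt.1 hclose).1]
  have hle' : ε ≤ ‖R N ω - γ * S N ω * (max (G N ω) (γ / 2))⁻¹ - 0‖ := hle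
  rw [hω, max_eq_left hG2.le, mul_right_comm, mul_inv_cancel₀ (by linarith), one_mul, sub_self,
    sub_zero, norm_zero] at hle'
  linarith

end Limit

namespace Proposal

variable {X Y : Type*} [MeasurableSpace X] [MeasurableSpace Y] {H : HMM X Y} {A : Proposal H}
  {y : ℕ → Y} {T : ℕ} {C : ℝ}

/-- The asymptotic variance of `√N` times the unnormalised estimator
`pathHat t (forwardInt (T - t) t f)`, for `f` with `∫ forwardInt T 0 f ∂γ₀ = 0`. It collects the
conditional variances of the sampling steps `0, …, t`. -/
noncomputable def pathVar (A : Proposal H) (y : ℕ → Y) (T : ℕ) (f : (ℕ → X) → ℝ) (t : ℕ) : ℝ :=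
  (∫ x, A.w₀ y x ^ 2 * H.forwardInt y T 0 f (fun _ => x) ^ 2 ∂A.ρ₀)
    + ∑ s ∈ Finset.range t, (∫ x, A.ϑ (s + 1) x ∂(H.γ y s))
      * A.secondMoment y (s + 1) (H.γ y s) fun x =>
        H.backwardInt (H.φ y) (s + 1) (H.forwardInt y (T - (s + 1)) (s + 1) f) (fun _ => x)

lemma secondMoment_nonneg (t : ℕ) (η : Measure X) (Φ : X → ℝ) : 0 ≤ A.secondMoment y t η Φ :=
  integral_nonneg fun x => mul_nonneg (A.ϑ_pos t x).le (integral_nonneg fun _ => by positivity)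

lemma zHat_succ {Ω : Type*} {N : ℕ} {ξ : ℕ → Fin N → Ω → X} {I : ℕ → Fin N → Ω → Fin N} (t : ℕ)
    (ω : Ω) : A.zHat y ξ I (t + 1) ω = ∫ x, A.ϑ (t + 1) x ∂(A.γHat y ξ I t ω) := by
  rw [integral_γHat t ω (A.measurable_ϑ _), zHat, mul_assoc]

section CentralLimit

variable {Ω : Type*} [MeasurableSpace Ω] {μ : Measure Ω} [IsProbabilityMeasure μ]
  {ξ : (N : ℕ) → ℕ → Fin N → Ω → X} {I : (N : ℕ) → ℕ → Fin N → Ω → Fin N}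
  (hF : ∀ N, A.IsParticleFilter y (ξ N) (I N) μ T) (hC : A.BoundedBy y T C)
  {f : (ℕ → X) → ℝ} (hf : Measurable f) {K : ℝ} (hK : ∀ x, |f x| ≤ K)

include hF hC hf hK

lemma tendsto_lintegral_enorm_condVariance_sub {k t : ℕ} (ht : t + (k + 1) ≤ T)
    (hdep : DependsOn f (Set.Iic (t + (k + 1))))
    (h0 : ∫ x, H.forwardInt y (t + (k + 1)) 0 f (fun _ => x) ∂(H.γ y 0) = 0) :
    Tendsto (fun N => ∫⁻ ω, ‖A.zHat y (ξ N) (I N) (t + 1) ω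
          * A.secondMoment y (t + 1) (A.γHat y (ξ N) (I N) t ω) (fun x =>
            H.backwardInt (fun s => A.filterHat y (ξ N) (I N) s ω) (t + 1)
              (H.forwardInt y k (t + 1) f) fun _ => x)
          - A.pathHat y (ξ N) (I N) t (H.forwardInt y (k + 1) t f) ω ^ 2
        - (∫ x, A.ϑ (t + 1) x ∂(H.γ y t)) * A.secondMoment y (t + 1) (H.γ y t) (fun x =>
            H.backwardInt (H.φ y) (t + 1) (H.forwardInt y k (t + 1) f) fun _ => x)‖ₑ ∂μ)
      atTop (𝓝 0) := by
  have hmeas := HMM.measurable_forwardInt (H := H) (y := y) hf (k + 1) t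
  have hbound := HMM.abs_forwardInt_le hC.g_le hK (k + 1) (t := t) (by omega)
  have hdepF : DependsOn (H.forwardInt y k (t + 1) f) (Set.Iic (t + 1)) := by
    have := HMM.dependsOn_forwardInt (H := H) (y := y) (f := f) (s := 0) (k := k) (t := t + 1)
      zero_le
    simp only [← bot_eq_zero, Set.Icc_bot] at this
    exact this (by rwa [add_assoc, add_comm 1])
  have hϑ (x : X) : |A.ϑ (t + 1) x| ≤ C :=
    (abs_of_pos (A.ϑ_pos _ x)).trans_le (hC.ϑ_le _ (by omega) (by omega) x)
  have hpath := tendsto_lintegral_enorm_pathHat_forwardInt_sub hF hC hf hK ht hdep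
  simp only [h0, sub_zero] at hpath
  set q := A.secondMoment y (t + 1) (H.γ y t) fun x =>
    H.backwardInt (H.φ y) (t + 1) (H.forwardInt y k (t + 1) f) fun _ => x
  refine tendsto_lintegral_enorm_of_abs_le (a := |q|) (b := (C * C) ^ t * C * (C ^ (k + 1) * K))
    (c := (C * C) ^ (t + 1)) (fun N => ((hF N).measurable_integral_γHat t
      (f := fun _ => A.ϑ (t + 1)) ((A.measurable_ϑ _).comp measurable_snd)).sub_const _)
    (fun N => (hF N).measurable_pathHat t hmeas) (fun N ω => ?_)
    (tendsto_lintegral_enorm_γHat_sub hF hC (by omega) (A.measurable_ϑ _) hϑ) hpath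
    (tendsto_lintegral_enorm_secondMoment_sub hF hC (HMM.measurable_forwardInt hf k (t + 1))
      (HMM.abs_forwardInt_le hC.g_le hK k (by omega)) (by omega) hdepF)
  have hz := zHat_le (ξ := ξ N) (I := I N) hC (t := t + 1) (by omega) ω
  have hz0 := zHat_nonneg (A := A) (y := y) (ξ := ξ N) (I := I N) (t + 1) ω
  have hp := abs_pathHat_le (ξ := ξ N) (I := I N) hC (t := t) (by omega) hbound ω
  rw [← zHat_succ]
  set Q := A.secondMoment y (t + 1) (A.γHat y (ξ N) (I N) t ω) fun x =>
    H.backwardInt (fun s => A.filterHat y (ξ N) (I N) s ω) (t + 1)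
      (H.forwardInt y k (t + 1) f) fun _ => x
  set z := A.zHat y (ξ N) (I N) (t + 1) ω
  set a := ∫ x, A.ϑ (t + 1) x ∂(H.γ y t)
  set p := A.pathHat y (ξ N) (I N) t (H.forwardInt y (k + 1) t f) ω
  calc |z * Q - p ^ 2 - a * q| = |(q * (z - a) - p * p) + z * (Q - q)| := by congr 1; ring
    _ ≤ |q| * |z - a| + |p| * |p| + |z| * |Q - q| := by
        refine (abs_add_le _ _).trans (add_le_add ((abs_sub _ _).trans ?_) (abs_mul _ _).le)
        rw [abs_mul, abs_mul]
    _ ≤ |q| * |z - a| + (C * C) ^ t * C * (C ^ (k + 1) * K) * |p|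
          + (C * C) ^ (t + 1) * |Q - q| := by
        rw [abs_of_nonneg hz0]
        gcongr

lemma tendsto_charFun_pathHat (hdep : DependsOn f (Set.Iic T))
    (h0 : ∫ x, H.forwardInt y T 0 f (fun _ => x) ∂(H.γ y 0) = 0) {t k : ℕ} (htk : t + k = T)
    (u : ℝ) :
    Tendsto (fun N : ℕ => ∫ ω, Complex.exp (Complex.I *
        (u * (√N * A.pathHat y (ξ N) (I N) t (H.forwardInt y k t f) ω) : ℝ)) ∂μ) atTop
      (𝓝 (Real.exp (-(u ^ 2 * A.pathVar y T f t / 2)) : ℝ)) := by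
  induction t generalizing k with
  | zero =>
    obtain rfl : k = T := by omega
    have hlim := IsCondIIDAverage.tendsto_integral_cexp (u := u) (c := 1)
      (v := ∫ x, A.w₀ y x ^ 2 * H.forwardInt y k 0 f (fun _ => x) ^ 2 ∂A.ρ₀)
      (fun N _ => (hF N).isCondIIDAverage_pathHat_zero hC hf hK le_rfl)
      (by simp [h0]) (integral_nonneg fun _ => by positivity) (by simp [h0])
    simpa [pathVar] using hlim
  | succ t ih =>
    obtain rfl : t + (k + 1) = T := by omega
    have hlim := IsCondIIDAverage.tendsto_integral_cexp (fun N hN =>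
      (hF N).isCondIIDAverage_pathHat_succ hC hN hf hK le_rfl hdep) (ih rfl)
      (mul_nonneg (integral_nonneg fun x => (A.ϑ_pos _ x).le) (secondMoment_nonneg _ _ _))
      (tendsto_lintegral_enorm_condVariance_sub hF hC hf hK le_rfl hdep h0)
    rw [← Complex.ofReal_mul, ← Real.exp_add] at hlim
    convert hlim using 4
    rw [pathVar, pathVar, Finset.sum_range_succ, show t + (k + 1) - (t + 1) = k by omega]
    ring

end CentralLimit

end Proposal

end FFBS

namespace FFBS

variable {X Y : Type*} [MeasurableSpace X] [MeasurableSpace Y] {H : HMM X Y} {y : ℕ → Y} {T : ℕ}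
  {C : ℝ}

namespace HMM

lemma measurable_lift {h : (Fin (T + 1) → X) → ℝ} (hh : Measurable h) : Measurable (lift h) :=
  hh.comp (measurable_pi_lambda _ fun i => measurable_pi_apply (i : ℕ))

lemma dependsOn_lift {E : Type*} (h : (Fin (T + 1) → E) → ℝ) : DependsOn (lift h) (Set.Iic T) :=
  fun _ _ hx => congrArg h (funext fun i => hx i (Nat.lt_succ_iff.1 i.2))

lemma unnormSmooth_eq (h : (Fin (T + 1) → X) → ℝ) :
    H.unnormSmooth y h = ∫ x, H.forwardInt y T 0 (lift h) (fun _ => x) ∂(H.γ y 0) :=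
  (integral_withDensity_g H.χ 0 _).symm

lemma unnormSmooth_one (hg : ∀ s ≤ T, ∀ x, H.g y s x ≤ C) :
    H.unnormSmooth y (T := T) (fun _ => 1) = (H.γ y T).real Set.univ := by
  have hforward := integral_γ_forwardInt_one hg T (zero_add T).le
  rw [zero_add] at hforward
  exact (unnormSmooth_eq _).trans hforward

lemma real_γ_univ_pos (hg : ∀ s ≤ T, ∀ x, H.g y s x ≤ C)
    (hg_pos : ∀ s ≤ T, ∀ x, 0 < H.g y s x) {t : ℕ} (ht : t ≤ T) :
    0 < (H.γ y t).real Set.univ := by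
  have := isFiniteMeasure_γ hg ht
  have : NeZero (H.γ y t) := ⟨γ_ne_zero hg_pos ht⟩
  exact measureReal_univ_pos

lemma unnormSmooth_sub_const (hg : ∀ s ≤ T, ∀ x, H.g y s x ≤ C) {h : (Fin (T + 1) → X) → ℝ}
    (hh : Measurable h) {K : ℝ} (hK : ∀ x, |h x| ≤ K) (c : ℝ) :
    H.unnormSmooth y (fun z => h z - c)
      = H.unnormSmooth y h - c * H.unnormSmooth y (T := T) fun _ => 1 := by
  have := isFiniteMeasure_γ hg T.zero_le
  have integrable_forwardInt {f : (ℕ → X) → ℝ} (hf : Measurable f) {K : ℝ} (hK : ∀ x, |f x| ≤ K) :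
      Integrable (fun x => H.forwardInt y T 0 f (fun _ => x)) (H.γ y 0) :=
    integrable_of_abs_le ((measurable_forwardInt hf T 0).comp
      (measurable_pi_lambda _ fun _ => measurable_id))
      fun x => abs_forwardInt_le hg hK T (zero_add T).le _
  have forwardInt_sub (x : X) : H.forwardInt y T 0 (lift fun z => h z - c) (fun _ => x)
      = H.forwardInt y T 0 (lift h) (fun _ => x)
        - c * H.forwardInt y T 0 (lift (T := T) fun _ => 1) (fun _ => x) := by
    rw [← forwardInt_sub_mul hg (measurable_lift hh) (measurable_lift measurable_const)
      (fun x => hK _) (fun _ => abs_one.le) c T (zero_add T).le]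
    simp only [lift, mul_one]
    rfl
  simp only [unnormSmooth_eq, forwardInt_sub]
  rw [integral_sub (integrable_forwardInt (measurable_lift hh) fun _ => hK _)
    ((integrable_forwardInt (measurable_lift measurable_const) fun _ => abs_one.le).const_mul _),
    integral_const_mul]

lemma unnormSmooth_sub_smooth (hg : ∀ s ≤ T, ∀ x, H.g y s x ≤ C)
    (hg_pos : ∀ s ≤ T, ∀ x, 0 < H.g y s x) {h : (Fin (T + 1) → X) → ℝ} (hh : Measurable h) {K : ℝ}
    (hK : ∀ x, |h x| ≤ K) :
    H.unnormSmooth y (fun z => h z - H.smooth y h) = 0 := by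
  have hpos := real_γ_univ_pos hg hg_pos le_rfl
  rw [← unnormSmooth_one hg] at hpos
  rw [unnormSmooth_sub_const hg hh hK, smooth, div_mul_cancel₀ _ hpos.ne', sub_self]

lemma integral_φ_F_one {Cm : ℝ} (hg : ∀ s ≤ T, ∀ x, H.g y s x ≤ C)
    (hg_pos : ∀ s ≤ T, ∀ x, 0 < H.g y s x) (hm : ∀ x x', H.m x x' ≤ Cm) {t : ℕ} (ht : t ≤ T) :
    ∫ x, H.F y (T := T) t x (fun _ => 1) ∂(H.φ y t)
      = (H.γ y T).real Set.univ / (H.γ y t).real Set.univ := by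
  obtain ⟨k, rfl⟩ := Nat.exists_eq_add_of_le ht
  have hforward := integral_γ_forwardInt_one hg (t + k) (zero_add _).le
  rw [zero_add] at hforward
  rw [integral_φ, ← hforward, ← integral_γ_backwardInt hg hg_pos hm (f := fun _ => 1)
    measurable_const (fun _ => abs_one.le) (fun _ _ _ => rfl) le_rfl]
  simp only [F, L, Nat.add_sub_cancel_left]
  rfl

end HMM

namespace Proposal

variable {A : Proposal H}

lemma asymVar_nonneg (h : (Fin (T + 1) → X) → ℝ) : 0 ≤ A.asymVar y h :=
  add_nonneg (div_nonneg (integral_nonneg fun _ => by positivity) (sq_nonneg _))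
    (Finset.sum_nonneg fun t _ => div_nonneg (mul_nonneg (secondMoment_nonneg (t + 1) _ _)
      (integral_nonneg fun x => (A.ϑ_pos _ x).le)) (sq_nonneg _))

lemma asymVar_eq (hC : A.BoundedBy y T C) (h : (Fin (T + 1) → X) → ℝ) :
    A.asymVar y h = A.pathVar y T (HMM.lift fun z => h z - H.smooth y h) T
      / (H.γ y T).real Set.univ ^ 2 := by
  have hpos {t : ℕ} (ht : t ≤ T) := HMM.real_γ_univ_pos hC.g_le hC.g_pos ht
  have hF_one : ∫ x, A.w₀ y x * H.F y (T := T) 0 x (fun _ => 1) ∂A.ρ₀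
      = (H.γ y T).real Set.univ := by
    rw [integral_w₀_mul, ← HMM.unnormSmooth_one hC.g_le, HMM.unnormSmooth_eq]
    rfl
  rw [asymVar, hF_one, pathVar, add_div, Finset.sum_div]
  refine congrArg₂ _ rfl (Finset.sum_congr rfl fun t ht => ?_)
  have htT : t ≤ T := (Finset.mem_range.1 ht).le
  rw [HMM.integral_φ_F_one hC.g_le hC.g_pos hC.m_le htT, HMM.integral_φ, HMM.integral_φ]
  have hγt := (hpos htT).ne'
  have hγT := (hpos le_rfl).ne'
  change (∫ x, A.upsilon y (t + 1) x h ∂(H.γ y t)) / _ * _ / _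
    = (∫ x, A.ϑ (t + 1) x ∂(H.γ y t)) * (∫ x, A.upsilon y (t + 1) x h ∂(H.γ y t)) / _
  field_simp

section

variable {Ω : Type*} {N : ℕ} {ξ : ℕ → Fin N → Ω → X} {I : ℕ → Fin N → Ω → Fin N}

lemma filterHat_univ_eq_one {t : ℕ} {ω : Ω}
    (h : ∑ i, ENNReal.ofReal (A.weight y ξ I t i ω) ≠ 0) : A.filterHat y ξ I t ω Set.univ = 1 := by
  rw [filterHat, Measure.smul_apply, smul_eq_mul, sum_smul_dirac_univ]
  exact ENNReal.inv_mul_cancel h (ENNReal.sum_ne_top.2 fun _ _ => ENNReal.ofReal_ne_top)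

lemma γHat_eq_univ_smul_filterHat (t : ℕ) (ω : Ω) :
    A.γHat y ξ I t ω = A.γHat y ξ I t ω Set.univ • A.filterHat y ξ I t ω := by
  rw [γHat_eq_smul_filterHat, Measure.smul_apply, smul_eq_mul]
  by_cases h : ∑ i, ENNReal.ofReal (A.weight y ξ I t i ω) = 0
  · simp only [h, mul_zero, zero_mul]
  · rw [filterHat_univ_eq_one h, mul_one]

lemma pathHat_lift (h : (Fin (T + 1) → X) → ℝ) (ω : Ω) :
    A.pathHat y ξ I T (HMM.lift h) ω
      = (A.γHat y ξ I T ω).real Set.univ * A.smoothHat y ξ I h ω := by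
  rw [pathHat, γHat_eq_univ_smul_filterHat, integral_smul_measure, smul_eq_mul,
    ← γHat_eq_univ_smul_filterHat]
  rfl

lemma pathHat_sub_const (hC : A.BoundedBy y T C) {t : ℕ} {f : (ℕ → X) → ℝ} (hf : Measurable f)
    {K : ℝ} (hK : ∀ x, |f x| ≤ K) (c : ℝ) (ω : Ω) :
    A.pathHat y ξ I t (fun z => f z - c) ω
      = A.pathHat y ξ I t f ω - c * A.pathHat y ξ I t (fun _ => 1) ω := by
  have backwardInt_sub_const (x : ℕ → X) :
      H.backwardInt (fun s => A.filterHat y ξ I s ω) t (fun z => f z - c) x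
        = H.backwardInt (fun s => A.filterHat y ξ I s ω) t f x
          - c * H.backwardInt (fun s => A.filterHat y ξ I s ω) t (fun _ => 1) x := by
    rw [HMM.backwardInt_sub hC.m_le _ hf measurable_const (K := max K |c|)
      (fun x => (hK x).trans (le_max_left _ _)) (fun _ => le_max_right _ _) t x,
      ← HMM.backwardInt_const_mul, mul_one]
  have integrable_backwardInt {f : (ℕ → X) → ℝ} (hf : Measurable f) {K : ℝ}
      (hK : ∀ x, |f x| ≤ K) :
      Integrable (fun x => H.backwardInt (fun s => A.filterHat y ξ I s ω) t f (fun _ => x))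
        (A.γHat y ξ I t ω) :=
    integrable_of_abs_le ((HMM.measurable_backwardInt _ hf t).comp
      (measurable_pi_lambda _ fun _ => measurable_id))
      fun _ => HMM.abs_backwardInt_le hC.m_le _ hK _ _
  simp only [pathHat, backwardInt_sub_const]
  rw [integral_sub (integrable_backwardInt hf hK)
    ((integrable_backwardInt measurable_const fun _ => abs_one.le).const_mul _),
    integral_const_mul]

variable [MeasurableSpace Ω] {μ : Measure Ω}

lemma IsParticleFilter.measurable_smoothHat (hF : A.IsParticleFilter y ξ I μ T)
    {h : (Fin (T + 1) → X) → ℝ} (hh : Measurable h) : Measurable (A.smoothHat y ξ I h) := by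
  let η : Kernel Ω X := ⟨A.filterHat y ξ I T, measurable_filterHat (t := T)
    (fun s _ => hF.measurable_ξ s) (fun s _ => hF.measurable_weight s) le_rfl⟩
  have : IsFiniteKernel η := ⟨1, ENNReal.one_lt_top, filterHat_univ_le_one T⟩
  exact (StronglyMeasurable.integral_kernel_prod_right (κ := η)
    (hF.measurable_backwardInt T (HMM.measurable_lift hh)).stronglyMeasurable).measurable

lemma IsParticleFilter.pathHat_lift_sub_const_ae_eq [IsProbabilityMeasure μ]
    (hF : A.IsParticleFilter y ξ I μ T) (hC : A.BoundedBy y T C) (hN : N ≠ 0)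
    {h : (Fin (T + 1) → X) → ℝ} (hh : Measurable h) {K : ℝ} (hK : ∀ x, |h x| ≤ K) (c : ℝ) :
    A.pathHat y ξ I T (HMM.lift fun z => h z - c)
      =ᵐ[μ] fun ω => (A.γHat y ξ I T ω).real Set.univ * (A.smoothHat y ξ I h ω - c) := by
  filter_upwards [hF.pathHat_one_ae_eq hC hN le_rfl] with ω hone
  rw [mul_sub, ← pathHat_lift, mul_comm _ c, ← hone]
  exact pathHat_sub_const hC (HMM.measurable_lift hh) (fun _ => hK _) c ω

end

section

variable {Ω : Type*} [MeasurableSpace Ω] {μ : Measure Ω} [IsProbabilityMeasure μ]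
  {ξ : (N : ℕ) → ℕ → Fin N → Ω → X} {I : (N : ℕ) → ℕ → Fin N → Ω → Fin N}
  (hF : ∀ N, A.IsParticleFilter y (ξ N) (I N) μ T) (hC : A.BoundedBy y T C)

include hF hC

lemma tendstoInMeasure_real_γHat_univ {t : ℕ} (ht : t ≤ T) :
    TendstoInMeasure μ (fun N ω => (A.γHat y (ξ N) (I N) t ω).real Set.univ) atTop
      (fun _ => (H.γ y t).real Set.univ) := by
  refine tendstoInMeasure_of_tendsto_eLpNorm one_ne_zero
    (fun N => ((hF N).measurable_real_γHat_univ t).aestronglyMeasurable)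
    aestronglyMeasurable_const ?_
  simp only [eLpNorm_one_eq_lintegral_enorm, Pi.sub_apply]
  simpa using tendsto_lintegral_enorm_γHat_sub hF hC ht (f := fun _ => 1) measurable_const
    fun _ => abs_one.le

lemma tendstoInDistribution_pathHat {h : (Fin (T + 1) → X) → ℝ} (hh : Measurable h) {K : ℝ}
    (hK : ∀ x, |h x| ≤ K) :
    TendstoInDistribution (fun (N : ℕ) ω => √N * (A.pathHat y (ξ N) (I N) T
        (HMM.lift fun z => h z - H.smooth y h) ω / (H.γ y T).real Set.univ))
      atTop (id : ℝ → ℝ) (fun _ => μ) (gaussianReal 0 (A.asymVar y h).toNNReal) := by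
  have hf := HMM.measurable_lift (hh.sub_const (H.smooth y h))
  have hKf (x : ℕ → X) : |HMM.lift (fun z => h z - H.smooth y h) x| ≤ K + |H.smooth y h| :=
    (abs_sub _ _).trans (add_le_add (hK _) le_rfl)
  have hmeas (N : ℕ) : Measurable fun ω => √N * (A.pathHat y (ξ N) (I N) T
      (HMM.lift fun z => h z - H.smooth y h) ω / (H.γ y T).real Set.univ) :=
    (((hF N).measurable_pathHat T hf).div_const _).const_mul _
  refine ⟨fun N => (hmeas N).aemeasurable, aemeasurable_id,
    ProbabilityMeasure.tendsto_iff_tendsto_charFun.2 fun u => ?_⟩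
  have hcentred := HMM.unnormSmooth_sub_smooth hC.g_le hC.g_pos hh hK
  rw [HMM.unnormSmooth_eq] at hcentred
  have hlim := tendsto_charFun_pathHat hF hC hf hKf (HMM.dependsOn_lift _) hcentred
    (add_zero T) (u / (H.γ y T).real Set.univ)
  simp only [ProbabilityMeasure.coe_mk, Measure.map_id, charFun_gaussianReal]
  convert hlim using 2 with N
  · rw [charFun_apply_real, integral_map (hmeas N).aemeasurable (by fun_prop)]
    congr 1 with ω
    simp only [HMM.forwardInt]
    congr 1
    push_cast
    ring
  · rw [Real.coe_toNNReal _ (asymVar_nonneg h), asymVar_eq hC]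
    push_cast
    congr 1
    ring

end

end Proposal

end FFBS

theorem mainTheorem2_general {X Y : Type*} [MeasurableSpace X] [MeasurableSpace Y]
    (H : FFBS.HMM X Y) (A : FFBS.Proposal H) (y : ℕ → Y) (T : ℕ)
    (hg : H.BoundedLikelihood y T) (hw : A.BoundedWeights y T)
    (hm : ∃ C : ℝ, ∀ x x', H.m x x' ≤ C)
    {Ω : Type*} [MeasurableSpace Ω] (μ : Measure Ω) [IsProbabilityMeasure μ]
    (ξ : (N : ℕ) → ℕ → Fin N → Ω → X) (I : (N : ℕ) → ℕ → Fin N → Ω → Fin N)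
    (hξ : ∀ N, A.IsParticleFilter y (ξ N) (I N) μ T)
    (h : (Fin (T + 1) → X) → ℝ) (h_meas : Measurable h) (h_bdd : ∃ C : ℝ, ∀ x, |h x| ≤ C) :
    0 ≤ A.asymVar y h ∧
    TendstoInDistribution
      (fun (N : ℕ) (ω : Ω) => √(N : ℝ) * (A.smoothHat y (ξ N) (I N) h ω - H.smooth y h))
      atTop (id : ℝ → ℝ) (fun _ => μ) (gaussianReal 0 (A.asymVar y h).toNNReal) := by
  obtain ⟨C, hC⟩ := FFBS.Proposal.exists_boundedBy hg hw hm
  obtain ⟨K, hK⟩ := h_bdd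
  have hpos : 0 < (H.γ y T).real Set.univ := FFBS.HMM.real_γ_univ_pos hC.g_le hC.g_pos le_rfl
  refine ⟨FFBS.Proposal.asymVar_nonneg h, FFBS.tendstoInDistribution_of_ae_eq_mul hpos
    (FFBS.Proposal.tendstoInDistribution_pathHat hξ hC h_meas hK)
    (fun N => (((hξ N).measurable_smoothHat h_meas).sub_const _).const_mul _)
    (fun N => (hξ N).measurable_real_γHat_univ T)
    (FFBS.Proposal.tendstoInMeasure_real_γHat_univ hξ hC le_rfl) fun N => ?_⟩
  rcases eq_or_ne N 0 with rfl | hN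
  · simp
  filter_upwards [(hξ N).pathHat_lift_sub_const_ae_eq hC hN h_meas hK (H.smooth y h)] with ω hω
  rw [hω]
  field_simp

theorem mainTheorem2 {X Y : Type*}
    [TopologicalSpace X] [PolishSpace X] [MeasurableSpace X] [BorelSpace X]
    [TopologicalSpace Y] [PolishSpace Y] [MeasurableSpace Y] [BorelSpace Y]
    (H : FFBS.HMM X Y) (A : FFBS.Proposal H) (y : ℕ → Y) (T : ℕ)
    (hg : H.BoundedLikelihood y T)
    (hw : A.BoundedWeights y T)
    (hd : A.BoundedDensities T)
    {Ω : Type*} [MeasurableSpace Ω] (μ : Measure Ω) [IsProbabilityMeasure μ]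
    (ξ : (N : ℕ) → ℕ → Fin N → Ω → X) (I : (N : ℕ) → ℕ → Fin N → Ω → Fin N)
    (hξ : ∀ N, A.IsParticleFilter y (ξ N) (I N) μ T)
    (h : (Fin (T + 1) → X) → ℝ) (h_meas : Measurable h) (h_bdd : ∃ C : ℝ, ∀ x, |h x| ≤ C) :
    0 ≤ A.asymVar y h ∧
    TendstoInDistribution
      (fun (N : ℕ) (ω : Ω) => √(N : ℝ) * (A.smoothHat y (ξ N) (I N) h ω - H.smooth y h))
      atTop (id : ℝ → ℝ) (fun _ => μ) (gaussianReal 0 (A.asymVar y h).toNNReal) :=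
  mainTheorem2_general H A y T hg hw hd.1 μ ξ I hξ h h_meas h_bdd
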